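/- Let $d\ge 2$, and write $d(x,y)$ for the $\ell^1$-distance on $\mathbb Z^d$ and $e_1,\dots,e_d$ for the standard basis. An environment $\omega$ assigns to each $x\in\mathbb Z^d$ a probability vector $(\omega(x,v))_{v\in\mathbb Z^d,\,|v|\le 1}$; put $\omega_x=(\omega(x,v))_v$. Let $P$ be a probability measure on environments that is invariant under the translations of $\mathbb Z^d$ and uniformly elliptic: for some $\kappa>0$, $P$-a.s. $\omega(x,e)>\kappa$ for all $x$ and all unit vectors $e\in\mathbb Z^d$. Assume that $P$ satisfies condition (G) with some integer $r\ge 1$, that is: (i) ($r$-Markov) for every finite $V\subset\mathbb Z^d$, $P((\omega_x)_{x\in V}\in\cdot\mid\omega_y,\,y\notin V)=P((\omega_x)_{x\in V}\in\cdot\mid \omega_y,\,y\in\partial_rV)$ $P$-a.s., where $\partial_rV=\{x\notin V: d(x,V)\le r\}$; (ii) there are $\gamma>0$ and $C_0<\infty$ such that for all finite $\Delta\subset V\subset\mathbb Z^d$ with $d(\Delta,V^c)\ge r$ and all $A\subset V^c$, $$P\big((\omega_x)_{x\in\Delta}\in\cdot\mid\eta\big)\le \exp\Big(C_0\sum_{x\in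 A,\,y\in\Delta}e^{-\gamma d(x,y)}\Big)\,P\big((\omega_x)_{x\in\Delta}\in\cdot\mid\eta'\big)$$ for all $\eta,\eta'$ in a set of full $P$-measure of configurations on $V^c$ which agree on $V^c\setminus A$, where $P(\cdot\mid\eta)$ is the regular conditional law given that the environment on $V^c$ is $\eta$. Let $\mathbb P$ be the annealed law of $(\omega,X)$, where, given $\omega$, $X=(X_n)_{n\ge0}$ is the Markov chain with $X_0=0$ that jumps from $x$ to $x+v$ with probability $\omega(x,v)$. Assume that $v_{e_1}>0$, where $v_{e_1}\ge0$ is the deterministic number with $X_n\cdot e_1/n\to v_{e_1}$ $\mathbb P$-a.s. on the event $\{X_n\cdot e_1\to\infty\}$ (and $v_{e_1}=0$ if this event has probability zero). *Coins.* Let $\epsilon=(\epsilon_{n,x})_{n\ge 0,x\in\mathbb Z^d}$ be iid, independent of $\omega$, equal to $1$ with probability $d\kappa$ and to $0$ otherwise. Let $\bar{\mathbb P}$ be the law of $(\omega,\epsilon,X)$ for which, given $(\omega,\epsilon)$, $X$ is the Markov chain from $X_0=0$ whose step at time $n$ from $z$ is uniform on the $2d$ unit vectors if $\epsilon_{n,z}=1$,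 and if $\epsilon_{n,z}=0$ equals a unit vector $e$ with probability $(\omega(z,e)-\kappa/2)/(1-d\kappa)$ and $0$ with probability $\omega(z,0)/(1-d\kappa)$. *Conditioned law.* For $c_5>0$ and a path $X$ let $$R=\inf\Big\{n\ge 0:\ \#\{0\le i\le n:X_i\cdot e_1=X_0\cdot e_1+j\}>c_5(j+1)^2\text{ for some }j\ge0\Big\}\wedge\inf\{n\ge1:X_n\cdot e_1\le X_0\cdot e_1\}.$$ Put $\hat{\mathbb P}=\bar{\mathbb P}(\cdot\mid R=\infty)$, where $c_5$ is such that $\mathbb P(R=\infty)>0$. *Regeneration times.* For $L\in\mathbb N$ let $R_0=0$ and, for $k\ge0$, let $S_{k+1}$ be the least $n\ge\max(R_k,L)$ such that $X_{n-L}\cdot e_1>X_m\cdot e_1$ for all $0\le m<n-L$, and $\epsilon_{n-i,X_{n-i}}=1$, $X_{n-i+1}-X_{n-i}=e_1$ for all $1\le i\le L$; let $R_{k+1}=S_{k+1}+R\circ\theta_{S_{k+1}}$, where $\theta_m$ is the time shift (of path and coins) by $m$ and $\inf\emptyset=\infty$. Let $\tau_1=S_K$, where $K$ is the least $k\ge1$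 with $S_k<\infty$ and $R_k=\infty$ ($\tau_1=\infty$ if there is none), $\tau_0=0$ and $\tau_{k+1}=\tau_k+\tau_1\circ\theta_{\tau_k}$. For $n\ge1$ let $Q(n,x)=\hat{\mathbb P}(X_m=x\text{ for some }m\in[\tau_{n-1},\tau_n))$. **Theorem.** Under these assumptions there is $c_5>0$ with $\mathbb P(R=\infty)>0$. Moreover, for every such $c_5$ there is $L_0$ such that for every $L\ge L_0$ all $\tau_n$ are $\hat{\mathbb P}$-a.s. finite, and there is a constant $C<\infty$ such that for all $n\ge1$ and all $x\in\mathbb Z^d$ $$\hat{\mathbb P}(X_{\tau_n}=x)\le C\,n^{-d/2},\qquad \sum_{y\in\mathbb Z^d}Q(n,y)^2\le C\,(E_{\hat{\mathbb P}}\tau_1)^2\,n^{-d/2}.$$ -/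

import Mathlib

open MeasureTheory ProbabilityTheory Filter
open scoped ENNReal Topology

noncomputable section

namespace RWRE

/-! ## Environments -/

/-- The lattice `ℤ^d`. -/
abbrev Site (d : ℕ) : Type := Fin d → ℤ

/-- The unit lattice vectors `± e_i`, encoded as `(i, true)` for `e_i` and `(i, false)` for `- e_i`. -/
abbrev UnitStep (d : ℕ) : Type := Fin d × Bool

/-- The vectors `v` of `ℤ^d` with `|v| ≤ 1`: the zero vector (`none`) and the unit vectors. -/
abbrev Step (d : ℕ) : Type := Option (UnitStep d)

/-- The element of `ℤ^d` encoded by a step. -/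
def stepVec {d : ℕ} : Step d → Site d
  | none => 0
  | some (i, true) => Pi.single i 1
  | some (i, false) => Pi.single i (-1)

/-- The space of probability measures on the finite set of steps, as a simplex. -/
abbrev StepLaw (d : ℕ) : Type := stdSimplex ℝ (Step d)

/-- The space of environments `ω`; `(ω x).1 v` is the probability `ω(x, v)` of jumping from `x` to
`x + v`. It carries the product `σ`-field. -/
abbrev Env (d : ℕ) : Type := Site d → StepLaw d

instance instNonemptyStepLaw (d : ℕ) : Nonempty (StepLaw d) :=
  ⟨⟨Pi.single none 1, single_mem_stdSimplex ℝ none⟩⟩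

instance instStandardBorelStepLaw (d : ℕ) : StandardBorelSpace (StepLaw d) :=
  (isClosed_stdSimplex ℝ (Step d)).measurableSet.standardBorel

/-- The `ℓ¹`-distance on `ℤ^d`. -/
def dist1 {d : ℕ} (x y : Site d) : ℕ := ∑ i, (x i - y i).natAbs

/-- The `r`-boundary of `V`: the points outside `V` at `ℓ¹`-distance at most `r` from `V`. -/
def rBoundary {d : ℕ} (r : ℕ) (V : Set (Site d)) : Set (Site d) :=
  {x | x ∉ V ∧ ∃ y ∈ V, dist1 x y ≤ r}

/-- The `σ`-field generated by the environment at the sites of `Λ`. -/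
@[reducible]
def envField {d : ℕ} (Λ : Set (Site d)) : MeasurableSpace (Env d) :=
  ⨆ x ∈ Λ, MeasurableSpace.comap (fun ω : Env d => ω x) inferInstance

/-- The restriction `(ω_x)_{x ∈ Λ}` of an environment to the sites of `Λ`. -/
def restrictEnv {d : ℕ} (Λ : Set (Site d)) (ω : Env d) : Λ → StepLaw d := fun x => ω x

/-- The spatial shift `(θ^y ω)_x = ω_{x+y}`. -/
def shiftEnv {d : ℕ} (y : Site d) (ω : Env d) : Env d := fun x => ω (x + y)

/-- The law of the environment is invariant under spatial shifts. -/
def TranslationInvariant {d : ℕ} (P : Measure (Env d)) : Prop :=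
  ∀ y : Site d, P.map (shiftEnv y) = P

/-- Uniform ellipticity with constant `κ`: almost surely `ω(x, e) > κ` for all sites `x` and all
unit vectors `e`. -/
def UniformlyElliptic {d : ℕ} (P : Measure (Env d)) (κ : ℝ) : Prop :=
  ∀ᵐ ω ∂P, ∀ (x : Site d) (e : UnitStep d), κ < (ω x).1 (some e)

/-- The `r`-Markov property: for finite `V`, conditioning the environment in `V` on the environment
outside `V` is the same as conditioning it on the environment on the `r`-boundary of `V`. -/
def IsRMarkov {d : ℕ} (P : Measure (Env d)) (r : ℕ) : Prop :=
  ∀ (V : Set (Site d)), V.Finite → ∀ B : Set (V → StepLaw d), MeasurableSet B →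
    P[(restrictEnv V ⁻¹' B).indicator (fun _ => (1 : ℝ)) | envField Vᶜ] =ᵐ[P]
      P[(restrictEnv V ⁻¹' B).indicator (fun _ => (1 : ℝ)) | envField (rBoundary r V)]

/-- The regular conditional law `P((ω_x)_{x ∈ Δ} ∈ · | η)` given that the environment outside `V`
is `η`. -/
def condLaw {d : ℕ} (P : Measure (Env d)) [IsFiniteMeasure P] (Δ V : Set (Site d)) :
    Kernel (↥Vᶜ → StepLaw d) (↥Δ → StepLaw d) :=
  condDistrib (restrictEnv Δ) (restrictEnv Vᶜ) P

/-- The environment is `r`-Markov, and the mixing condition (G) holds: for some `γ > 0` and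
`C < ∞`, for all finite `Δ ⊆ V` with `d(Δ, Vᶜ) ≥ r` and all `A ⊆ Vᶜ`,
`dP(ω_Δ ∈ · | η) / dP(ω_Δ ∈ · | η') ≤ exp (C ∑_{x ∈ A, y ∈ Δ} e^{-γ d(x, y)})` for almost all `η`, `η'`
(all `η`, `η'` in a set `S` of full measure) which agree on `Vᶜ \ A`. -/
def ConditionG {d : ℕ} (P : Measure (Env d)) [IsFiniteMeasure P] (r : ℕ) : Prop :=
  IsRMarkov P r ∧ ∃ γ : ℝ, 0 < γ ∧ ∃ C : ℝ,
    ∀ Δ V : Set (Site d), V.Finite → Δ ⊆ V → (∀ x ∈ Δ, ∀ y ∉ V, r ≤ dist1 x y) →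
    ∀ A : Set (Site d), A ⊆ Vᶜ →
    ∃ S : Set (↥Vᶜ → StepLaw d),
      (∀ᵐ η ∂(P.map (restrictEnv Vᶜ)), η ∈ S) ∧
      ∀ η ∈ S, ∀ η' ∈ S, (∀ x : ↥Vᶜ, (x : Site d) ∉ A → η x = η' x) →
        ∀ B : Set (↥Δ → StepLaw d), MeasurableSet B →
          condLaw P Δ V η B ≤
            ENNReal.ofReal (Real.exp (C * ∑' (x : A) (y : Δ), Real.exp (-γ * dist1 (x : Site d) y)))
              * condLaw P Δ V η' B

/-! ## Markov chains on the lattice -/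

/-- Infinite sequences of sites. -/
abbrev Path (d : ℕ) : Type := ℕ → Site d

/-- The law of `z + v`, where the step `v` is chosen according to `q`. -/
def nextLaw {d : ℕ} (q : StepLaw d) (z : Site d) : Measure (Site d) :=
  ∑ v, ENNReal.ofReal (q.1 v) • Measure.dirac (z + stepVec v)

instance instIsProbabilityMeasureNextLaw {d : ℕ} (q : StepLaw d) (z : Site d) :
    IsProbabilityMeasure (nextLaw q z) where
  measure_univ := by
    have h := q.2.2
    simp only [nextLaw, Measure.coe_finsetSum, Finset.sum_apply, Measure.smul_apply, measure_univ,
      smul_eq_mul, mul_one]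
    rw [← ENNReal.ofReal_sum_of_nonneg fun v _ => q.2.1 v, h, ENNReal.ofReal_one]

/-- One step of the chain that, at time `n` in state `z`, chooses its step according to `p n z`. -/
def stepKernel {d : ℕ} (p : ℕ → Site d → StepLaw d) (n : ℕ) :
    Kernel ((i : Finset.Iic n) → Site d) (Site d) :=
  Kernel.ofFunOfCountable fun h =>
    nextLaw (p n (h ⟨n, Finset.mem_Iic.2 le_rfl⟩)) (h ⟨n, Finset.mem_Iic.2 le_rfl⟩)

instance instIsMarkovKernelStepKernel {d : ℕ} (p : ℕ → Site d → StepLaw d) (n : ℕ) :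
    IsMarkovKernel (stepKernel p n) :=
  ⟨fun _ => instIsProbabilityMeasureNextLaw _ _⟩

/-- The law of the (time-inhomogeneous) Markov chain `(X_n)` with `X_0 = x` that, at time `n` in
state `z`, chooses its step according to `p n z`. -/
def chainLaw {d : ℕ} (p : ℕ → Site d → StepLaw d) (x : Site d) : Measure (Path d) :=
  Kernel.traj (X := fun _ => Site d) (stepKernel p) 0 (fun _ => x)

instance instIsProbabilityMeasureChainLaw {d : ℕ} (p : ℕ → Site d → StepLaw d) (x : Site d) :
    IsProbabilityMeasure (chainLaw p x) := by
  unfold chainLaw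
  infer_instance

lemma measurable_nextLaw {d : ℕ} {Θ : Type*} [MeasurableSpace Θ] {q : Θ → StepLaw d}
    (hq : Measurable q) (z : Site d) : Measurable fun θ => nextLaw (q θ) z := by
  refine Measure.measurable_of_measurable_coe _ fun s _ => ?_
  simp only [nextLaw, Measure.coe_finsetSum, Finset.sum_apply, Measure.smul_apply, smul_eq_mul]
  refine Finset.measurable_sum _ fun v _ => Measurable.mul_const ?_ _
  exact ENNReal.measurable_ofReal.comp ((measurable_pi_apply v).comp (measurable_subtype_coe.comp hq))

lemma measurable_partialTraj {d : ℕ} {Θ : Type*} [MeasurableSpace Θ]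
    {p : Θ → ℕ → Site d → StepLaw d} (hp : ∀ n z, Measurable fun θ => p θ n z) (x : Site d) (n : ℕ) :
    Measurable fun θ =>
      Kernel.partialTraj (X := fun _ => Site d) (stepKernel (p θ)) 0 n (fun _ => x) := by
  induction n with
  | zero => simp [Kernel.partialTraj_self]
  | succ n ih =>
    refine Measure.measurable_of_measurable_coe _ fun s hs => ?_
    have key : ∀ θ, Kernel.partialTraj (X := fun _ => Site d) (stepKernel (p θ)) 0 (n + 1)
          (fun _ => x) s =
        ∑' h : ((i : Finset.Iic n) → Site d),
          nextLaw (p θ n (h ⟨n, Finset.mem_Iic.2 le_rfl⟩)) (h ⟨n, Finset.mem_Iic.2 le_rfl⟩)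
            {y | IicProdIoc (X := fun _ => Site d) n (n + 1)
              (h, MeasurableEquiv.piSingleton (X := fun _ => Site d) n y) ∈ s} *
          Kernel.partialTraj (X := fun _ => Site d) (stepKernel (p θ)) 0 n (fun _ => x) {h} := by
      intro θ
      rw [Kernel.partialTraj_succ_eq_comp (Nat.zero_le n), Kernel.comp_apply' _ _ _ hs,
        lintegral_countable']
      refine tsum_congr fun h => ?_
      congr 1
      rw [Kernel.partialTraj_succ_self, Kernel.map_apply' _ (by fun_prop) _ hs,
        Kernel.prod_apply, Kernel.id_apply, Measure.dirac_prod]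
      have hs' := measurable_IicProdIoc (X := fun _ => Site d) (m := n) (n := n + 1) hs
      have hm : Measurable (Prod.mk (β := (i : Finset.Ioc n (n + 1)) → Site d) h) :=
        measurable_prodMk_left
      refine (Measure.map_apply hm hs').trans ?_
      rw [Kernel.map_apply' _ (MeasurableEquiv.measurable _) _ (hm hs')]
      rfl
    simp_rw [key]
    refine Measurable.tsum fun h => Measurable.mul ?_ ?_
    · exact (Measure.measurable_coe (Set.to_countable _).measurableSet).comp
        (measurable_nextLaw (hp n _) _)
    · exact (Measure.measurable_coe (measurableSet_singleton _)).comp ih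

/-- The law of the chain depends measurably on a parameter when its transition probabilities do. -/
lemma measurable_chainLaw {d : ℕ} {Θ : Type*} [MeasurableSpace Θ]
    {p : Θ → ℕ → Site d → StepLaw d} (hp : ∀ n z, Measurable fun θ => p θ n z) (x : Site d) :
    Measurable fun θ => chainLaw (p θ) x := by
  refine Measurable.measure_of_isPiSystem_of_isProbabilityMeasure
    generateFrom_measurableCylinders.symm isPiSystem_measurableCylinders fun t ht => ?_
  obtain ⟨N, S, mS, rfl⟩ : ∃ N S, MeasurableSet S ∧ t = cylinder (Finset.Iic N) S := by
    simpa [measurableCylinders_nat] using ht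
  have key : ∀ θ, chainLaw (p θ) x (cylinder (Finset.Iic N) S) =
      Kernel.partialTraj (X := fun _ => Site d) (stepKernel (p θ)) 0 N (fun _ => x) S := by
    intro θ
    rw [← Kernel.traj_map_frestrictLe_apply, Measure.map_apply (by fun_prop) mS]
    rfl
  simp_rw [key]
  exact (Measure.measurable_coe mS).comp (measurable_partialTraj hp x N)

/-! ## The walk in the random environment -/

/-- The quenched law: the walk in the environment `ω` started at `x`. -/
def quenchedLaw {d : ℕ} (ω : Env d) (x : Site d) : Measure (Path d) :=
  chainLaw (fun _ z => ω z) x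

/-- The quenched law of the walk started at the origin, as a kernel. -/
def quenchedKernel (d : ℕ) : Kernel (Env d) (Path d) where
  toFun ω := quenchedLaw ω 0
  measurable' := measurable_chainLaw (fun _ z => measurable_pi_apply z) 0

instance instIsMarkovKernelQuenchedKernel (d : ℕ) : IsMarkovKernel (quenchedKernel d) :=
  ⟨fun ω => instIsProbabilityMeasureChainLaw (fun _ z => ω z) 0⟩

/-- The annealed law `ℙ` of the pair `(ω, X)`, for the walk started at the origin. -/
def annealedLaw {d : ℕ} (P : Measure (Env d)) : Measure (Env d × Path d) :=
  P ⊗ₘ quenchedKernel d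

/-- The number `v ≥ 0` is the limiting speed `v_{e_1}` in direction `e_1`: almost surely
`X_n · e_1 / n → v` on the event `{X_n · e_1 → ∞}`, and `v = 0` if that event is null. -/
structure IsSpeed {d : ℕ} [NeZero d] (P : Measure (Env d)) (v : ℝ) : Prop where
  nonneg : 0 ≤ v
  tendsto : ∀ᵐ y ∂(annealedLaw P), Tendsto (fun n => y.2 n 0) atTop atTop →
    Tendsto (fun n : ℕ => (y.2 n 0 : ℝ) / n) atTop (𝓝 v)
  eq_zero : annealedLaw P {y | Tendsto (fun n => y.2 n 0) atTop atTop} = 0 → v = 0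

/-! ## Coins -/

/-- The coins `ε = (ε_{n,z})`. -/
abbrev Coins (d : ℕ) : Type := ℕ × Site d → Bool

/-- The law of iid coins, each of which is `1` (that is, `true`) with probability `d κ`. (The
number `d κ` lies in `[0, 1]` when `κ > 0` is an ellipticity constant.) -/
def coinMeasure (d : ℕ) (κ : ℝ) : Measure (Coins d) :=
  Measure.infinitePi fun _ => bernoulliMeasure true false (Set.projIcc 0 1 zero_le_one (d * κ))

instance instIsProbabilityMeasureCoinMeasure (d : ℕ) (κ : ℝ) :
    IsProbabilityMeasure (coinMeasure d κ) := by
  unfold coinMeasure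
  infer_instance

/-- The step probabilities of the walk with coins, where `q` is the environment at the present site
and `b` the present coin: if the coin is `1`, the step is uniform on the unit vectors, otherwise
the step is `e` with probability `(q(e) - κ / 2) / (1 - d κ)` for a unit vector `e`, and the rest
of the mass, which is `q(0) / (1 - d κ)`, is on the zero step. -/
def coinWeight {d : ℕ} (κ : ℝ) (q : StepLaw d) (b : Bool) : Step d → ℝ
  | none => if b then 0 else q.1 none / (1 - d * κ)
  | some e => if b then 1 / (2 * d) else (q.1 (some e) - κ / 2) / (1 - d * κ)

open Classical in
/-- The step law with weights `coinWeight`. These are a probability vector whenever `q(e) > κ > 0`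
for all unit vectors `e` and `d ≥ 1`; otherwise the value plays no role, and `q` is taken. -/
def coinStepLaw {d : ℕ} (κ : ℝ) (q : StepLaw d) (b : Bool) : StepLaw d :=
  if h : coinWeight κ q b ∈ stdSimplex ℝ (Step d) then ⟨coinWeight κ q b, h⟩ else q

/-- The law `P_{ω,ε}^x` of the walk started at `x` in the environment `ω` with the coins `ε`. -/
def coinQuenchedLaw {d : ℕ} (κ : ℝ) (ω : Env d) (ε : Coins d) (x : Site d) : Measure (Path d) :=
  chainLaw (fun n z => coinStepLaw κ (ω z) (ε (n, z))) x

lemma measurable_coinStepLaw {d : ℕ} (κ : ℝ) (b : Bool) :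
    Measurable fun q : StepLaw d => coinStepLaw κ q b := by
  have hw : Measurable fun q : StepLaw d => coinWeight κ q b := by
    refine measurable_pi_lambda _ fun v => ?_
    have h : ∀ v, Measurable fun q : StepLaw d => q.1 v := fun v =>
      (measurable_pi_apply v).comp measurable_subtype_coe
    cases v with
    | none => cases b with
      | false => simpa [coinWeight] using (h none).div_const _
      | true => simp [coinWeight]
    | some e => cases b with
      | false => simpa [coinWeight] using ((h (some e)).sub_const _).div_const _
      | true => simp [coinWeight]
  have hs : MeasurableSet {q : StepLaw d | coinWeight κ q b ∈ stdSimplex ℝ (Step d)} :=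
    hw (isClosed_stdSimplex ℝ (Step d)).measurableSet
  refine Measurable.subtype_mk (h := fun q => (coinStepLaw κ q b).2) ?_ |> fun h => by simpa using h
  have : (fun q : StepLaw d => (coinStepLaw κ q b).1) = fun q => by
      classical exact
        if coinWeight κ q b ∈ stdSimplex ℝ (Step d) then coinWeight κ q b else q.1 := by
    funext q
    unfold coinStepLaw
    split_ifs <;> rfl
  rw [this]
  exact Measurable.ite hs hw measurable_subtype_coe

/-- The laws `P_{ω,ε}^o` as a kernel. -/
def coinQuenchedKernel (d : ℕ) (κ : ℝ) : Kernel (Env d × Coins d) (Path d) where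
  toFun y := coinQuenchedLaw κ y.1 y.2 0
  measurable' := by
    refine measurable_chainLaw
      (p := fun (y : Env d × Coins d) n z => coinStepLaw κ (y.1 z) (y.2 (n, z))) (fun n z => ?_) 0
    have h : Measurable fun u : StepLaw d × Bool => coinStepLaw κ u.1 u.2 :=
      measurable_from_prod_countable_left fun b => measurable_coinStepLaw κ b
    have h' : Measurable fun y : Env d × Coins d => (y.1 z, y.2 (n, z)) :=
      ((measurable_pi_apply z).comp measurable_fst).prodMk
        ((measurable_pi_apply (n, z)).comp measurable_snd)
    exact h.comp h'

instance instIsMarkovKernelCoinQuenchedKernel (d : ℕ) (κ : ℝ) :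
    IsMarkovKernel (coinQuenchedKernel d κ) :=
  ⟨fun y => instIsProbabilityMeasureChainLaw (fun n z => coinStepLaw κ (y.1 z) (y.2 (n, z))) 0⟩

/-- The law `P ⊗ Q ⊗ P_{ω,ε}^o` of the triple `((ω, ε), X)`. -/
def coinAnnealedLaw {d : ℕ} (P : Measure (Env d)) (κ : ℝ) :
    Measure ((Env d × Coins d) × Path d) :=
  (P.prod (coinMeasure d κ)) ⊗ₘ coinQuenchedKernel d κ

/-! ## Regeneration times in direction `e_1`

The first coordinate `x 0` of a site `x` is `x · e_1`. Times take values in `ℕ∞`. -/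

/-- `D`: the first time `n ≥ 1` with `X_n · e_1 ≤ X_0 · e_1`. -/
def backTime {d : ℕ} [NeZero d] (X : Path d) : ℕ∞ :=
  ⨅ (n : ℕ) (_ : 1 ≤ n ∧ X n 0 ≤ X 0 0), (n : ℕ∞)

/-- The number of visits up to time `n` to the level `{x | x · e_1 = X_0 · e_1 + j}`. -/
def levelVisits {d : ℕ} [NeZero d] (X : Path d) (n j : ℕ) : ℕ :=
  ((Finset.range (n + 1)).filter fun i => X i 0 = X 0 0 + j).card

/-- `R`: the first time at which some level `j ≥ 0` has been visited more than `c (j + 1)²` times,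
or `D`, whichever comes first. -/
def stopR {d : ℕ} [NeZero d] (c : ℝ) (X : Path d) : ℕ∞ :=
  (⨅ (n : ℕ) (_ : ∃ j : ℕ, c * (j + 1) ^ 2 < levelVisits X n j), (n : ℕ∞)) ⊓ backTime X

/-- The time shift of a path. -/
def shiftPath {d : ℕ} (n : ℕ) (X : Path d) : Path d := fun i => X (n + i)

/-- The time shift of the coins. -/
def shiftCoins {d : ℕ} (n : ℕ) (ε : Coins d) : Coins d := fun u => ε (n + u.1, u.2)

/-- At time `n - L` the walk is strictly beyond all its earlier levels, and its last `L` steps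
before time `n` were `e_1`, each taken with the coin equal to `1`. -/
def IsCandidate {d : ℕ} [NeZero d] (L : ℕ) (ε : Coins d) (X : Path d) (n : ℕ) : Prop :=
  L ≤ n ∧ (∀ m < n - L, X m 0 < X (n - L) 0) ∧
    ∀ i, 1 ≤ i → i ≤ L →
      ε (n - i, X (n - i)) = true ∧ X (n - i + 1) - X (n - i) = Pi.single 0 1

/-- The first candidate time `n ≥ t`. -/
def candidateTime {d : ℕ} [NeZero d] (L : ℕ) (ε : Coins d) (X : Path d) (t : ℕ∞) : ℕ∞ :=
  ⨅ (n : ℕ) (_ : t ≤ n ∧ IsCandidate L ε X n), (n : ℕ∞)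

/-- The times `R_k`: `R_0 = 0` and `R_{k+1} = S_{k+1} + R ∘ θ_{S_{k+1}}`, where `S_{k+1}` is the first
candidate time from `R_k` on. -/
def timeR {d : ℕ} [NeZero d] (c : ℝ) (L : ℕ) (ε : Coins d) (X : Path d) : ℕ → ℕ∞
  | 0 => 0
  | k + 1 =>
    candidateTime L ε X (timeR c L ε X k) +
      stopR c (shiftPath (candidateTime L ε X (timeR c L ε X k)).toNat X)

/-- `timeS k` is the time `S_{k+1}`. -/
def timeS {d : ℕ} [NeZero d] (c : ℝ) (L : ℕ) (ε : Coins d) (X : Path d) (k : ℕ) : ℕ∞ :=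
  candidateTime L ε X (timeR c L ε X k)

open Classical in
/-- The first regeneration time `τ_1 = S_K`, where `K` is the least `k ≥ 1` such that `S_k < ∞` and
`R_k = ∞` (and `τ_1 = ∞` if there is none). -/
def tauOne {d : ℕ} [NeZero d] (c : ℝ) (L : ℕ) (ε : Coins d) (X : Path d) : ℕ∞ :=
  if h : ∃ k : ℕ, timeS c L ε X k < ⊤ ∧ timeR c L ε X (k + 1) = ⊤ then
    timeS c L ε X (Nat.find h) else ⊤

/-- The regeneration times: `τ_0 = 0` and `τ_{k+1} = τ_k + τ_1 ∘ θ_{τ_k}`. -/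
def tau {d : ℕ} [NeZero d] (c : ℝ) (L : ℕ) (ε : Coins d) (X : Path d) : ℕ → ℕ∞
  | 0 => 0
  | k + 1 =>
    tau c L ε X k +
      tauOne c L (shiftCoins (tau c L ε X k).toNat ε) (shiftPath (tau c L ε X k).toNat X)

/-- The law conditioned on `{R = ∞}`. -/
def hatLaw {d : ℕ} [NeZero d] (P : Measure (Env d)) (κ c : ℝ) :
    Measure ((Env d × Coins d) × Path d) :=
  ProbabilityTheory.cond (coinAnnealedLaw P κ) {y | stopR c y.2 = ⊤}

/-- The regeneration time `τ_n` as a function of the triple `((ω, ε), X)`. -/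
def regTime {d : ℕ} [NeZero d] (c : ℝ) (L n : ℕ) (y : (Env d × Coins d) × Path d) : ℕ∞ :=
  tau c L y.1.2 y.2 n

/-- The event `{X_{τ_n} = x}` (in particular `τ_n < ∞`). -/
def regPosition {d : ℕ} [NeZero d] (c : ℝ) (L n : ℕ) (x : Site d) :
    Set ((Env d × Coins d) × Path d) :=
  {y | ∃ m : ℕ, regTime c L n y = m ∧ y.2 m = x}

/-- `Q(n, x)`: the conditioned probability that `x` is visited in `[τ_{n-1}, τ_n)` (for `n ≥ 1`). -/
def visitProb {d : ℕ} [NeZero d] (P : Measure (Env d)) (κ c : ℝ) (L n : ℕ) (x : Site d) : ℝ≥0∞ :=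
  hatLaw P κ c {y | ∃ m : ℕ, regTime c L (n - 1) y ≤ m ∧ (m : ℕ∞) < regTime c L n y ∧ y.2 m = x}

/-- The conditioned expectation of `τ_1`. -/
def meanTau {d : ℕ} [NeZero d] (P : Measure (Env d)) (κ c : ℝ) (L : ℕ) : ℝ≥0∞ :=
  ∫⁻ y, (regTime c L 1 y : ℝ≥0∞) ∂(hatLaw P κ c)

end RWRE

end

noncomputable section

namespace RWRE

/-! ## Words and tracks -/

/-! Under (G) the pieces of the walk between regenerations are not independent, but their dependence
decays so fast that at least half of the first `n` increments can be replaced by independent ones,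
outside an event of exponentially small probability. Independent increments satisfy the `n^{-d/2}`
bound by an elementary local estimate.

Encoding. The walk meets a fresh coin at each time, so given `ω` the sequence of letters (step,
coin) is a Markov process and the probability of a word is a product of one-site weights
(`trackKernel_cyl`, `trackKernel_markov`). The event `R = ∞` says that every prefix is `Adm`. An
admissible word ending at a strict record may be followed by any good track (`Adm.append`), so
whether a word is a segment between two regenerations can be read off from the word alone
(`isSeg_iff`). The law of the first segments is therefore the integral of the weight of their word
times the quenched probability of `R = ∞` from its endpoint. The last `L` letters of a segment have
weight `(κ/2)^L` in every environment: past and future are separated by a slab of width `L`.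

Decoupling. The bound `c (j+1)²` on the visits to level `j` makes the interaction between an
admissible word above level `0` and any set of sites below level `-t` at most a constant times `exp
(-a t)` (`interaction_sites_le`). With the mixing inequality this lets one forget the environment
below `-t` at the cost of a factor `θ t = exp (D exp (-a t))` (`exists_decouples`, `DecFun.ae`).

Regenerations exist. Positive speed forces some shifted track to be good, hence `P(R = ∞) > 0` for
some `c` (`exists_goodMass_ne_zero`). From each strict record a regeneration has conditional
probability bounded below (`Decouples.le_regen`), and a good track has infinitely many records, so a
zero-one argument (`measure_infinitely_often_diff`) makes all regeneration times finite.

Local bound for independent increments. Explicit segments show that the displacement law of a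
segment dominates a multiple of a translated uniform law on `{0,1}^d`. Powers of the latter are
products of binomials, and a Chernoff argument carried out on operators transfers their bound to
`regOp` (`regOp_pow_le`).

Forgetting. Integrating out the most recent segment turns a functional of the past into its
conditional mean given the environment in the earlier segments (`Decouples.energy_succ`). Each
segment rises by at least `L`, so conditioning on `j + 1` instead of `j` past segments dominates
`p_j = 1 - q_j` times the coarser conditional mean, with `q_j` of order `exp (-a L (j+1))`
(`Decouples.mul_condOp_le`). Thus the memory `ℓ` drops by one per step, except that it is reset to
`j + 1` with probability at most `q_j`; at memory zero the step is an exact independent step of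
`regOp` (`RecentPast.condOp_zero`). The quantity `4^(ℓ-m)`, with `m` the number of independent steps
gained, contracts in mean by `3/8` (`Decouples.energy_le`), and the local bound is used with `m ≥
n/2`.

Visits. One decoupling gives `Q(n, ·) ≤ θ(L)²` times the convolution of the law of `X_{τ_{n-1}}`
with the visits of one segment, whose total mass is at most the mean of `τ_1`; the second estimate
follows from `tsum_conv_sq_le`. -/

instance instMeasurableSpaceStep (d : ℕ) : MeasurableSpace (Step d) := ⊤

instance instDiscreteMeasurableSpaceStep (d : ℕ) : DiscreteMeasurableSpace (Step d) :=
  ⟨fun _ => trivial⟩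

/-- A letter is a step together with the value of the coin that was used for it. -/
abbrev Letter (d : ℕ) : Type := Step d × Bool

/-- The sequence of all steps and coins used by the walk. -/
abbrev Track (d : ℕ) : Type := ℕ → Letter d

lemma stepVec_injective {d : ℕ} : Function.Injective (stepVec : Step d → Site d) := by
  intro a b h
  rcases a with _ | ⟨i, a⟩ <;> rcases b with _ | ⟨j, b⟩
  · rfl
  · have := congrFun h j
    cases b <;> simp [stepVec] at this
  · have := congrFun h i
    cases a <;> simp [stepVec] at this
  · have h1 := congrFun h i
    have hij : i = j := by
      by_contra hne
      cases a <;> cases b <;> simp [stepVec, hne] at h1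
    subst hij
    cases a <;> cases b <;> simp [stepVec] at h1 ⊢

open Classical in
/-- The step encoded by an increment. -/
def stepOf {d : ℕ} (z : Site d) : Step d := if h : ∃ v, stepVec v = z then h.choose else none

lemma stepOf_stepVec {d : ℕ} (v : Step d) : stepOf (stepVec v) = v := by
  have h : ∃ w : Step d, stepVec w = stepVec v := ⟨v, rfl⟩
  rw [stepOf, dif_pos h]
  exact stepVec_injective h.choose_spec

/-- The displacement of a word. -/
def pos {d : ℕ} (u : List (Letter d)) : Site d := (u.map fun a => stepVec a.1).sum

@[simp] lemma pos_nil {d : ℕ} : pos ([] : List (Letter d)) = 0 := rfl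

@[simp] lemma pos_cons {d : ℕ} (a : Letter d) (u : List (Letter d)) :
    pos (a :: u) = stepVec a.1 + pos u := by simp [pos]

@[simp] lemma pos_append {d : ℕ} (u v : List (Letter d)) : pos (u ++ v) = pos u + pos v := by
  simp [pos]

/-- The first `n` letters of a track. -/
def pre {d : ℕ} (σ : Track d) (n : ℕ) : List (Letter d) := (List.range n).map σ

@[simp] lemma length_pre {d : ℕ} (σ : Track d) (n : ℕ) : (pre σ n).length = n := by simp [pre]

@[simp] lemma pre_zero {d : ℕ} (σ : Track d) : pre σ 0 = [] := by simp [pre]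

lemma pre_succ {d : ℕ} (σ : Track d) (n : ℕ) : pre σ (n + 1) = pre σ n ++ [σ n] := by
  simp [pre, List.range_succ]

/-- The time shift of a track. -/
def shiftTrack {d : ℕ} (n : ℕ) (σ : Track d) : Track d := fun i => σ (n + i)

lemma shiftTrack_add {d : ℕ} (m n : ℕ) (σ : Track d) :
    shiftTrack n (shiftTrack m σ) = shiftTrack (m + n) σ := by
  funext i; simp [shiftTrack, add_assoc]

@[simp] lemma shiftTrack_zero {d : ℕ} (σ : Track d) : shiftTrack 0 σ = σ := by
  funext i; simp [shiftTrack]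

lemma pre_add {d : ℕ} (σ : Track d) (m n : ℕ) :
    pre σ (m + n) = pre σ m ++ pre (shiftTrack m σ) n := by
  induction n with
  | zero => simp
  | succ n ih => rw [← add_assoc, pre_succ, ih, pre_succ]; simp [shiftTrack]

lemma pre_take {d : ℕ} (σ : Track d) {m n : ℕ} (h : m ≤ n) : (pre σ n).take m = pre σ m := by
  obtain ⟨k, rfl⟩ := Nat.exists_eq_add_of_le h
  rw [pre_add, List.take_left' (length_pre σ m)]

/-- The path of a track. -/
def trackPath {d : ℕ} (σ : Track d) : Path d := fun n => pos (pre σ n)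

@[simp] lemma trackPath_zero {d : ℕ} (σ : Track d) : trackPath σ 0 = 0 := by simp [trackPath]

lemma trackPath_succ {d : ℕ} (σ : Track d) (n : ℕ) :
    trackPath σ (n + 1) = trackPath σ n + stepVec (σ n).1 := by
  simp [trackPath, pre_succ]

lemma trackPath_add {d : ℕ} (σ : Track d) (m n : ℕ) :
    trackPath σ (m + n) = trackPath σ m + trackPath (shiftTrack m σ) n := by
  simp [trackPath, pre_add]

/-- The tracks that start with the word `u`. -/
def cyl {d : ℕ} (u : List (Letter d)) : Set (Track d) := {σ | pre σ u.length = u}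

lemma measurable_pre_preimage {d : ℕ} (n : ℕ) (S : Set (List (Letter d))) :
    MeasurableSet {σ : Track d | pre σ n ∈ S} := by
  have h : {σ : Track d | pre σ n ∈ S} =
      (fun σ (i : Fin n) => σ i) ⁻¹' {f : Fin n → Letter d | List.ofFn f ∈ S} := by
    ext σ
    have : pre σ n = List.ofFn (fun i : Fin n => σ i) := by
      apply List.ext_getElem <;> simp [pre]
    simp [this]
  rw [h]
  have hm : Measurable fun (σ : Track d) (i : Fin n) => σ i :=
    measurable_pi_lambda _ fun i => measurable_pi_apply _
  exact hm (Set.toFinite _).measurableSet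

lemma measurableSet_cyl {d : ℕ} (u : List (Letter d)) : MeasurableSet (cyl u) :=
  measurable_pre_preimage u.length {u}

lemma measurable_shiftTrack {d : ℕ} (n : ℕ) : Measurable (shiftTrack (d := d) n) :=
  measurable_pi_lambda _ fun _ => measurable_pi_apply _

lemma measurable_trackPath {d : ℕ} (n : ℕ) : Measurable fun σ : Track d => trackPath σ n := by
  intro s _
  exact measurable_pre_preimage n {u | pos u ∈ s}

lemma finite_words (d n : ℕ) : {u : List (Letter d) | u.length = n}.Finite :=
  List.finite_length_eq _ n

/-- The events that depend on finitely many letters. -/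
def finiteEvents (d : ℕ) : Set (Set (Track d)) :=
  {E | ∃ (n : ℕ) (S : Set (List (Letter d))), E = {σ | pre σ n ∈ S}}

lemma isPiSystem_finiteEvents (d : ℕ) : IsPiSystem (finiteEvents d) := by
  rintro _ ⟨m, S, rfl⟩ _ ⟨n, S', rfl⟩ -
  refine ⟨max m n, {u | u.take m ∈ S ∧ u.take n ∈ S'}, ?_⟩
  ext σ
  simp [pre_take σ (le_max_left m n), pre_take σ (le_max_right m n)]

lemma generateFrom_finiteEvents (d : ℕ) :
    (inferInstance : MeasurableSpace (Track d)) = MeasurableSpace.generateFrom (finiteEvents d) := by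
  apply le_antisymm
  · refine iSup_le fun i => ?_
    rintro _ ⟨B, -, rfl⟩
    refine MeasurableSpace.measurableSet_generateFrom ⟨i + 1, {u | u.getLast? ∈ some '' B}, ?_⟩
    ext σ
    change σ i ∈ B ↔ (pre σ (i + 1)).getLast? ∈ some '' B
    rw [pre_succ, List.getLast?_append]
    simp only [List.getLast?_singleton, Option.some_or]
    exact ((Option.some_injective _).mem_set_image).symm
  · refine MeasurableSpace.generateFrom_le ?_
    rintro _ ⟨n, S, rfl⟩
    exact measurable_pre_preimage n S

/-- Decomposition of the mass of a finite event into words. -/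
lemma measure_pre_inter {d : ℕ} (μ : Measure (Track d)) (n : ℕ) (S : Set (List (Letter d)))
    (E : Set (Track d)) (hE : MeasurableSet E) :
    μ ({σ | pre σ n ∈ S} ∩ E) =
      ∑ u ∈ (finite_words d n).toFinset, S.indicator (fun u => μ (cyl u ∩ E)) u := by
  classical
  have h : {σ | pre σ n ∈ S} ∩ E =
      ⋃ u ∈ (finite_words d n).toFinset.filter (· ∈ S), cyl u ∩ E := by
    ext σ
    simp only [Set.mem_inter_iff, Set.mem_ofPred_eq, Set.mem_iUnion, Finset.mem_filter,
      Set.Finite.mem_toFinset, cyl, exists_prop]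
    constructor
    · rintro ⟨h1, h2⟩
      exact ⟨pre σ n, ⟨by simp, h1⟩, by simp, h2⟩
    · rintro ⟨u, ⟨hu, huS⟩, h1, h2⟩
      rw [hu] at h1
      exact ⟨h1 ▸ huS, h2⟩
  rw [h, measure_biUnion_finset, Finset.sum_filter]
  · rfl
  · intro u hu v hv huv
    rw [Function.onFun, Set.disjoint_left]
    rintro σ ⟨h1, -⟩ ⟨h2, -⟩
    simp only [Finset.coe_filter, Set.Finite.mem_toFinset, Set.mem_ofPred_eq] at hu hv
    simp only [cyl, Set.mem_ofPred_eq] at h1 h2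
    rw [hu.1] at h1
    rw [hv.1] at h2
    exact huv (h1.symm.trans h2)
  · intro u _
    exact (measurableSet_cyl u).inter hE

lemma measure_ext_cyl {d : ℕ} {μ ν : Measure (Track d)} [IsFiniteMeasure μ]
    (h : ∀ u, μ (cyl u) = ν (cyl u)) : μ = ν := by
  refine ext_of_generate_finite _ (generateFrom_finiteEvents d) (isPiSystem_finiteEvents d) ?_ ?_
  · rintro _ ⟨n, S, rfl⟩
    have h1 := measure_pre_inter μ n S Set.univ MeasurableSet.univ
    have h2 := measure_pre_inter ν n S Set.univ MeasurableSet.univ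
    simp only [Set.inter_univ] at h1 h2
    rw [h1, h2]
    simp_rw [h]
  · have := h []
    simpa [cyl] using this

/-! ## Weights of words -/

/-- The law of a single coin. -/
def coinProb (d : ℕ) (κ : ℝ) (b : Bool) : ℝ≥0∞ :=
  bernoulliMeasure true false (Set.projIcc 0 1 zero_le_one (d * κ)) {b}

/-- The probability of a letter at a site with environment `q`. -/
def letterWeight {d : ℕ} (κ : ℝ) (q : StepLaw d) (a : Letter d) : ℝ≥0∞ :=
  coinProb d κ a.2 * ENNReal.ofReal ((coinStepLaw κ q a.2).1 a.1)

/-- The probability that the walk from the origin follows the word `u`. -/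
def wordWeight {d : ℕ} (κ : ℝ) : List (Letter d) → Env d → ℝ≥0∞
  | [], _ => 1
  | a :: u, ω => letterWeight κ (ω 0) a * wordWeight κ u (shiftEnv (stepVec a.1) ω)

@[simp] lemma shiftEnv_zero {d : ℕ} (ω : Env d) : shiftEnv 0 ω = ω := by
  funext x; simp [shiftEnv]

lemma shiftEnv_shiftEnv {d : ℕ} (y z : Site d) (ω : Env d) :
    shiftEnv y (shiftEnv z ω) = shiftEnv (z + y) ω := by
  funext x; simp only [shiftEnv]; congr 1; abel

lemma measurable_shiftEnv {d : ℕ} (y : Site d) : Measurable (shiftEnv (d := d) y) :=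
  measurable_pi_lambda _ fun _ => measurable_pi_apply _

@[simp] lemma wordWeight_nil {d : ℕ} (κ : ℝ) (ω : Env d) : wordWeight κ [] ω = 1 := rfl

lemma wordWeight_append {d : ℕ} (κ : ℝ) (u v : List (Letter d)) (ω : Env d) :
    wordWeight κ (u ++ v) ω = wordWeight κ u ω * wordWeight κ v (shiftEnv (pos u) ω) := by
  induction u generalizing ω with
  | nil => simp
  | cons a u ih =>
    simp only [List.cons_append, wordWeight, ih, shiftEnv_shiftEnv, pos_cons, mul_assoc]

lemma wordWeight_eq_prod {d : ℕ} (κ : ℝ) (u : List (Letter d)) (ω : Env d) :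
    wordWeight κ u ω =
      ∏ i ∈ Finset.range u.length, letterWeight κ (ω (pos (u.take i))) (u.getD i (none, false)) := by
  induction u generalizing ω with
  | nil => simp
  | cons a u ih =>
    rw [List.length_cons, Finset.prod_range_succ', wordWeight, ih, mul_comm]
    simp [shiftEnv, add_comm]

lemma measurable_letterWeight {d : ℕ} (κ : ℝ) (a : Letter d) :
    Measurable fun q : StepLaw d => letterWeight κ q a :=
  Measurable.const_mul (ENNReal.measurable_ofReal.comp
    ((measurable_pi_apply a.1).comp (measurable_subtype_coe.comp (measurable_coinStepLaw κ a.2)))) _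

lemma measurable_wordWeight {d : ℕ} (κ : ℝ) (u : List (Letter d)) :
    Measurable (wordWeight κ u) := by
  induction u with
  | nil => exact measurable_const
  | cons a u ih =>
    exact ((measurable_letterWeight κ a).comp (measurable_pi_apply 0)).mul
      (ih.comp (measurable_shiftEnv _))

/-! ## Cylinder probabilities of the chain -/

lemma nextLaw_singleton {d : ℕ} (q : StepLaw d) (z : Site d) (v : Step d) :
    nextLaw q z {z + stepVec v} = ENNReal.ofReal (q.1 v) := by
  classical
  simp only [nextLaw, Measure.coe_finsetSum, Finset.sum_apply, Measure.smul_apply, smul_eq_mul,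
    MeasurableSet.singleton, Measure.dirac_apply', Set.indicator_apply, Set.mem_singleton_iff,
    add_right_inj, stepVec_injective.eq_iff]
  simp

lemma nextLaw_eq_zero {d : ℕ} (q : StepLaw d) (z y : Site d) (h : ∀ v, stepVec v ≠ y - z) :
    nextLaw q z {y} = 0 := by
  classical
  simp only [nextLaw, Measure.coe_finsetSum, Finset.sum_apply, Measure.smul_apply, smul_eq_mul,
    MeasurableSet.singleton, Measure.dirac_apply', Set.indicator_apply, Set.mem_singleton_iff]
  refine Finset.sum_eq_zero fun v _ => ?_
  rw [if_neg, mul_zero]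
  intro h'
  exact h v (by rw [← h']; abel)

lemma chainLaw_cylinder {d : ℕ} (p : ℕ → Site d → StepLaw d) (x : Site d) (u : ℕ → Site d)
    (n : ℕ) :
    chainLaw p x {X | ∀ i ≤ n, X i = u i} =
      (if u 0 = x then 1 else 0) * ∏ i ∈ Finset.range n, nextLaw (p i (u i)) (u i) {u (i + 1)} := by
  classical
  set h : ∀ n, (i : Finset.Iic n) → Site d := fun n i => u i.1 with hh
  have key : ∀ n, chainLaw p x {X | ∀ i ≤ n, X i = u i} =
      Kernel.partialTraj (X := fun _ => Site d) (stepKernel p) 0 n (fun _ => x) {h n} := by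
    intro n
    rw [← Kernel.traj_map_frestrictLe_apply, Measure.map_apply (by fun_prop)
      (measurableSet_singleton _)]
    congr 1
    ext X
    exact ⟨fun hX => funext fun i => hX i.1 (Finset.mem_Iic.1 i.2),
      fun hX i hi => congrFun hX ⟨i, Finset.mem_Iic.2 hi⟩⟩
  rw [key]
  induction n with
  | zero =>
    rw [Kernel.partialTraj_self, Kernel.id_apply, Measure.dirac_apply' _ (measurableSet_singleton _)]
    simp only [Finset.range_zero, Finset.prod_empty, mul_one, Set.indicator_apply,
      Set.mem_singleton_iff, Pi.one_apply]
    congr 1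
    rw [eq_iff_iff]
    constructor
    · intro h0; exact (congrFun h0 ⟨0, by simp⟩).symm
    · intro h0
      funext ⟨i, hi⟩
      obtain rfl : i = 0 := by simpa using hi
      exact h0.symm
  | succ n ih =>
    rw [Kernel.partialTraj_succ_eq_comp (Nat.zero_le n), Kernel.comp_apply' _ _ _
      (measurableSet_singleton _)]
    have hk : ∀ g : (i : Finset.Iic n) → Site d,
        Kernel.partialTraj (X := fun _ => Site d) (stepKernel p) n (n + 1) g {h (n + 1)} =
          Set.indicator {h n} (fun _ => nextLaw (p n (u n)) (u n) {u (n + 1)}) g := by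
      intro g
      rw [Kernel.partialTraj_succ_self, Kernel.map_apply' _ (by fun_prop) _
        (measurableSet_singleton _), Kernel.prod_apply, Kernel.id_apply, Measure.dirac_prod]
      have hs' := measurable_IicProdIoc (X := fun _ => Site d) (m := n) (n := n + 1)
        (measurableSet_singleton (h (n + 1)))
      have hm : Measurable (Prod.mk (β := (i : Finset.Ioc n (n + 1)) → Site d) g) :=
        measurable_prodMk_left
      refine (Measure.map_apply hm hs').trans ?_
      rw [Kernel.map_apply' _ (MeasurableEquiv.measurable _) _ (hm hs')]
      by_cases hg : g = h n
      · subst hg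
        simp only [Set.mem_singleton_iff, Set.indicator_of_mem]
        change nextLaw (p n (h n ⟨n, _⟩)) (h n ⟨n, _⟩) _ = _
        congr 1
        ext y
        simp only [Set.mem_preimage, Set.mem_singleton_iff]
        constructor
        · intro hy
          have := congrFun hy ⟨n + 1, by simp⟩
          simpa [IicProdIoc, MeasurableEquiv.piSingleton, hh] using this
        · intro hy
          funext ⟨i, hi⟩
          rw [Finset.mem_Iic] at hi
          simp only [IicProdIoc, hh]
          split_ifs with h1
          · rfl
          · obtain rfl : i = n + 1 := by omega
            simpa [MeasurableEquiv.piSingleton] using hy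
      · rw [Set.indicator_of_notMem (by simpa using hg)]
        convert measure_empty (μ := stepKernel p n g)
        ext y
        simp only [Set.mem_preimage, Set.mem_singleton_iff, Set.mem_empty_iff_false, iff_false]
        intro hy
        apply hg
        funext ⟨i, hi⟩
        have hi' := hi
        rw [Finset.mem_Iic] at hi'
        have := congrFun hy ⟨i, by simp; omega⟩
        simpa [IicProdIoc, hi', hh] using this
    simp_rw [hk]
    rw [lintegral_indicator_const (measurableSet_singleton _), ih, Finset.prod_range_succ]
    ring

lemma chainLaw_ae {d : ℕ} (p : ℕ → Site d → StepLaw d) (x : Site d) :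
    ∀ᵐ X ∂(chainLaw p x), X 0 = x ∧ ∀ i, stepVec (stepOf (X (i + 1) - X i)) = X (i + 1) - X i := by
  -- A property of finitely many coordinates fails on a countable union of cylinders, so it suffices
  -- that each bad cylinder is null. Values beyond time `n` are filled in with `0`.
  have hnull : ∀ (n : ℕ) (Q : (ℕ → Site d) → Prop),
      (∀ u, ¬ Q u → chainLaw p x {X | ∀ i ≤ n, X i = u i} = 0) →
      (∀ u u', (∀ i ≤ n, u i = u' i) → (Q u ↔ Q u')) → ∀ᵐ X ∂(chainLaw p x), Q X := by
    intro n Q hQ hdep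
    rw [ae_iff]
    have hsub : {X | ¬ Q X} ⊆ ⋃ f ∈ {f : Fin (n + 1) → Site d |
        ¬ Q fun i => if h : i < n + 1 then f ⟨i, h⟩ else 0},
        {X | ∀ i ≤ n, X i = if h : i < n + 1 then f ⟨i, h⟩ else 0} := by
      intro X hX
      simp only [Set.mem_ofPred_eq, Set.mem_iUnion, exists_prop]
      refine ⟨fun i => X i, ?_, ?_⟩
      · rw [← hdep X]
        · exact hX
        · intro i hi
          rw [dif_pos (by omega)]
      · intro i hi
        rw [dif_pos (by omega)]
    refine measure_mono_null hsub ?_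
    rw [measure_biUnion_null_iff (Set.to_countable _)]
    intro f hf
    exact hQ _ hf
  rw [eventually_and, ae_all_iff]
  constructor
  · refine hnull 0 (fun X => X 0 = x) ?_ ?_
    · intro u hu
      rw [chainLaw_cylinder, if_neg hu, zero_mul]
    · intro u u' h
      simp only [h 0 le_rfl]
  · intro i
    refine hnull (i + 1) (fun X => stepVec (stepOf (X (i + 1) - X i)) = X (i + 1) - X i) ?_ ?_
    · intro u hu
      rw [chainLaw_cylinder, Finset.prod_range_succ, nextLaw_eq_zero, mul_zero, mul_zero]
      intro v hv
      exact hu (by rw [← hv, stepOf_stepVec])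
    · intro u u' h
      simp only [h (i + 1) le_rfl, h i (by omega)]

/-! ## The law of the track -/

/-- The track of a walk with coins. -/
def trackOf {d : ℕ} (y : Coins d × Path d) : Track d :=
  fun i => (stepOf (y.2 (i + 1) - y.2 i), y.1 (i, y.2 i))

lemma measurable_trackOf {d : ℕ} : Measurable (trackOf (d := d)) := by
  refine measurable_pi_lambda _ fun i => Measurable.prodMk ?_ ?_
  · have h1 : Measurable fun y : Coins d × Path d => y.2 (i + 1) - y.2 i :=
      ((measurable_pi_apply (i + 1)).comp measurable_snd).sub
        ((measurable_pi_apply i).comp measurable_snd)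
    exact (measurable_of_countable (stepOf (d := d))).comp h1
  · have h : Measurable fun u : Coins d × Site d => u.1 (i, u.2) :=
      measurable_from_prod_countable_left fun z => measurable_pi_apply (i, z)
    exact h.comp (measurable_fst.prodMk ((measurable_pi_apply i).comp measurable_snd))

/-- The quenched law of the track, as a kernel. -/
def trackKernel (d : ℕ) (κ : ℝ) : Kernel (Env d) (Track d) :=
  ((Kernel.const (Env d) (coinMeasure d κ)) ⊗ₖ (coinQuenchedKernel d κ)).map trackOf

instance instIsMarkovKernelTrackKernel (d : ℕ) (κ : ℝ) : IsMarkovKernel (trackKernel d κ) := by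
  unfold trackKernel
  exact Kernel.IsMarkovKernel.map _ measurable_trackOf

lemma trackKernel_apply {d : ℕ} (κ : ℝ) (ω : Env d) {E : Set (Track d)} (hE : MeasurableSet E) :
    trackKernel d κ ω E =
      ∫⁻ ε, coinQuenchedLaw κ ω ε 0 {X | trackOf (ε, X) ∈ E} ∂(coinMeasure d κ) := by
  rw [trackKernel, Kernel.map_apply' _ measurable_trackOf _ hE,
    Kernel.compProd_apply (measurable_trackOf hE)]
  rfl

lemma mem_cyl_iff {d : ℕ} (u : List (Letter d)) (σ : Track d) :
    σ ∈ cyl u ↔ ∀ i < u.length, σ i = u.getD i (none, false) := by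
  constructor
  · intro h i hi
    have h' : pre σ u.length = u := h
    rw [← h']
    simp [pre, hi]
  · intro h
    apply List.ext_getElem
    · simp
    · intro i h1 h2
      simp [pre, h i h2, h2]

lemma pos_take_succ {d : ℕ} (u : List (Letter d)) {i : ℕ} (hi : i < u.length) :
    pos (u.take (i + 1)) = pos (u.take i) + stepVec (u.getD i (none, false)).1 := by
  rw [List.take_succ_eq_append_getElem hi, pos_append]
  simp [hi]

lemma coinQuenchedLaw_cyl {d : ℕ} (κ : ℝ) (ω : Env d) (ε : Coins d) (u : List (Letter d)) :
    coinQuenchedLaw κ ω ε 0 {X | trackOf (ε, X) ∈ cyl u} =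
      Set.indicator {ε | ∀ i < u.length, ε (i, pos (u.take i)) = (u.getD i (none, false)).2}
        (fun _ => ∏ i ∈ Finset.range u.length, ENNReal.ofReal
          ((coinStepLaw κ (ω (pos (u.take i))) (u.getD i (none, false)).2).1
            (u.getD i (none, false)).1)) ε := by
  have hae := chainLaw_ae (fun n z => coinStepLaw κ (ω z) (ε (n, z))) 0
  have hset : coinQuenchedLaw κ ω ε 0 {X | trackOf (ε, X) ∈ cyl u} =
      coinQuenchedLaw κ ω ε 0 {X | (∀ i ≤ u.length, X i = pos (u.take i)) ∧
        ∀ i < u.length, ε (i, pos (u.take i)) = (u.getD i (none, false)).2} := by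
    refine measure_congr ?_
    filter_upwards [hae] with X hX
    apply propext
    change trackOf (ε, X) ∈ cyl u ↔ _ ∧ _
    rw [mem_cyl_iff]
    constructor
    · intro h
      have hpos : ∀ i ≤ u.length, X i = pos (u.take i) := by
        intro i
        induction i with
        | zero => intro _; simpa using hX.1
        | succ i ih =>
          intro hi
          have h1 := ih (by omega)
          have h2 := congrArg Prod.fst (h i (by omega))
          simp only [trackOf] at h2
          have h3 := hX.2 i
          rw [h2] at h3
          rw [pos_take_succ u (by omega), h3, ← h1]
          abel
      refine ⟨hpos, fun i hi => ?_⟩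
      have h2 := congrArg Prod.snd (h i hi)
      simp only [trackOf] at h2
      rw [← hpos i hi.le, h2]
    · rintro ⟨h1, h2⟩ i hi
      refine Prod.ext ?_ ?_
      · simp only [trackOf]
        rw [h1 i hi.le, h1 (i + 1) hi, pos_take_succ u hi, add_sub_cancel_left, stepOf_stepVec]
      · simp only [trackOf]
        rw [h1 i hi.le, h2 i hi]
  rw [hset]
  by_cases hε : ∀ i < u.length, ε (i, pos (u.take i)) = (u.getD i (none, false)).2
  · rw [Set.indicator_of_mem (show ε ∈ {ε : Coins d | ∀ i < u.length, ε (i, pos (u.take i)) = (u.getD i (none, false)).2} from hε)]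
    have : {X : Path d | (∀ i ≤ u.length, X i = pos (u.take i)) ∧
        ∀ i < u.length, ε (i, pos (u.take i)) = (u.getD i (none, false)).2} =
        {X | ∀ i ≤ u.length, X i = pos (u.take i)} := by
      ext X
      exact ⟨fun h => h.1, fun h => ⟨h, hε⟩⟩
    rw [this, coinQuenchedLaw, chainLaw_cylinder _ _ (fun i => pos (u.take i))]
    simp only [List.take_zero, pos_nil, if_true, one_mul]
    refine Finset.prod_congr rfl fun i hi => ?_
    rw [Finset.mem_range] at hi
    rw [pos_take_succ u hi, nextLaw_singleton, hε i hi]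
  · rw [Set.indicator_of_notMem (show ε ∉ {ε : Coins d | ∀ i < u.length, ε (i, pos (u.take i)) = (u.getD i (none, false)).2} from hε)]
    have : {X : Path d | (∀ i ≤ u.length, X i = pos (u.take i)) ∧
        ∀ i < u.length, ε (i, pos (u.take i)) = (u.getD i (none, false)).2} = ∅ := by
      ext X
      exact ⟨fun h => hε h.2, fun h => h.elim⟩
    rw [this, measure_empty]

/-- The indices `(i, z i)` are distinct because the times are, even if the path returns to a site.
This is why the track is time-homogeneous given `ω`. -/
lemma coinMeasure_cylinder {d : ℕ} (κ : ℝ) (n : ℕ) (z : ℕ → Site d) (b : ℕ → Bool) :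
    coinMeasure d κ {ε | ∀ i < n, ε (i, z i) = b i} = ∏ i ∈ Finset.range n, coinProb d κ (b i) := by
  classical
  have h : {ε : Coins d | ∀ i < n, ε (i, z i) = b i} =
      (((Finset.range n).image fun i => (i, z i) : Finset (ℕ × Site d)) : Set (ℕ × Site d)).pi
        fun j => {b j.1} := by
    ext ε
    simp [Set.pi]
  rw [h, coinMeasure, Measure.infinitePi_pi _ fun _ _ => measurableSet_singleton _,
    Finset.prod_image]
  · rfl
  · intro i _ j _ hij
    exact (Prod.ext_iff.1 hij).1

lemma trackKernel_cyl {d : ℕ} (κ : ℝ) (ω : Env d) (u : List (Letter d)) :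
    trackKernel d κ ω (cyl u) = wordWeight κ u ω := by
  rw [trackKernel_apply κ ω (measurableSet_cyl u)]
  simp_rw [coinQuenchedLaw_cyl]
  rw [lintegral_indicator_const, coinMeasure_cylinder κ u.length (fun i => pos (u.take i))
    (fun i => (u.getD i (none, false)).2), wordWeight_eq_prod, ← Finset.prod_mul_distrib]
  · exact Finset.prod_congr rfl fun i _ => mul_comm _ _
  · have : {ε : Coins d | ∀ i < u.length, ε (i, pos (u.take i)) = (u.getD i (none, false)).2} =
      ⋂ i, ⋂ (_ : i < u.length), {ε | ε (i, pos (u.take i)) = (u.getD i (none, false)).2} := by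
      ext ε; simp
    rw [this]
    exact MeasurableSet.iInter fun i => MeasurableSet.iInter fun _ =>
      measurable_pi_apply _ (measurableSet_singleton _)

lemma cyl_append {d : ℕ} (u v : List (Letter d)) :
    cyl (u ++ v) = cyl u ∩ shiftTrack u.length ⁻¹' cyl v := by
  ext σ
  simp only [cyl, Set.mem_ofPred_eq, Set.mem_inter_iff, Set.mem_preimage, List.length_append,
    pre_add]
  constructor
  · exact fun h => List.append_inj h (by simp)
  · rintro ⟨h1, h2⟩
    rw [h1, h2]

/-- The Markov property of the walk. -/
lemma trackKernel_markov {d : ℕ} (κ : ℝ) (ω : Env d) (u : List (Letter d)) {E : Set (Track d)}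
    (hE : MeasurableSet E) :
    trackKernel d κ ω (cyl u ∩ shiftTrack u.length ⁻¹' E) =
      wordWeight κ u ω * trackKernel d κ (shiftEnv (pos u) ω) E := by
  have h : ((trackKernel d κ ω).restrict (cyl u)).map (shiftTrack u.length) =
      wordWeight κ u ω • trackKernel d κ (shiftEnv (pos u) ω) := by
    have : IsFiniteMeasure (((trackKernel d κ ω).restrict (cyl u)).map (shiftTrack u.length)) :=
      Measure.isFiniteMeasure_map _ _
    refine measure_ext_cyl fun v => ?_
    rw [Measure.map_apply (measurable_shiftTrack _) (measurableSet_cyl v),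
      Measure.restrict_apply (measurable_shiftTrack _ (measurableSet_cyl v)), Set.inter_comm,
      ← cyl_append, trackKernel_cyl, wordWeight_append, Measure.smul_apply, trackKernel_cyl,
      smul_eq_mul]
  have h2 := congrArg (fun μ => μ E) h
  simp only [Measure.smul_apply, smul_eq_mul] at h2
  rw [← h2, Measure.map_apply (measurable_shiftTrack _) hE,
    Measure.restrict_apply (measurable_shiftTrack _ hE), Set.inter_comm]

/-- The annealed law of the track. -/
def trackLaw {d : ℕ} (P : Measure (Env d)) (κ : ℝ) : Measure (Track d) :=
  P.bind (trackKernel d κ)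

lemma trackLaw_apply {d : ℕ} (P : Measure (Env d)) (κ : ℝ) {E : Set (Track d)}
    (hE : MeasurableSet E) : trackLaw P κ E = ∫⁻ ω, trackKernel d κ ω E ∂P :=
  Measure.bind_apply hE (Kernel.aemeasurable _)

instance instIsProbabilityMeasureTrackLaw {d : ℕ} (P : Measure (Env d)) [IsProbabilityMeasure P]
    (κ : ℝ) : IsProbabilityMeasure (trackLaw P κ) :=
  ⟨by rw [trackLaw_apply P κ MeasurableSet.univ]; simp⟩

lemma coinAnnealedLaw_map {d : ℕ} (P : Measure (Env d)) [IsProbabilityMeasure P] (κ : ℝ) :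
    (coinAnnealedLaw P κ).map (fun y => trackOf (y.1.2, y.2)) = trackLaw P κ := by
  have hm : Measurable fun y : (Env d × Coins d) × Path d => trackOf (y.1.2, y.2) :=
    measurable_trackOf.comp ((measurable_snd.comp measurable_fst).prodMk measurable_snd)
  ext E hE
  rw [Measure.map_apply hm hE, trackLaw_apply P κ hE, coinAnnealedLaw,
    Measure.compProd_apply (hm hE), lintegral_prod _
      (Kernel.measurable_kernel_prodMk_left (hm hE)).aemeasurable]
  simp_rw [trackKernel_apply κ _ hE]
  rfl

lemma coinAnnealedLaw_ae {d : ℕ} (P : Measure (Env d)) [IsProbabilityMeasure P] (κ : ℝ) :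
    ∀ᵐ y ∂(coinAnnealedLaw P κ), y.2 = trackPath (trackOf (y.1.2, y.2)) := by
  have hm : Measurable fun y : (Env d × Coins d) × Path d => trackOf (y.1.2, y.2) :=
    measurable_trackOf.comp ((measurable_snd.comp measurable_fst).prodMk measurable_snd)
  have hms : MeasurableSet {y : (Env d × Coins d) × Path d |
      y.2 = trackPath (trackOf (y.1.2, y.2))} := by
    refine measurableSet_eq_fun measurable_snd ?_
    exact measurable_pi_lambda _ fun n => (measurable_trackPath n).comp hm
  rw [coinAnnealedLaw, Measure.ae_compProd_iff hms]
  refine Eventually.of_forall fun y => ?_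
  filter_upwards [chainLaw_ae (fun n z => coinStepLaw κ (y.1 z) (y.2 (n, z))) 0] with X hX
  funext n
  induction n with
  | zero => simpa using hX.1
  | succ n ih =>
    rw [trackPath_succ, ← ih]
    simp only [trackOf]
    rw [hX.2 n]
    abel

/-! ## Elliptic environments -/

/-- The environments in which all the jump probabilities to neighbours exceed `κ`. -/
def Elliptic {d : ℕ} (κ : ℝ) (ω : Env d) : Prop :=
  ∀ (x : Site d) (e : UnitStep d), κ < (ω x).1 (some e)

lemma Elliptic.shift {d : ℕ} {κ : ℝ} {ω : Env d} (h : Elliptic κ ω) (y : Site d) :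
    Elliptic κ (shiftEnv y ω) := fun x e => h (x + y) e

lemma stepLaw_sum {d : ℕ} (q : StepLaw d) : q.1 none + ∑ e, q.1 (some e) = 1 := by
  have := q.2.2
  rwa [Fintype.sum_option] at this

lemma two_mul_lt_one {d : ℕ} [NeZero d] {κ : ℝ} (q : StepLaw d) (h : ∀ e, κ < q.1 (some e)) :
    2 * (d * κ) < 1 := by
  have h1 := stepLaw_sum q
  have h0 := q.2.1 none
  have h2 : ∑ _e : UnitStep d, κ < ∑ e, q.1 (some e) :=
    Finset.sum_lt_sum_of_nonempty ⟨(0, true), Finset.mem_univ _⟩ fun e _ => h e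
  simp only [Finset.sum_const, Finset.card_univ, Fintype.card_prod, Fintype.card_fin,
    Fintype.card_bool, nsmul_eq_mul, Nat.cast_mul, Nat.cast_ofNat] at h2
  linarith

lemma coinStepLaw_true {d : ℕ} [NeZero d] (κ : ℝ) (q : StepLaw d) (e : UnitStep d) :
    (coinStepLaw κ q true).1 (some e) = 1 / (2 * d) := by
  have hd : (d : ℝ) ≠ 0 := NeZero.ne _
  have h : coinWeight κ q true ∈ stdSimplex ℝ (Step d) := by
    refine ⟨fun v => ?_, ?_⟩
    · cases v <;> simp [coinWeight]
    · rw [Fintype.sum_option]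
      simp only [coinWeight, if_true, Finset.sum_const, Finset.card_univ, Fintype.card_prod,
        Fintype.card_fin, Fintype.card_bool, nsmul_eq_mul]
      push_cast
      field_simp
      ring
  rw [coinStepLaw, dif_pos h]
  simp [coinWeight]

lemma coinStepLaw_of_elliptic {d : ℕ} [NeZero d] {κ : ℝ} (hκ : 0 < κ) (q : StepLaw d)
    (h : ∀ e, κ < q.1 (some e)) (b : Bool) (v : Step d) :
    (coinStepLaw κ q b).1 v = coinWeight κ q b v := by
  have hd : (d : ℝ) ≠ 0 := NeZero.ne _
  have hdpos : (0 : ℝ) < d := by positivity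
  have h2 := two_mul_lt_one q h
  have hdκ : 0 < d * κ := by positivity
  have hw : coinWeight κ q b ∈ stdSimplex ℝ (Step d) := by
    refine ⟨fun v => ?_, ?_⟩
    · cases b
      · cases v with
        | none =>
          simp only [coinWeight, Bool.false_eq_true, if_false]
          exact div_nonneg (q.2.1 none) (by linarith)
        | some e =>
          simp only [coinWeight, Bool.false_eq_true, if_false]
          exact div_nonneg (by linarith [h e]) (by linarith)
      · cases v <;> simp [coinWeight]
    · rw [Fintype.sum_option]
      cases b
      · simp only [coinWeight, Bool.false_eq_true, if_false]
        rw [← Finset.sum_div, ← add_div, Finset.sum_sub_distrib, ← add_sub_assoc, stepLaw_sum q,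
          div_eq_one_iff_eq (by linarith)]
        simp only [Finset.sum_const, Finset.card_univ, Fintype.card_prod, Fintype.card_fin,
          Fintype.card_bool, nsmul_eq_mul]
        push_cast
        ring
      · simp only [coinWeight, if_true, Finset.sum_const, Finset.card_univ, Fintype.card_prod,
          Fintype.card_fin, Fintype.card_bool, nsmul_eq_mul]
        push_cast
        field_simp
        ring
  rw [coinStepLaw, dif_pos hw]

lemma coinProb_true {d : ℕ} {κ : ℝ} (h0 : 0 ≤ d * κ) (h1 : d * κ ≤ 1) :
    coinProb d κ true = ENNReal.ofReal (d * κ) := by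
  rw [coinProb, bernoulliMeasure_apply_of_mem_of_notMem _ (by simp) (by simp) (by simp),
    Set.projIcc_of_mem zero_le_one ⟨h0, h1⟩, ENNReal.ofReal]
  congr 1
  exact (Real.toNNReal_of_nonneg h0).symm

lemma coinProb_false {d : ℕ} {κ : ℝ} (h0 : 0 ≤ d * κ) (h1 : d * κ ≤ 1) :
    coinProb d κ false = ENNReal.ofReal (1 - d * κ) := by
  rw [coinProb, bernoulliMeasure_apply_of_notMem_of_mem _ (by simp) (by simp) (by simp),
    Set.projIcc_of_mem zero_le_one ⟨h0, h1⟩, ENNReal.ofReal]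
  congr 1
  exact (Real.toNNReal_of_nonneg (sub_nonneg.2 h1)).symm

/-- With the coin `1` the step ignores the environment: `dκ · 1/(2d) = κ/2`. No ellipticity of `q`
enters, so such letters reveal nothing about the sites where they are used. -/
lemma letterWeight_true {d : ℕ} [NeZero d] {κ : ℝ} (hκ : 0 < κ) (h2 : 2 * (d * κ) < 1)
    (q : StepLaw d) (e : UnitStep d) :
    letterWeight κ q (some e, true) = ENNReal.ofReal (κ / 2) := by
  have hd : (d : ℝ) ≠ 0 := NeZero.ne _
  have hdκ : 0 < d * κ := by positivity
  rw [letterWeight, coinStepLaw_true, coinProb_true hdκ.le (by linarith),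
    ← ENNReal.ofReal_mul hdκ.le]
  congr 1
  field_simp

lemma letterWeight_false {d : ℕ} [NeZero d] {κ : ℝ} (hκ : 0 < κ) (q : StepLaw d)
    (h : ∀ e, κ < q.1 (some e)) (e : UnitStep d) :
    letterWeight κ q (some e, false) = ENNReal.ofReal (q.1 (some e) - κ / 2) := by
  have hd : (d : ℝ) ≠ 0 := NeZero.ne _
  have hdκ : 0 < d * κ := by positivity
  have h2 := two_mul_lt_one q h
  have h3 : (1 : ℝ) - d * κ ≠ 0 := by linarith
  rw [letterWeight, coinStepLaw_of_elliptic hκ q h, coinProb_false hdκ.le (by linarith),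
    ← ENNReal.ofReal_mul (by linarith)]
  congr 1
  simp only [coinWeight, Bool.false_eq_true, if_false]
  field_simp

lemma le_letterWeight {d : ℕ} [NeZero d] {κ : ℝ} (hκ : 0 < κ) (q : StepLaw d)
    (h : ∀ e, κ < q.1 (some e)) (e : UnitStep d) (b : Bool) :
    ENNReal.ofReal (κ / 2) ≤ letterWeight κ q (some e, b) := by
  cases b
  · rw [letterWeight_false hκ q h]
    exact ENNReal.ofReal_le_ofReal (by linarith [h e])
  · rw [letterWeight_true hκ (two_mul_lt_one q h)]

/-- Averaging over the coin gives the original step law. -/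
lemma letterWeight_add {d : ℕ} [NeZero d] {κ : ℝ} (hκ : 0 < κ) (q : StepLaw d)
    (h : ∀ e, κ < q.1 (some e)) (v : Step d) :
    letterWeight κ q (v, false) + letterWeight κ q (v, true) = ENNReal.ofReal (q.1 v) := by
  have hd : (d : ℝ) ≠ 0 := NeZero.ne _
  have hdκ : 0 < d * κ := by positivity
  have h2 := two_mul_lt_one q h
  have h3 : (1 : ℝ) - d * κ ≠ 0 := by linarith
  cases v with
  | none =>
    simp only [letterWeight]
    rw [coinStepLaw_of_elliptic hκ q h, coinStepLaw_of_elliptic hκ q h,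
      coinProb_false hdκ.le (by linarith), ← ENNReal.ofReal_mul (by linarith)]
    simp only [coinWeight, if_true, Bool.false_eq_true, if_false, ENNReal.ofReal_zero, mul_zero,
      add_zero]
    congr 1
    field_simp
  | some e =>
    rw [letterWeight_true hκ h2, letterWeight_false hκ q h,
      ← ENNReal.ofReal_add (by linarith [h e]) (by positivity)]
    congr 1
    ring

/-! ## The walk without coins -/

lemma path_ext {d : ℕ} {μ ν : Measure (Path d)} [IsFiniteMeasure μ]
    (h : ∀ (n : ℕ) (u : ℕ → Site d), μ {X | ∀ i ≤ n, X i = u i} = ν {X | ∀ i ≤ n, X i = u i})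
    (huniv : μ Set.univ = ν Set.univ) : μ = ν := by
  refine ext_of_generate_finite {E | ∃ (n : ℕ) (u : ℕ → Site d), E = {X | ∀ i ≤ n, X i = u i}}
    ?_ ?_ ?_ huniv
  · apply le_antisymm
    · refine iSup_le fun i => ?_
      rintro _ ⟨B, -, rfl⟩
      have : (fun X : Path d => X i) ⁻¹' B = ⋃ f ∈ {f : Fin (i + 1) → Site d | f (Fin.last i) ∈ B},
          {X | ∀ j ≤ i, X j = if h : j < i + 1 then f ⟨j, h⟩ else 0} := by
        ext X
        simp only [Set.mem_preimage, Set.mem_ofPred_eq, Set.mem_iUnion, exists_prop]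
        constructor
        · intro hX
          refine ⟨fun j => X j, by simpa using hX, fun j hj => ?_⟩
          rw [dif_pos (by omega)]
        · rintro ⟨f, hf, hX⟩
          have h1 := hX i le_rfl
          rw [dif_pos (by omega)] at h1
          rw [h1]
          exact hf
      rw [this]
      refine @MeasurableSet.biUnion (Path d) (Fin (i + 1) → Site d)
        (MeasurableSpace.generateFrom {E | ∃ (n : ℕ) (u : ℕ → Site d), E = {X | ∀ i ≤ n, X i = u i}})
        _ _ (Set.to_countable _) ?_
      intro f _
      apply MeasurableSpace.measurableSet_generateFrom
      exact ⟨i, _, rfl⟩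
    · refine MeasurableSpace.generateFrom_le ?_
      rintro _ ⟨n, u, rfl⟩
      have : {X : Path d | ∀ i ≤ n, X i = u i} = ⋂ i, ⋂ (_ : i ≤ n), {X | X i = u i} := by
        ext X; simp
      rw [this]
      exact MeasurableSet.iInter fun i => MeasurableSet.iInter fun _ =>
        measurable_pi_apply _ (measurableSet_singleton _)
  · rintro _ ⟨m, u, rfl⟩ _ ⟨n, u', rfl⟩ ⟨X, hX, hX'⟩
    refine ⟨max m n, X, ?_⟩
    ext Y
    constructor
    · rintro ⟨hY, hY'⟩ i hi
      rcases le_max_iff.1 hi with h1 | h1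
      · rw [hY i h1, hX i h1]
      · rw [hY' i h1, hX' i h1]
    · intro hY
      exact ⟨fun i hi => by rw [hY i (hi.trans (le_max_left _ _)), hX i hi],
        fun i hi => by rw [hY i (hi.trans (le_max_right _ _)), hX' i hi]⟩
  · rintro _ ⟨n, u, rfl⟩
    exact h n u

/-- Split according to the first coin, apply the Markov property to both letters, and add the two
weights by `letterWeight_add`. -/
lemma trackKernel_steps {d : ℕ} [NeZero d] {κ : ℝ} (hκ : 0 < κ) {ω : Env d} (hω : Elliptic κ ω)
    (n : ℕ) (v : ℕ → Step d) (u : ℕ → Site d) (hu : ∀ i < n, u (i + 1) = u i + stepVec (v i)) :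
    trackKernel d κ (shiftEnv (u 0) ω) {σ | ∀ i < n, (σ i).1 = v i} =
      ∏ i ∈ Finset.range n, ENNReal.ofReal ((ω (u i)).1 (v i)) := by
  have hmeas : ∀ (n : ℕ) (v : ℕ → Step d), MeasurableSet {σ : Track d | ∀ i < n, (σ i).1 = v i} := by
    intro n v
    have : {σ : Track d | ∀ i < n, (σ i).1 = v i} =
        ⋂ i, ⋂ (_ : i < n), {σ | (σ i).1 = v i} := by
      ext σ; simp
    rw [this]
    exact MeasurableSet.iInter fun i => MeasurableSet.iInter fun _ =>
      (measurable_fst.comp (measurable_pi_apply i)) (measurableSet_singleton _)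
  induction n generalizing v u with
  | zero => simp
  | succ n ih =>
    have hset : {σ : Track d | ∀ i < n + 1, (σ i).1 = v i} =
        (cyl [(v 0, false)] ∩ shiftTrack 1 ⁻¹' {σ | ∀ i < n, (σ i).1 = v (i + 1)}) ∪
        (cyl [(v 0, true)] ∩ shiftTrack 1 ⁻¹' {σ | ∀ i < n, (σ i).1 = v (i + 1)}) := by
      ext σ
      have hc : ∀ b, σ ∈ cyl [(v 0, b)] ↔ σ 0 = (v 0, b) := by
        intro b; simp [cyl, pre]
      simp only [Set.mem_ofPred_eq, Set.mem_union, Set.mem_inter_iff, hc, Set.mem_preimage,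
        shiftTrack]
      rw [← or_and_right]
      constructor
      · intro h
        refine ⟨?_, fun i hi => by rw [add_comm]; exact h (i + 1) (by omega)⟩
        have h0 := h 0 (by omega)
        rcases hb : (σ 0).2 with _ | _
        · exact Or.inl (Prod.ext h0 hb)
        · exact Or.inr (Prod.ext h0 hb)
      · rintro ⟨h0, h⟩ i hi
        rcases i with _ | i
        · rcases h0 with h0 | h0 <;> rw [h0]
        · have := h i (by omega)
          rwa [add_comm] at this
    have hdisj : Disjoint (cyl [(v 0, false)] ∩ shiftTrack 1 ⁻¹' {σ | ∀ i < n, (σ i).1 = v (i + 1)})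
        (cyl [(v 0, true)] ∩ shiftTrack 1 ⁻¹' {σ | ∀ i < n, (σ i).1 = v (i + 1)}) := by
      rw [Set.disjoint_left]
      rintro σ ⟨h1, -⟩ ⟨h2, -⟩
      have e1 : σ 0 = (v 0, false) := by simpa [cyl, pre] using h1
      have e2 : σ 0 = (v 0, true) := by simpa [cyl, pre] using h2
      simp [e1] at e2
    have hm := hmeas n fun i => v (i + 1)
    rw [hset, measure_union hdisj ((measurableSet_cyl _).inter (measurable_shiftTrack 1 hm))]
    have k1 := fun b => trackKernel_markov κ (shiftEnv (u 0) ω) [(v 0, b)] hm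
    simp only [List.length_cons, List.length_nil, zero_add] at k1
    rw [k1, k1]
    have hu1 : u 1 = u 0 + stepVec (v 0) := hu 0 (by omega)
    have ih' := ih (fun i => v (i + 1)) (fun i => u (i + 1)) (fun i hi => hu (i + 1) (by omega))
    simp only [zero_add] at ih'
    simp only [pos_cons, pos_nil, add_zero, shiftEnv_shiftEnv, ← hu1, ih', wordWeight, mul_one]
    rw [← add_mul, letterWeight_add hκ _ (fun e => hω.shift (u 0) 0 e), Finset.prod_range_succ',
      mul_comm]
    simp [shiftEnv]

/-- The link between the walk without coins, for which the speed and the positivity of `R = ∞` are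
assumed, and the track, on which everything else is proved. -/
lemma quenchedLaw_eq_map {d : ℕ} [NeZero d] {κ : ℝ} (hκ : 0 < κ) {ω : Env d} (hω : Elliptic κ ω) :
    quenchedLaw ω 0 = (trackKernel d κ ω).map trackPath := by
  have hmt : Measurable (trackPath (d := d)) := measurable_pi_lambda _ measurable_trackPath
  have : IsProbabilityMeasure (quenchedLaw ω 0) := instIsProbabilityMeasureChainLaw _ _
  have : IsProbabilityMeasure ((trackKernel d κ ω).map trackPath) :=
    Measure.isProbabilityMeasure_map hmt.aemeasurable
  refine path_ext (fun n u => ?_) (by simp)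
  have hms : MeasurableSet {X : Path d | ∀ i ≤ n, X i = u i} := by
    have : {X : Path d | ∀ i ≤ n, X i = u i} = ⋂ i, ⋂ (_ : i ≤ n), {X | X i = u i} := by
      ext X; simp
    rw [this]
    exact MeasurableSet.iInter fun i => MeasurableSet.iInter fun _ =>
      measurable_pi_apply _ (measurableSet_singleton _)
  rw [Measure.map_apply hmt hms, quenchedLaw, chainLaw_cylinder]
  by_cases h0 : u 0 = 0
  swap
  · rw [if_neg h0, zero_mul]
    symm
    convert measure_empty (μ := trackKernel d κ ω)
    ext σ
    simp only [Set.mem_preimage, Set.mem_ofPred_eq, Set.mem_empty_iff_false, iff_false]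
    intro h
    exact h0 (by rw [← h 0 (Nat.zero_le _), trackPath_zero])
  rw [if_pos h0, one_mul]
  by_cases hstep : ∀ i < n, stepVec (stepOf (u (i + 1) - u i)) = u (i + 1) - u i
  · have hu : ∀ i < n, u (i + 1) = u i + stepVec (stepOf (u (i + 1) - u i)) := by
      intro i hi
      rw [hstep i hi]; abel
    have hk := trackKernel_steps hκ hω n (fun i => stepOf (u (i + 1) - u i)) u hu
    rw [h0, shiftEnv_zero] at hk
    have hset : trackPath ⁻¹' {X : Path d | ∀ i ≤ n, X i = u i} =
        {σ | ∀ i < n, (σ i).1 = stepOf (u (i + 1) - u i)} := by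
      ext σ
      simp only [Set.mem_preimage, Set.mem_ofPred_eq]
      constructor
      · intro h i hi
        rw [← h (i + 1) hi, ← h i hi.le, trackPath_succ, add_sub_cancel_left, stepOf_stepVec]
      · intro h i
        induction i with
        | zero => intro _; rw [trackPath_zero, h0]
        | succ i ih =>
          intro hi
          rw [trackPath_succ, ih (by omega), h i (by omega), ← hu i (by omega)]
    rw [hset, hk]
    refine Finset.prod_congr rfl fun i hi => ?_
    rw [Finset.mem_range] at hi
    conv_lhs => rw [hu i hi]
    rw [nextLaw_singleton]
  · push Not at hstep
    obtain ⟨i, hi, hne⟩ := hstep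
    rw [Finset.prod_eq_zero (Finset.mem_range.2 hi)]
    · symm
      convert measure_empty (μ := trackKernel d κ ω)
      ext σ
      simp only [Set.mem_preimage, Set.mem_ofPred_eq, Set.mem_empty_iff_false, iff_false]
      intro h
      apply hne
      rw [← h (i + 1) hi, ← h i hi.le, trackPath_succ, add_sub_cancel_left, stepOf_stepVec]
    · refine nextLaw_eq_zero _ _ _ fun v hv => hne ?_
      rw [← hv, stepOf_stepVec]

lemma annealedLaw_snd {d : ℕ} [NeZero d] {P : Measure (Env d)} [IsProbabilityMeasure P] {κ : ℝ}
    (hκ : 0 < κ) (hell : UniformlyElliptic P κ) {E : Set (Path d)} (hE : MeasurableSet E) :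
    annealedLaw P {y | y.2 ∈ E} = trackLaw P κ (trackPath ⁻¹' E) := by
  have hmt : Measurable (trackPath (d := d)) := measurable_pi_lambda _ measurable_trackPath
  rw [trackLaw_apply P κ (hmt hE), annealedLaw]
  refine (Measure.compProd_apply (measurable_snd hE)).trans ?_
  refine lintegral_congr_ae ?_
  filter_upwards [hell] with ω hω
  rw [← Measure.map_apply hmt hE, ← quenchedLaw_eq_map hκ hω]
  rfl

/-! ## Admissible words and segments -/

/-- The height (first coordinate) reached by the first `i` letters of a word. -/
def height {d : ℕ} [NeZero d] (u : List (Letter d)) (i : ℕ) : ℤ := pos (u.take i) 0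

lemma height_append_left {d : ℕ} [NeZero d] (u v : List (Letter d)) {i : ℕ} (hi : i ≤ u.length) :
    height (u ++ v) i = height u i := by
  simp [height, List.take_append_of_le_length hi]

lemma height_append_right {d : ℕ} [NeZero d] (u v : List (Letter d)) (k : ℕ) :
    height (u ++ v) (u.length + k) = pos u 0 + height v k := by
  simp [height, List.take_append, List.take_of_length_le]

lemma height_take {d : ℕ} [NeZero d] (u : List (Letter d)) {i n : ℕ} (hi : i ≤ n) :
    height (u.take n) i = height u i := by
  simp [height, List.take_take, min_eq_left hi]

@[simp] lemma height_zero {d : ℕ} [NeZero d] (u : List (Letter d)) : height u 0 = 0 := by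
  simp [height]

lemma height_length {d : ℕ} [NeZero d] (u : List (Letter d)) : height u u.length = pos u 0 := by
  simp [height]

lemma height_pre {d : ℕ} [NeZero d] (σ : Track d) {i n : ℕ} (hi : i ≤ n) :
    height (pre σ n) i = trackPath σ i 0 := by
  simp [height, pre_take σ hi, trackPath]

/-- The number of visits of a word to a height. -/
def visits {d : ℕ} [NeZero d] (u : List (Letter d)) (j : ℕ) : ℕ :=
  ((Finset.range (u.length + 1)).filter fun i => height u i = j).card

/-- The words that violate neither of the two constraints defining `R`. -/
def Adm {d : ℕ} [NeZero d] (c : ℝ) (u : List (Letter d)) : Prop :=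
  (∀ i, 1 ≤ i → i ≤ u.length → 0 < height u i) ∧ ∀ j : ℕ, (visits u j : ℝ) ≤ c * (j + 1) ^ 2

lemma Adm.take {d : ℕ} [NeZero d] {c : ℝ} {u : List (Letter d)} (h : Adm c u) (n : ℕ) :
    Adm c (u.take n) := by
  refine ⟨fun i h1 h2 => ?_, fun j => le_trans ?_ (h.2 j)⟩
  · rw [List.length_take] at h2
    rw [height_take u (by omega)]
    exact h.1 i h1 (by omega)
  · norm_cast
    refine Finset.card_le_card fun i hi => ?_
    simp only [List.length_take, Finset.mem_filter, Finset.mem_range] at hi ⊢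
    rw [height_take u (by omega)] at hi
    exact ⟨by omega, hi.2⟩

/-- Let `h` be the final height of `u`, reached there for the first time. Levels below `h` are
visited only by `u`; a level `j ≥ h` is visited only by the second part, at most `c (j - h + 1)² ≤ c
(j + 1)²` times. The common endpoint is counted in `v`. -/
lemma Adm.append {d : ℕ} [NeZero d] {c : ℝ} (hc : 0 ≤ c) {u v : List (Letter d)} (hu : Adm c u)
    (hrec : ∀ i < u.length, height u i < pos u 0) (hv : Adm c v) : Adm c (u ++ v) := by
  have hpos : 0 ≤ pos u 0 := by
    rw [← height_length]
    rcases Nat.eq_zero_or_pos u.length with h | h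
    · simp [h]
    · exact (hu.1 _ h le_rfl).le
  have hv0 : ∀ k ≤ v.length, 0 ≤ height v k := by
    intro k hk
    rcases Nat.eq_zero_or_pos k with rfl | h
    · simp
    · exact (hv.1 k h hk).le
  refine ⟨fun i h1 h2 => ?_, fun j => ?_⟩
  · rcases le_total i u.length with h | h
    · rw [height_append_left _ _ h]
      exact hu.1 i h1 h
    · obtain ⟨k, rfl⟩ := Nat.exists_eq_add_of_le h
      rw [List.length_append] at h2
      rw [height_append_right]
      rcases Nat.eq_zero_or_pos k with rfl | hk
      · have := hu.1 u.length (by omega) le_rfl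
        rw [height_length] at this
        simpa using this
      · have := hv.1 k hk (by omega)
        omega
  · obtain ⟨h, hh⟩ := Int.eq_ofNat_of_zero_le hpos
    rcases lt_or_ge j h with hj | hj
    · refine le_trans ?_ (hu.2 j)
      norm_cast
      refine Finset.card_le_card fun i hi => ?_
      simp only [List.length_append, Finset.mem_filter, Finset.mem_range] at hi ⊢
      rcases lt_or_ge i u.length with h1 | h1
      · rw [height_append_left _ _ h1.le] at hi
        exact ⟨by omega, hi.2⟩
      · obtain ⟨k, rfl⟩ := Nat.exists_eq_add_of_le h1
        rw [height_append_right] at hi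
        have := hv0 k (by omega)
        omega
    · have hle : (visits (u ++ v) j : ℝ) ≤ visits v (j - h) := by
        norm_cast
        refine Finset.card_le_card_of_injOn (fun i => i - u.length) ?_ ?_
        · intro i hi
          simp only [List.length_append, Finset.coe_filter, Finset.mem_range, Set.mem_ofPred_eq]
            at hi ⊢
          rcases lt_or_ge i u.length with h1 | h1
          · rw [height_append_left _ _ h1.le] at hi
            have := hrec i h1
            omega
          · obtain ⟨k, rfl⟩ := Nat.exists_eq_add_of_le h1
            rw [height_append_right] at hi
            simp only [add_tsub_cancel_left]
            exact ⟨by omega, by omega⟩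
        · intro i hi i' hi' hii
          simp only [List.length_append, Finset.coe_filter, Finset.mem_range, Set.mem_ofPred_eq]
            at hi hi' hii
          have key : ∀ i, i < u.length + v.length + 1 ∧ height (u ++ v) i = j → u.length ≤ i := by
            intro i hi
            by_contra h1
            rw [height_append_left _ _ (by omega)] at hi
            have := hrec i (by omega)
            omega
          have := key i hi
          have := key i' hi'
          omega
      refine hle.trans ((hv.2 (j - h)).trans ?_)
      gcongr
      omega

/-- The letter used in the last `L` steps before a regeneration. -/
def upLetter (d : ℕ) [NeZero d] : Letter d := (some (0, true), true)

/-- At the end of the word the walk is at a candidate time. -/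
def CandWord {d : ℕ} [NeZero d] (L : ℕ) (u : List (Letter d)) : Prop :=
  L ≤ u.length ∧ (∀ i < u.length - L, height u i < height u (u.length - L)) ∧
    u.drop (u.length - L) = List.replicate L (upLetter d)

lemma pos_replicate {d : ℕ} [NeZero d] (L : ℕ) :
    pos (List.replicate L (upLetter d)) 0 = L := by
  induction L with
  | zero => simp
  | succ n ih =>
    rw [List.replicate_succ, pos_cons, Pi.add_apply, ih]
    simp [upLetter, stepVec]
    ring

lemma CandWord.eq_append {d : ℕ} [NeZero d] {L : ℕ} {u : List (Letter d)} (h : CandWord L u) :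
    u = u.take (u.length - L) ++ List.replicate L (upLetter d) := by
  rw [← h.2.2, List.take_append_drop]

lemma CandWord.height_add {d : ℕ} [NeZero d] {L : ℕ} {u : List (Letter d)} (h : CandWord L u)
    {k : ℕ} (hk : k ≤ L) : height u (u.length - L + k) = height u (u.length - L) + k := by
  have h1 := h.eq_append
  have hlen : (u.take (u.length - L)).length = u.length - L := by simp
  have h2 : height u (u.length - L + k) =
      pos (u.take (u.length - L)) 0 + height (List.replicate L (upLetter d)) k := by
    conv_lhs => rw [h1]
    rw [← height_append_right]
    congr 1
    simp
  rw [h2]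
  simp [height, List.take_replicate, min_eq_left hk, pos_replicate]

lemma CandWord.pos_eq {d : ℕ} [NeZero d] {L : ℕ} {u : List (Letter d)} (h : CandWord L u) :
    pos u 0 = height u (u.length - L) + L := by
  rw [← h.height_add le_rfl, ← height_length]
  congr 1
  have := h.1
  omega

lemma CandWord.record {d : ℕ} [NeZero d] {L : ℕ} {u : List (Letter d)} (h : CandWord L u) :
    ∀ i < u.length, height u i < pos u 0 := by
  intro i hi
  rw [h.pos_eq]
  rcases lt_or_ge i (u.length - L) with h1 | h1
  · have := h.2.1 i h1
    omega
  · obtain ⟨k, rfl⟩ := Nat.exists_eq_add_of_le h1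
    rw [h.height_add (by omega)]
    omega

/-- The words between two consecutive regenerations. -/
def IsSeg {d : ℕ} [NeZero d] (c : ℝ) (L : ℕ) (u : List (Letter d)) : Prop :=
  CandWord L u ∧ Adm c u ∧ ∀ m < u.length, CandWord L (u.take m) → ¬ Adm c (u.drop m)

/-! ## Good tracks -/

/-- The tracks for which `R = ∞`. -/
def GoodTrack {d : ℕ} [NeZero d] (c : ℝ) (σ : Track d) : Prop := ∀ n, Adm c (pre σ n)

/-- The event `R = ∞`. -/
def goodSet (d : ℕ) [NeZero d] (c : ℝ) : Set (Track d) := {σ | GoodTrack c σ}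

lemma goodSet_eq_iInter {d : ℕ} [NeZero d] (c : ℝ) :
    goodSet d c = ⋂ n, {σ | pre σ n ∈ {u | Adm c u}} := by
  ext σ; simp [goodSet, GoodTrack]

lemma measurableSet_goodSet {d : ℕ} [NeZero d] (c : ℝ) : MeasurableSet (goodSet d c) := by
  rw [goodSet_eq_iInter]
  exact MeasurableSet.iInter fun n => measurable_pre_preimage n _

/-- Regeneration at time `n`. -/
def RegAt {d : ℕ} [NeZero d] (c : ℝ) (L : ℕ) (σ : Track d) (n : ℕ) : Prop :=
  CandWord L (pre σ n) ∧ GoodTrack c (shiftTrack n σ)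

lemma drop_pre {d : ℕ} (σ : Track d) {m n : ℕ} (h : m ≤ n) :
    (pre σ n).drop m = pre (shiftTrack m σ) (n - m) := by
  obtain ⟨k, rfl⟩ := Nat.exists_eq_add_of_le h
  rw [pre_add, List.drop_left' (length_pre σ m)]
  simp

/-- If a good track starts at a record time `n`, then an earlier attempt started at `m` can only
fail before `n`: by `Adm.append` the word between `m` and `n`, if admissible, glues to the future.
Thus goodness from `m` becomes a condition on a finite word. -/
lemma good_shift_iff {d : ℕ} [NeZero d] {c : ℝ} (hc : 0 ≤ c) {σ : Track d} {m n : ℕ}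
    (hmn : m ≤ n) (hrec : ∀ i < n, height (pre σ n) i < pos (pre σ n) 0)
    (hn : GoodTrack c (shiftTrack n σ)) :
    GoodTrack c (shiftTrack m σ) ↔ Adm c ((pre σ n).drop m) := by
  rw [drop_pre σ hmn]
  refine ⟨fun h => h _, fun h k => ?_⟩
  rcases le_total k (n - m) with hk | hk
  · rw [← pre_take _ hk]
    exact h.take k
  · obtain ⟨l, rfl⟩ := Nat.exists_eq_add_of_le hk
    rw [pre_add, shiftTrack_add, show m + (n - m) = n by omega]
    refine h.append hc ?_ (hn l)
    intro i hi
    rw [length_pre] at hi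
    have h1 := hrec (m + i) (by omega)
    have h2 : pre σ n = pre σ m ++ pre (shiftTrack m σ) (n - m) := by
      rw [← pre_add]; congr 1; omega
    rw [h2, pos_append, Pi.add_apply] at h1
    have h3 := height_append_right (pre σ m) (pre (shiftTrack m σ) (n - m)) i
    rw [length_pre] at h3
    rw [h3] at h1
    omega

/-- Regeneration times look into the infinite future, but given a good track from `n`, being the
first one is a property of the first `n` letters. This makes sums over segments exact decompositions
of probabilities. -/
lemma isSeg_iff {d : ℕ} [NeZero d] {c : ℝ} (hc : 0 ≤ c) {L : ℕ} {σ : Track d} {n : ℕ}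
    (hn : GoodTrack c (shiftTrack n σ)) :
    IsSeg c L (pre σ n) ↔ GoodTrack c σ ∧ RegAt c L σ n ∧ ∀ m < n, ¬ RegAt c L σ m := by
  have key : CandWord L (pre σ n) → ∀ m ≤ n,
      (GoodTrack c (shiftTrack m σ) ↔ Adm c ((pre σ n).drop m)) := by
    intro h m hm
    refine good_shift_iff hc hm ?_ hn
    simpa using h.record
  constructor
  · rintro ⟨h1, h2, h3⟩
    refine ⟨?_, ⟨h1, hn⟩, ?_⟩
    · have := (key h1 0 (Nat.zero_le _)).2 (by simpa using h2)
      simpa using this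
    · rintro m hm ⟨h4, h5⟩
      refine h3 m (by simpa using hm) ?_ ((key h1 m hm.le).1 h5)
      rwa [pre_take σ hm.le]
  · rintro ⟨h1, ⟨h2, -⟩, h3⟩
    refine ⟨h2, h1 n, fun m hm h4 h5 => ?_⟩
    rw [length_pre] at hm
    rw [pre_take σ hm.le] at h4
    exact h3 m hm ⟨h4, (key h2 m hm.le).2 h5⟩

/-! ## Matching of paths with coins and tracks -/

/-- The path `X` uses the steps and the coins of the track `σ`. -/
def Match {d : ℕ} (ε : Coins d) (X : Path d) (σ : Track d) : Prop :=
  ∀ i, X (i + 1) - X i = stepVec (σ i).1 ∧ ε (i, X i) = (σ i).2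

lemma Match.shift {d : ℕ} {ε : Coins d} {X : Path d} {σ : Track d} (h : Match ε X σ) (n : ℕ) :
    Match (shiftCoins n ε) (shiftPath n X) (shiftTrack n σ) := fun i =>
  ⟨(h (n + i)).1, (h (n + i)).2⟩

lemma Match.path {d : ℕ} {ε : Coins d} {X : Path d} {σ : Track d} (h : Match ε X σ) (n : ℕ) :
    X n = X 0 + trackPath σ n := by
  induction n with
  | zero => simp
  | succ n ih =>
    have h1 := (h n).1
    rw [sub_eq_iff_eq_add] at h1
    rw [h1, trackPath_succ, ih]
    abel

lemma Match.levelVisits {d : ℕ} [NeZero d] {ε : Coins d} {X : Path d} {σ : Track d}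
    (h : Match ε X σ) (n j : ℕ) : levelVisits X n j = visits (pre σ n) j := by
  unfold RWRE.levelVisits visits
  rw [length_pre]
  congr 1
  refine Finset.filter_congr fun i hi => ?_
  rw [Finset.mem_range] at hi
  rw [height_pre σ (by omega), h.path i]
  simp

lemma Match.stopR_le {d : ℕ} [NeZero d] {ε : Coins d} {X : Path d} {σ : Track d}
    (h : Match ε X σ) {c : ℝ} {k : ℕ} (hk : ¬ Adm c (pre σ k)) : stopR c X ≤ k := by
  rw [Adm, not_and_or] at hk
  rcases hk with hk | hk
  · push Not at hk
    obtain ⟨i, h1, h2, h3⟩ := hk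
    rw [length_pre] at h2
    rw [height_pre σ h2] at h3
    refine inf_le_right.trans ((iInf₂_le i ⟨h1, ?_⟩).trans (by exact_mod_cast h2))
    rw [h.path i, Pi.add_apply]
    omega
  · push Not at hk
    obtain ⟨j, hj⟩ := hk
    refine inf_le_left.trans (iInf₂_le k ⟨j, ?_⟩)
    rwa [h.levelVisits]

lemma Match.stopR_eq_top {d : ℕ} [NeZero d] {ε : Coins d} {X : Path d} {σ : Track d}
    (h : Match ε X σ) {c : ℝ} : stopR c X = ⊤ ↔ GoodTrack c σ := by
  constructor
  · intro h1 k
    by_contra hk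
    have := h.stopR_le hk
    rw [h1] at this
    exact absurd this (by simp)
  · intro h1
    rw [stopR, backTime, inf_eq_top_iff, iInf₂_eq_top, iInf₂_eq_top]
    constructor
    · rintro n ⟨j, hj⟩
      exfalso
      rw [h.levelVisits] at hj
      exact absurd ((h1 n).2 j) (not_le.2 hj)
    · rintro n ⟨hn, hX⟩
      exfalso
      have := (h1 n).1 n hn (by simp)
      rw [height_pre σ le_rfl] at this
      rw [h.path n, Pi.add_apply] at hX
      omega

/-- Each failed attempt costs at least one unit of time, so the iteration `R_k` cannot stall. For `c
< 1` the visit at time `0` would already stop it. -/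
lemma one_le_stopR {d : ℕ} [NeZero d] {c : ℝ} (hc : 1 ≤ c) (X : Path d) : 1 ≤ stopR c X := by
  refine le_inf (le_iInf₂ ?_) (le_iInf₂ fun n hn => by exact_mod_cast hn.1)
  rintro n ⟨j, hj⟩
  rcases Nat.eq_zero_or_pos n with rfl | hn
  · exfalso
    have h1 : (levelVisits X 0 j : ℝ) ≤ 1 := by
      norm_cast
      exact (Finset.card_filter_le _ _).trans (by simp)
    have h2 : (1 : ℝ) ≤ c * (j + 1) ^ 2 := by
      have : (1 : ℝ) ≤ ((j : ℝ) + 1) ^ 2 := by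
        apply one_le_pow₀
        have : (0 : ℝ) ≤ j := by positivity
        linarith
      nlinarith
    linarith
  · exact_mod_cast hn

lemma drop_pre_eq_replicate {d : ℕ} [NeZero d] (σ : Track d) (L n : ℕ) (hL : L ≤ n) :
    (pre σ n).drop (n - L) = List.replicate L (upLetter d) ↔
      ∀ i, 1 ≤ i → i ≤ L → σ (n - i) = upLetter d := by
  rw [drop_pre σ (Nat.sub_le _ _), show n - (n - L) = L by omega, List.eq_replicate_iff,
    and_iff_right (length_pre _ _)]
  simp only [pre, List.mem_map, List.mem_range, forall_exists_index, and_imp,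
    forall_apply_eq_imp_iff₂, shiftTrack]
  constructor
  · intro h i h1 h2
    have := h (L - i) (by omega)
    rwa [show n - L + (L - i) = n - i by omega] at this
  · intro h i hi
    have := h (L - i) (by omega) (by omega)
    rwa [show n - (L - i) = n - L + i by omega] at this

lemma Match.isCandidate {d : ℕ} [NeZero d] {ε : Coins d} {X : Path d} {σ : Track d}
    (h : Match ε X σ) (L n : ℕ) : IsCandidate L ε X n ↔ CandWord L (pre σ n) := by
  unfold IsCandidate CandWord
  rw [length_pre]
  refine and_congr_right fun hL => and_congr ?_ ?_
  · refine forall₂_congr fun m hm => ?_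
    rw [height_pre σ (by omega), height_pre σ (by omega), h.path m, h.path (n - L)]
    simp
  · rw [drop_pre_eq_replicate σ L n hL]
    refine forall₃_congr fun i h1 h2 => ?_
    have e : (Pi.single 0 1 : Site d) = stepVec (some (0, true)) := rfl
    rw [(h (n - i)).1, (h (n - i)).2, e, stepVec_injective.eq_iff, upLetter, Prod.ext_iff, and_comm]

lemma candidateTime_spec {d : ℕ} [NeZero d] {L : ℕ} {ε : Coins d} {X : Path d} {t : ℕ∞} {m : ℕ}
    (h : candidateTime L ε X t = m) : t ≤ m ∧ IsCandidate L ε X m := by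
  have hne : ({n : ℕ | t ≤ n ∧ IsCandidate L ε X n}).Nonempty := by
    by_contra hemp
    rw [Set.not_nonempty_iff_eq_empty] at hemp
    have : candidateTime L ε X t = ⊤ := by
      rw [candidateTime, iInf₂_eq_top]
      intro n hn
      have : n ∈ ({n : ℕ | t ≤ n ∧ IsCandidate L ε X n}) := hn
      rw [hemp] at this
      exact this.elim
    rw [this] at h
    exact absurd h (by simp)
  have hmem := Nat.sInf_mem hne
  have heq : candidateTime L ε X t = (sInf {n : ℕ | t ≤ n ∧ IsCandidate L ε X n} : ℕ) := by
    apply le_antisymm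
    · exact iInf₂_le _ hmem
    · refine le_iInf₂ fun n hn => ?_
      exact_mod_cast Nat.sInf_le hn
  rw [heq] at h
  have h' : sInf {n : ℕ | t ≤ n ∧ IsCandidate L ε X n} = m := by exact_mod_cast h
  rw [h'] at hmem
  exact hmem

lemma Match.tauOne_spec {d : ℕ} [NeZero d] {ε : Coins d} {X : Path d} {σ : Track d}
    (h : Match ε X σ) {c : ℝ} {L m : ℕ} (hm : tauOne c L ε X = m) : RegAt c L σ m := by
  unfold tauOne at hm
  split_ifs at hm with hk
  · obtain ⟨h1, h2⟩ := Nat.find_spec hk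
    set k := Nat.find hk
    have h3 := candidateTime_spec hm
    refine ⟨(h.isCandidate L m).1 h3.2, ?_⟩
    rw [← (h.shift m).stopR_eq_top]
    have hm' : candidateTime L ε X (timeR c L ε X k) = m := hm
    have h4 : (m : ℕ∞) + stopR c (shiftPath m X) = ⊤ := by
      have h5 : timeR c L ε X (k + 1) = candidateTime L ε X (timeR c L ε X k) +
        stopR c (shiftPath (candidateTime L ε X (timeR c L ε X k)).toNat X) := rfl
      rw [hm', ENat.toNat_natCast] at h5
      rw [← h5, h2]
    by_contra hne
    obtain ⟨l, hl⟩ := ENat.ne_top_iff_exists.1 hne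
    rw [← hl] at h4
    exact absurd h4 (by norm_cast)
  · exact absurd hm (by simp)

/-- The search `S_1, R_1, S_2, …` does not jump over a regeneration time `n`: a failed attempt
started before `n` must fail by time `n`, by `good_shift_iff`. -/
lemma Match.tauOne_le {d : ℕ} [NeZero d] {ε : Coins d} {X : Path d} {σ : Track d}
    (h : Match ε X σ) {c : ℝ} (hc : 1 ≤ c) {L n : ℕ} (hn : RegAt c L σ n) :
    tauOne c L ε X ≤ n := by
  have hc0 : 0 ≤ c := by linarith
  set good : ℕ → Prop := fun k => timeS c L ε X k < ⊤ ∧ timeR c L ε X (k + 1) = ⊤ with hgood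
  have hS : ∀ k, timeR c L ε X k ≤ n → timeS c L ε X k ≤ n := fun k hk =>
    iInf₂_le n ⟨hk, (h.isCandidate L n).2 hn.1⟩
  -- The upper bound keeps `n` available as a candidate; the lower bound `k ≤ R_k` contradicts it at
  -- `k = n + 1` if no attempt ever succeeds.
  have claim : ∀ k, (∀ k' < k, ¬ good k') → timeR c L ε X k ≤ n ∧ (k : ℕ∞) ≤ timeR c L ε X k := by
    intro k
    induction k with
    | zero => intro _; simp [timeR]
    | succ k ih =>
      intro hk
      obtain ⟨h1, h2⟩ := ih fun k' hk' => hk k' (by omega)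
      have hSk := hS k h1
      obtain ⟨m, hm⟩ := ENat.ne_top_iff_exists.1 (ne_top_of_le_ne_top (ENat.natCast_ne_top n) hSk)
      have hmn : m ≤ n := by rw [← hm] at hSk; exact_mod_cast hSk
      have hm' : candidateTime L ε X (timeR c L ε X k) = m := hm.symm
      have h3 := candidateTime_spec hm'
      have hR : timeR c L ε X (k + 1) = m + stopR c (shiftPath m X) := by
        have h5 : timeR c L ε X (k + 1) = candidateTime L ε X (timeR c L ε X k) +
          stopR c (shiftPath (candidateTime L ε X (timeR c L ε X k)).toNat X) := rfl
        rwa [hm', ENat.toNat_natCast] at h5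
      have hnot : stopR c (shiftPath m X) ≠ ⊤ := by
        intro htop
        refine hk k (by omega) ⟨?_, ?_⟩
        · rw [← hm]; exact ENat.natCast_lt_top m
        · rw [hR, htop]; simp
      have hnadm : ¬ Adm c ((pre σ n).drop m) := by
        rw [← good_shift_iff hc0 hmn (by simpa using hn.1.record) hn.2,
          ← (h.shift m).stopR_eq_top]
        exact hnot
      rw [drop_pre σ hmn] at hnadm
      have hle := (h.shift m).stopR_le hnadm
      have h1le := one_le_stopR hc (shiftPath m X)
      obtain ⟨l, hl⟩ := ENat.ne_top_iff_exists.1 hnot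
      rw [hR]
      rw [← hl] at hle h1le ⊢
      have hkm : (k : ℕ∞) ≤ m := h2.trans h3.1
      norm_cast at hle h1le hkm ⊢
      omega
  by_cases hex : ∃ k, good k
  · have hfind := claim (Nat.find hex) fun k' hk' => Nat.find_min hex hk'
    have : tauOne c L ε X = timeS c L ε X (Nat.find hex) := by
      rw [tauOne, dif_pos hex]
    rw [this]
    exact hS _ hfind.1
  · exfalso
    push Not at hex
    have := claim (n + 1) fun k' _ => hex k'
    have h2 := this.2.trans this.1
    norm_cast at h2
    omega

lemma Match.tauOne_first {d : ℕ} [NeZero d] {ε : Coins d} {X : Path d} {σ : Track d}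
    (h : Match ε X σ) {c : ℝ} (hc : 1 ≤ c) {L n : ℕ} :
    tauOne c L ε X = n ↔ RegAt c L σ n ∧ ∀ m < n, ¬ RegAt c L σ m := by
  constructor
  · intro hn
    refine ⟨h.tauOne_spec hn, fun m hm hreg => ?_⟩
    have := h.tauOne_le hc hreg
    rw [hn] at this
    norm_cast at this
    omega
  · rintro ⟨h1, h2⟩
    have h3 := h.tauOne_le hc h1
    obtain ⟨m, hm⟩ := ENat.ne_top_iff_exists.1 (ne_top_of_le_ne_top (ENat.natCast_ne_top n) h3)
    have h4 := h.tauOne_spec hm.symm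
    rw [← hm] at h3 ⊢
    norm_cast at h3 ⊢
    rcases lt_or_eq_of_le h3 with h5 | h5
    · exact absurd h4 (h2 m h5)
    · exact h5

/-- The segments of the walk between regenerations. -/
abbrev Seg (d : ℕ) [NeZero d] (c : ℝ) (L : ℕ) : Type := {u : List (Letter d) // IsSeg c L u}

/-- The word composed of a list of segments, the most recent of which is the head of the list. -/
def segWord {d : ℕ} [NeZero d] {c : ℝ} {L : ℕ} : List (Seg d c L) → List (Letter d)
  | [] => []
  | w :: a => segWord a ++ w.1

/-- Since the track is good again from each regeneration time, `isSeg_iff` applies afresh after each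
shift. -/
lemma Match.tau_spec {d : ℕ} [NeZero d] {ε : Coins d} {X : Path d} {σ : Track d}
    (h : Match ε X σ) {c : ℝ} (hc : 1 ≤ c) (hgood : GoodTrack c σ) {L : ℕ} (n N : ℕ)
    (hN : tau c L ε X n = N) :
    ∃ a : List (Seg d c L), a.length = n ∧ segWord a = pre σ N ∧
      GoodTrack c (shiftTrack N σ) := by
  induction n generalizing N with
  | zero =>
    have : N = 0 := by
      have h0 : (0 : ℕ∞) = N := hN
      exact_mod_cast h0.symm
    subst this
    exact ⟨[], rfl, by simp [segWord], by simpa using hgood⟩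
  | succ n ih =>
    have h1 : tau c L ε X (n + 1) = tau c L ε X n +
      tauOne c L (shiftCoins (tau c L ε X n).toNat ε) (shiftPath (tau c L ε X n).toNat X) := rfl
    rw [hN] at h1
    have hne : tau c L ε X n ≠ ⊤ := by
      intro htop
      rw [htop] at h1
      simp at h1
    obtain ⟨M, hM⟩ := ENat.ne_top_iff_exists.1 hne
    rw [← hM, ENat.toNat_natCast] at h1
    have hne' : tauOne c L (shiftCoins M ε) (shiftPath M X) ≠ ⊤ := by
      intro htop
      rw [htop] at h1
      simp at h1
    obtain ⟨m, hm⟩ := ENat.ne_top_iff_exists.1 hne'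
    obtain ⟨a, ha, haw, hag⟩ := ih M hM.symm
    have hreg := ((h.shift M).tauOne_first hc).1 hm.symm
    have hseg := (isSeg_iff (by linarith) hreg.1.2).2 ⟨hag, hreg⟩
    rw [← hm] at h1
    norm_cast at h1
    refine ⟨⟨_, hseg⟩ :: a, by simp [ha], ?_, ?_⟩
    · rw [segWord, haw, h1, pre_add]
    · have := hreg.1.2
      rwa [shiftTrack_add, ← h1] at this

lemma Match.tau_succ {d : ℕ} [NeZero d] {ε : Coins d} {X : Path d} {σ : Track d}
    (h : Match ε X σ) {c : ℝ} (hc : 1 ≤ c) {L : ℕ} (n N m : ℕ) (hN : tau c L ε X n = N)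
    (hm : RegAt c L (shiftTrack N σ) m) : tau c L ε X (n + 1) < ⊤ := by
  have h1 : tau c L ε X (n + 1) = tau c L ε X n +
    tauOne c L (shiftCoins (tau c L ε X n).toNat ε) (shiftPath (tau c L ε X n).toNat X) := rfl
  rw [h1, hN, ENat.toNat_natCast]
  have := (h.shift N).tauOne_le hc hm
  refine lt_of_le_of_lt (add_le_add_right this _) ?_
  norm_cast
  exact ENat.natCast_lt_top _

/-! ## Conditional expectation given the environment in a set -/

lemma measurable_restrictEnv {d : ℕ} (Λ : Set (Site d)) : Measurable (restrictEnv Λ) :=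
  measurable_pi_lambda _ fun _ => measurable_pi_apply _

/-- The conditional expectation of `f` given the environment in `Λ`. -/
def condE {d : ℕ} (P : Measure (Env d)) [IsFiniteMeasure P] (Λ : Set (Site d))
    (f : Env d → ℝ≥0∞) (ω : Env d) : ℝ≥0∞ :=
  ∫⁻ ω', f ω' ∂(condDistrib id (restrictEnv Λ) P (restrictEnv Λ ω))

/-- The full-measure sets supplied by `ConditionG` need not be measurable; this replaces such a
property by a measurable stronger one. -/
lemma exists_measurable_of_ae {Ω : Type*} [MeasurableSpace Ω] {μ : Measure Ω} {p : Ω → Prop}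
    (h : ∀ᵐ ω ∂μ, p ω) : ∃ T : Set Ω, (∀ ω ∈ T, p ω) ∧ MeasurableSet T ∧ ∀ᵐ ω ∂μ, ω ∈ T := by
  refine ⟨(toMeasurable μ {ω | ¬ p ω})ᶜ, fun ω hω => ?_, (measurableSet_toMeasurable _ _).compl, ?_⟩
  · by_contra hn
    exact hω (subset_toMeasurable μ _ hn)
  · rw [ae_iff] at h ⊢
    simpa [measure_toMeasurable] using h

section condE

variable {d : ℕ} {P : Measure (Env d)} [IsFiniteMeasure P] {Λ : Set (Site d)}

lemma measurable_condE {f : Env d → ℝ≥0∞} (hf : Measurable f) : Measurable (condE P Λ f) := by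
  have h : Measurable fun η => ∫⁻ ω', f ω' ∂(condDistrib id (restrictEnv Λ) P η) :=
    hf.lintegral_kernel
  exact h.comp (measurable_restrictEnv Λ)

lemma dependsOn_condE (f : Env d → ℝ≥0∞) : DependsOn (condE P Λ f) Λ := by
  intro ω ω' h
  have : restrictEnv Λ ω = restrictEnv Λ ω' := funext fun x => h x x.2
  simp only [condE, this]

lemma condE_mono {f g : Env d → ℝ≥0∞} (h : f ≤ g) : condE P Λ f ≤ condE P Λ g :=
  fun _ => lintegral_mono h

lemma condE_const (c : ℝ≥0∞) : condE P Λ (fun _ => c) = fun _ => c := by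
  funext ω
  simp [condE]

lemma condE_tsum {ι : Type*} [Countable ι] {f : ι → Env d → ℝ≥0∞} (hf : ∀ i, Measurable (f i)) :
    condE P Λ (fun ω => ∑' i, f i ω) = fun ω => ∑' i, condE P Λ (f i) ω := by
  funext ω
  exact lintegral_tsum fun i => (hf i).aemeasurable

/-- Resampling given the environment in `Λ` preserves `P`, hence its null sets, and keeps the values
in `Λ`: the pair (restriction, environment) lies almost surely on a graph, which is then
disintegrated. -/
lemma condE_ae_of_ae {p : Env d → Prop} (hp : ∀ᵐ ω ∂P, p ω) :
    ∀ᵐ ω ∂P, ∀ᵐ ω' ∂(condDistrib id (restrictEnv Λ) P (restrictEnv Λ ω)),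
      p ω' ∧ ∀ x ∈ Λ, ω' x = ω x := by
  obtain ⟨T, hT, hTm, hTP⟩ := exists_measurable_of_ae hp
  have hm : Measurable fun ω : Env d => (restrictEnv Λ ω, id ω) :=
    (measurable_restrictEnv Λ).prodMk measurable_id
  have h1 : ∀ᵐ z ∂(P.map fun ω => (restrictEnv Λ ω, id ω)),
      z.2 ∈ T ∧ restrictEnv Λ z.2 = z.1 := by
    rw [ae_map_iff hm.aemeasurable]
    · filter_upwards [hTP] with ω hω
      exact ⟨hω, rfl⟩
    · exact (measurable_snd hTm).inter
        (measurableSet_eq_fun ((measurable_restrictEnv Λ).comp measurable_snd) measurable_fst)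
  rw [← compProd_map_condDistrib aemeasurable_id] at h1
  have h2 := Measure.ae_ae_of_ae_compProd h1
  have h3 := ae_of_ae_map (measurable_restrictEnv Λ).aemeasurable h2
  filter_upwards [h3] with ω hω
  filter_upwards [hω] with ω' hω'
  exact ⟨hT _ hω'.1, fun x hx => congrFun hω'.2 ⟨x, hx⟩⟩

lemma condE_congr_ae {f g : Env d → ℝ≥0∞} (h : f =ᵐ[P] g) : condE P Λ f =ᵐ[P] condE P Λ g := by
  filter_upwards [condE_ae_of_ae (Λ := Λ) h] with ω hω
  exact lintegral_congr_ae (hω.mono fun _ h => h.1)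

lemma lintegral_condE {h : (Λ → StepLaw d) × Env d → ℝ≥0∞} (hh : Measurable h) :
    ∫⁻ ω, ∫⁻ ω', h (restrictEnv Λ ω, ω') ∂(condDistrib id (restrictEnv Λ) P (restrictEnv Λ ω)) ∂P =
      ∫⁻ ω, h (restrictEnv Λ ω, ω) ∂P := by
  have hm : Measurable fun ω : Env d => (restrictEnv Λ ω, id ω) :=
    (measurable_restrictEnv Λ).prodMk measurable_id
  have h1 : ∫⁻ z, h z ∂(P.map fun ω => (restrictEnv Λ ω, id ω)) =
      ∫⁻ ω, h (restrictEnv Λ ω, ω) ∂P := lintegral_map hh hm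
  rw [← h1, ← compProd_map_condDistrib aemeasurable_id, Measure.lintegral_compProd hh,
    lintegral_map _ (measurable_restrictEnv Λ)]
  exact hh.lintegral_kernel_prod_right'

lemma lintegral_mul_condE {f g : Env d → ℝ≥0∞} (hf : Measurable f) (hg : Measurable g)
    (hgd : DependsOn g Λ) : ∫⁻ ω, g ω * condE P Λ f ω ∂P = ∫⁻ ω, g ω * f ω ∂P := by
  rw [← lintegral_condE (Λ := Λ) (h := fun z => g z.2 * f z.2)
    ((hg.mul hf).comp measurable_snd)]
  refine lintegral_congr_ae ?_
  filter_upwards [condE_ae_of_ae (P := P) (Λ := Λ) (p := fun _ => True)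
    (Eventually.of_forall fun _ => trivial)] with ω hω
  rw [condE, ← lintegral_const_mul _ hf]
  refine lintegral_congr_ae ?_
  filter_upwards [hω] with ω' hω'
  rw [hgd fun x hx => hω'.2 x hx]

/-- Conditional expectation is self-adjoint, which later moves the conditioning from the past
functional onto the future one. -/
lemma lintegral_condE_mul {f g : Env d → ℝ≥0∞} (hf : Measurable f) (hg : Measurable g) :
    ∫⁻ ω, condE P Λ f ω * g ω ∂P = ∫⁻ ω, f ω * condE P Λ g ω ∂P := by
  rw [← lintegral_mul_condE hg (measurable_condE hf) (dependsOn_condE f)]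
  simp_rw [mul_comm (condE P Λ f _), mul_comm (f _)]
  exact lintegral_mul_condE hf (measurable_condE hg) (dependsOn_condE g)

end condE

/-! ## The mixing inequality -/

open Classical in
/-- An environment with prescribed values in two sets. -/
def glue {d : ℕ} (V Δ : Set (Site d)) (z : (V → StepLaw d) × (Δ → StepLaw d)) : Env d :=
  fun x => if h : x ∈ Δ then z.2 ⟨x, h⟩ else if h : x ∈ V then z.1 ⟨x, h⟩ else Classical.arbitrary _

lemma measurable_glue {d : ℕ} (V Δ : Set (Site d)) : Measurable (glue V Δ) := by
  refine measurable_pi_lambda _ fun x => ?_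
  by_cases h : x ∈ Δ
  · simp only [glue, h, dif_pos]
    exact (measurable_pi_apply _).comp measurable_snd
  · by_cases h' : x ∈ V
    · simp only [glue, h, h', dif_neg, dif_pos, not_false_eq_true]
      exact (measurable_pi_apply _).comp measurable_fst
    · simp only [glue, h, h', dif_neg, not_false_eq_true]
      exact measurable_const

instance instIsMarkovKernelCondLaw {d : ℕ} (P : Measure (Env d)) [IsFiniteMeasure P]
    (Δ V : Set (Site d)) : IsMarkovKernel (condLaw P Δ V) := by
  unfold condLaw
  infer_instance

lemma lintegral_condLaw {d : ℕ} {P : Measure (Env d)} [IsFiniteMeasure P] {Δ V : Set (Site d)}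
    {h : (↥Vᶜ → StepLaw d) × (Δ → StepLaw d) → ℝ≥0∞} (hh : Measurable h) :
    ∫⁻ ω, ∫⁻ ξ, h (restrictEnv Vᶜ ω, ξ) ∂(condLaw P Δ V (restrictEnv Vᶜ ω)) ∂P =
      ∫⁻ ω, h (restrictEnv Vᶜ ω, restrictEnv Δ ω) ∂P := by
  have hm : Measurable fun ω : Env d => (restrictEnv Vᶜ ω, restrictEnv Δ ω) :=
    (measurable_restrictEnv _).prodMk (measurable_restrictEnv _)
  have h1 : ∫⁻ z, h z ∂(P.map fun ω => (restrictEnv Vᶜ ω, restrictEnv Δ ω)) =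
      ∫⁻ ω, h (restrictEnv Vᶜ ω, restrictEnv Δ ω) ∂P := lintegral_map hh hm
  rw [← h1, ← compProd_map_condDistrib (measurable_restrictEnv _).aemeasurable,
    Measure.lintegral_compProd hh, lintegral_map _ (measurable_restrictEnv _)]
  · rfl
  · exact hh.lintegral_kernel_prod_right'

/-- Integrating out the environment in `Δ` replaces `g` by a function `K` of the environment outside
`V`. By (G), `K` changes at most by the factor `θ` between environments that agree on `rec`. Both
integrals average `f ω' K`, with `ω'` resampled from `ω` given `rec`: one evaluates `K` at `ω`, the
other at `ω'`. -/
lemma mixing_core {d : ℕ} {P : Measure (Env d)} [IsProbabilityMeasure P]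
    {Δ V A rec old : Set (Site d)} {θ : ℝ≥0∞}
    (hG : ∃ S : Set (↥Vᶜ → StepLaw d), (∀ᵐ η ∂(P.map (restrictEnv Vᶜ)), η ∈ S) ∧
      ∀ η ∈ S, ∀ η' ∈ S, (∀ x : ↥Vᶜ, (x : Site d) ∉ A → η x = η' x) →
        ∀ B : Set (↥Δ → StepLaw d), MeasurableSet B →
          condLaw P Δ V η B ≤ θ * condLaw P Δ V η' B)
    (hrec : rec ⊆ Vᶜ) (hold : old ⊆ Vᶜ) (hA : Vᶜ \ A ⊆ rec)
    {f g : Env d → ℝ≥0∞} (hf : Measurable f) (hfd : DependsOn f (rec ∪ old))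
    (hg : Measurable g) (hgd : DependsOn g (rec ∪ Δ)) :
    ∫⁻ ω, condE P rec f ω * g ω ∂P ≤ θ * ∫⁻ ω, f ω * g ω ∂P ∧
      ∫⁻ ω, f ω * g ω ∂P ≤ θ * ∫⁻ ω, condE P rec f ω * g ω ∂P := by
  obtain ⟨S, hS, hSineq⟩ := hG
  have hgm : Measurable fun z => g (glue Vᶜ Δ z) := hg.comp (measurable_glue _ _)
  set K : (↥Vᶜ → StepLaw d) → ℝ≥0∞ := fun η => ∫⁻ ξ, g (glue Vᶜ Δ (η, ξ)) ∂(condLaw P Δ V η) with hK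
  have hKm : Measurable K := hgm.lintegral_kernel_prod_right'
  have hKm' : Measurable fun ω : Env d => K (restrictEnv Vᶜ ω) := hKm.comp (measurable_restrictEnv _)
  have hglue : ∀ ω : Env d, g (glue Vᶜ Δ (restrictEnv Vᶜ ω, restrictEnv Δ ω)) = g ω := by
    intro ω
    refine hgd fun x hx => ?_
    unfold glue restrictEnv
    split_ifs with h1 h2
    · rfl
    · rfl
    · rcases hx with hx | hx
      · exact absurd (hrec hx) h2
      · exact absurd hx h1
  -- integrating out the environment in `Δ`
  have hdis : ∀ φ : Env d → ℝ≥0∞, Measurable φ → DependsOn φ Vᶜ →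
      ∫⁻ ω, φ ω * g ω ∂P = ∫⁻ ω, φ ω * K (restrictEnv Vᶜ ω) ∂P := by
    intro φ hφ hφd
    have hfill : ∀ (ω : Env d) (ξ : (∅ : Set (Site d)) → StepLaw d),
        φ (glue Vᶜ ∅ (restrictEnv Vᶜ ω, ξ)) = φ ω := by
      intro ω ξ
      refine hφd fun x hx => ?_
      have h0 : x ∉ (∅ : Set (Site d)) := fun h => h
      simp only [glue, restrictEnv, h0, hx, dif_neg, dif_pos, not_false_eq_true]
    set ξ0 : (∅ : Set (Site d)) → StepLaw d := fun _ => Classical.arbitrary _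
    have hmm : Measurable fun z : (↥Vᶜ → StepLaw d) × (Δ → StepLaw d) =>
        φ (glue Vᶜ ∅ (z.1, ξ0)) * g (glue Vᶜ Δ z) :=
      (hφ.comp ((measurable_glue _ _).comp (measurable_fst.prodMk measurable_const))).mul hgm
    have h1 := lintegral_condLaw (P := P) hmm
    simp only [hfill, hglue] at h1
    rw [← h1]
    refine lintegral_congr fun ω => ?_
    rw [lintegral_const_mul]
    exact hgm.comp measurable_prodMk_left
  have hSae : ∀ᵐ ω ∂P, restrictEnv Vᶜ ω ∈ S :=
    ae_of_ae_map (measurable_restrictEnv _).aemeasurable hS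
  -- comparison of two environments that agree on `rec`
  have hcomp : ∀ ω ω' : Env d, restrictEnv Vᶜ ω ∈ S → restrictEnv Vᶜ ω' ∈ S →
      (∀ x ∈ rec, ω x = ω' x) → K (restrictEnv Vᶜ ω) ≤ θ * K (restrictEnv Vᶜ ω') := by
    intro ω ω' h1 h2 h3
    have hle : condLaw P Δ V (restrictEnv Vᶜ ω) ≤ θ • condLaw P Δ V (restrictEnv Vᶜ ω') := by
      refine Measure.le_iff.2 fun B hB => ?_
      rw [Measure.smul_apply, smul_eq_mul]
      exact hSineq _ h1 _ h2 (fun x hx => h3 x (hA ⟨x.2, hx⟩)) B hB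
    have heq : ∀ ξ, g (glue Vᶜ Δ (restrictEnv Vᶜ ω, ξ)) = g (glue Vᶜ Δ (restrictEnv Vᶜ ω', ξ)) := by
      intro ξ
      refine hgd fun x hx => ?_
      unfold glue restrictEnv
      split_ifs with h1 h2
      · rfl
      · rcases hx with hx | hx
        · exact h3 x hx
        · exact absurd hx h1
      · rfl
    simp only [hK, heq]
    refine (lintegral_mono' hle le_rfl).trans ?_
    rw [lintegral_smul_measure, smul_eq_mul]
  have hpair := condE_ae_of_ae (Λ := rec) hSae
  have hlhs : ∫⁻ ω, condE P rec f ω * g ω ∂P = ∫⁻ ω, ∫⁻ ω', f ω' * K (restrictEnv Vᶜ ω)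
      ∂(condDistrib id (restrictEnv rec) P (restrictEnv rec ω)) ∂P := by
    rw [hdis _ (measurable_condE hf) ((dependsOn_condE f).mono hrec)]
    refine lintegral_congr fun ω => ?_
    rw [lintegral_mul_const _ hf]
    rfl
  have hfK : Measurable fun ω => f ω * K (restrictEnv Vᶜ ω) := hf.mul hKm'
  have hrhs : ∫⁻ ω, f ω * g ω ∂P = ∫⁻ ω, ∫⁻ ω', f ω' * K (restrictEnv Vᶜ ω')
      ∂(condDistrib id (restrictEnv rec) P (restrictEnv rec ω)) ∂P := by
    rw [hdis f hf (hfd.mono (Set.union_subset hrec hold))]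
    exact (lintegral_condE (Λ := rec) (h := fun z => f z.2 * K (restrictEnv Vᶜ z.2))
      (hfK.comp measurable_snd)).symm
  have hmeas1 : Measurable fun ω => ∫⁻ ω', f ω' * K (restrictEnv Vᶜ ω')
      ∂(condDistrib id (restrictEnv rec) P (restrictEnv rec ω)) := measurable_condE hfK
  have hmeas2 : Measurable fun ω => ∫⁻ ω', f ω' * K (restrictEnv Vᶜ ω)
      ∂(condDistrib id (restrictEnv rec) P (restrictEnv rec ω)) := by
    have : (fun ω => ∫⁻ ω', f ω' * K (restrictEnv Vᶜ ω)
      ∂(condDistrib id (restrictEnv rec) P (restrictEnv rec ω))) =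
        fun ω => condE P rec f ω * K (restrictEnv Vᶜ ω) := by
      funext ω
      rw [lintegral_mul_const _ hf]
      rfl
    rw [this]
    exact (measurable_condE hf).mul hKm'
  rw [hlhs, hrhs]
  constructor
  · rw [← lintegral_const_mul _ hmeas1]
    refine lintegral_mono_ae ?_
    filter_upwards [hpair, hSae] with ω hω hωS
    rw [← lintegral_const_mul _ hfK]
    refine lintegral_mono_ae ?_
    filter_upwards [hω] with ω' hω'
    rw [mul_left_comm]
    exact mul_le_mul_right (hcomp ω ω' hωS hω'.1 fun x hx => (hω'.2 x hx).symm) _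
  · rw [← lintegral_const_mul _ hmeas2]
    refine lintegral_mono_ae ?_
    filter_upwards [hpair, hSae] with ω hω hωS
    rw [← lintegral_const_mul _ (hf.mul_const _)]
    refine lintegral_mono_ae ?_
    filter_upwards [hω] with ω' hω'
    rw [mul_left_comm]
    exact mul_le_mul_right (hcomp ω' ω hω'.1 hωS fun x hx => hω'.2 x hx) _

/-! ## Sums over the lattice -/

lemma summable_exp_natAbs {γ : ℝ} (hγ : 0 < γ) :
    Summable fun k : ℤ => Real.exp (-γ * (k.natAbs : ℝ)) := by
  have h : Summable fun n : ℕ => Real.exp (-γ * (n : ℝ)) := by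
    simpa [mul_comm] using Real.summable_exp_nat_mul_iff.2 (neg_neg_of_pos hγ)
  refine Summable.of_nat_of_neg ?_ ?_ <;> simpa using h

lemma summable_exp_dist1_zero {γ : ℝ} (hγ : 0 < γ) (d : ℕ) :
    Summable fun x : Site d => Real.exp (-γ * (dist1 x 0 : ℝ)) := by
  induction d with
  | zero => exact Summable.of_finite
  | succ n ih =>
    rw [← (Fin.consEquiv fun _ : Fin (n + 1) => ℤ).summable_iff]
    have h := (summable_exp_natAbs hγ).mul_of_nonneg ih (fun _ => (Real.exp_pos _).le)
      (fun _ => (Real.exp_pos _).le)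
    refine h.congr fun p => ?_
    rw [← Real.exp_add]
    simp only [Function.comp_apply, Fin.consEquiv_apply, dist1, Fin.sum_univ_succ, Fin.cons_zero,
      Fin.cons_succ, Pi.zero_apply, sub_zero]
    push_cast
    congr 1
    ring

lemma dist1_sub {d : ℕ} (x y : Site d) : dist1 x y = dist1 (x - y) 0 := by simp [dist1]

lemma dist1_comm {d : ℕ} (x y : Site d) : dist1 x y = dist1 y x := by
  unfold dist1
  refine Finset.sum_congr rfl fun i _ => ?_
  rw [← Int.natAbs_neg, neg_sub]

lemma summable_exp_dist1 {γ : ℝ} (hγ : 0 < γ) {d : ℕ} (y : Site d) :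
    Summable fun x : Site d => Real.exp (-γ * (dist1 x y : ℝ)) := by
  have h := (summable_exp_dist1_zero hγ d).comp_injective (sub_left_injective (b := y))
  refine h.congr fun x => ?_
  rw [Function.comp_apply, dist1_sub x y]

lemma tsum_exp_dist1 {γ : ℝ} {d : ℕ} (y : Site d) :
    ∑' x : Site d, Real.exp (-γ * (dist1 x y : ℝ)) = ∑' x : Site d, Real.exp (-γ * (dist1 x 0 : ℝ)) := by
  rw [← (Equiv.subRight y).tsum_eq fun x : Site d => Real.exp (-γ * (dist1 x 0 : ℝ))]
  refine tsum_congr fun x => ?_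
  rw [Equiv.subRight_apply, dist1_sub x y]

lemma finite_dist1_lt {d : ℕ} (y : Site d) (r : ℕ) : {x : Site d | dist1 x y < r}.Finite := by
  refine (Set.Finite.pi fun i => Set.finite_Icc (y i - r) (y i + r)).subset ?_
  intro x hx i _
  have h1 : (x i - y i).natAbs ≤ dist1 x y :=
    Finset.single_le_sum (f := fun i => (x i - y i).natAbs) (fun _ _ => Nat.zero_le _)
      (Finset.mem_univ i)
  have h2 : dist1 x y < r := hx
  simp only [Set.mem_Icc]
  omega

/-- The interaction between a finite set and another set. -/
def interaction {d : ℕ} (γ : ℝ) (old : Set (Site d)) (Δ : Finset (Site d)) : ℝ :=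
  ∑' x, old.indicator (fun x => ∑ y ∈ Δ, Real.exp (-γ * (dist1 x y : ℝ))) x

/-- (G) concerns finite `V`, so the complement of `V` contains sites far away besides `rec` and
`old`. Their interaction with `Δ` tends to `0` as the box grows, and the strict inequality `C *
interaction < φ` absorbs it. -/
lemma mixing {d : ℕ} {P : Measure (Env d)} [IsProbabilityMeasure P] {r : ℕ} (hr : 1 ≤ r)
    (hG : ConditionG P r) : ∃ γ : ℝ, 0 < γ ∧ ∃ C : ℝ, 0 ≤ C ∧
    ∀ (Δ : Finset (Site d)) (rec old : Set (Site d)),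
      (∀ x ∈ Δ, ∀ y ∈ rec ∪ old, r ≤ dist1 x y) →
      ∀ f g : Env d → ℝ≥0∞, Measurable f → DependsOn f (rec ∪ old) → Measurable g →
        DependsOn g (rec ∪ Δ) → ∀ φ : ℝ, C * interaction γ old Δ < φ →
        ∫⁻ ω, condE P rec f ω * g ω ∂P ≤ ENNReal.ofReal (Real.exp φ) * ∫⁻ ω, f ω * g ω ∂P ∧
        ∫⁻ ω, f ω * g ω ∂P ≤ ENNReal.ofReal (Real.exp φ) * ∫⁻ ω, condE P rec f ω * g ω ∂P := by
  classical
  obtain ⟨-, γ, hγ, C, hC⟩ := hG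
  refine ⟨γ, hγ, |C|, abs_nonneg C, ?_⟩
  intro Δ rec old hdist f g hf hfd hg hgd φ hφ
  set h : Site d → ℝ := fun x => ∑ y ∈ Δ, Real.exp (-γ * (dist1 x y : ℝ)) with hh
  have hsum : Summable h := summable_sum fun y _ => summable_exp_dist1 hγ y
  have hpos : ∀ x, 0 ≤ h x := fun x => Finset.sum_nonneg fun y _ => (Real.exp_pos _).le
  -- a large finite box
  obtain ⟨s, hs⟩ : ∃ s : Finset (Site d), |C| * (interaction γ old Δ +
      ∑' x, (s : Set (Site d))ᶜ.indicator h x) < φ ∧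
      ∀ x ∈ Δ, ∀ y, dist1 x y < r → y ∈ s := by
    have h1 := tendsto_tsum_compl_atTop_zero h
    have h2 : Tendsto (fun s : Finset (Site d) => |C| * (interaction γ old Δ +
        ∑' x, (s : Set (Site d))ᶜ.indicator h x)) atTop (𝓝 (|C| * (interaction γ old Δ + 0))) := by
      refine Tendsto.const_mul _ (Tendsto.const_add _ ?_)
      convert h1 using 2 with s
      exact (tsum_subtype ((s : Set (Site d))ᶜ) h).symm
    rw [add_zero] at h2
    have hfin : (⋃ x ∈ Δ, {y : Site d | dist1 x y < r}).Finite := by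
      refine Δ.finite_toSet.biUnion fun x _ => ?_
      simp_rw [dist1_comm x]
      exact finite_dist1_lt x r
    obtain ⟨s, hs1, hs2⟩ := ((h2.eventually (gt_mem_nhds hφ)).and
      (eventually_ge_atTop hfin.toFinset)).exists
    refine ⟨s, hs1, fun x hx y hy => hs2 ?_⟩
    rw [Set.Finite.mem_toFinset]
    exact Set.mem_biUnion hx hy
  set V : Set (Site d) := (s : Set (Site d)) \ (rec ∪ old) with hV
  have hVfin : V.Finite := s.finite_toSet.subset Set.sdiff_subset
  have hΔV : (Δ : Set (Site d)) ⊆ V := by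
    intro x hx
    have h0 : dist1 x x = 0 := by simp [dist1]
    refine ⟨hs.2 x hx x (by omega), fun hx' => ?_⟩
    have := hdist x hx x hx'
    omega
  have hΔVd : ∀ x ∈ (Δ : Set (Site d)), ∀ y ∉ V, r ≤ dist1 x y := by
    intro x hx y hy
    by_contra hlt
    push Not at hlt
    have hys := hs.2 x hx y hlt
    have : y ∈ rec ∪ old := by
      by_contra hn
      exact hy ⟨hys, hn⟩
    have := hdist x hx y this
    omega
  -- Everything outside `V` except `rec` may change: this is contained in `old` together with the
  -- exterior of the box.
  set A : Set (Site d) := Vᶜ \ rec with hA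
  obtain ⟨S, hS1, hS2⟩ := hC (Δ : Set (Site d)) V hVfin hΔV hΔVd A Set.sdiff_subset
  have hrecV : rec ⊆ Vᶜ := fun x hx hx' => hx'.2 (Or.inl hx)
  have holdV : old ⊆ Vᶜ := fun x hx hx' => hx'.2 (Or.inr hx)
  have hAsum : ∑' x : A, ∑' y : (Δ : Set (Site d)), Real.exp (-γ * dist1 (x : Site d) (y : Site d)) ≤
      interaction γ old Δ + ∑' x, (s : Set (Site d))ᶜ.indicator h x := by
    have e1 : ∀ x : Site d, ∑' y : (Δ : Set (Site d)), Real.exp (-γ * dist1 x (y : Site d)) = h x :=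
      fun x => Finset.tsum_subtype' Δ fun y => Real.exp (-γ * dist1 x y)
    simp_rw [e1]
    rw [tsum_subtype A h, interaction, ← (hsum.indicator old).tsum_add
      (hsum.indicator (s : Set (Site d))ᶜ)]
    refine (hsum.indicator A).tsum_le_tsum (fun x => ?_)
      ((hsum.indicator old).add (hsum.indicator (s : Set (Site d))ᶜ))
    by_cases hx : x ∈ A
    · rw [Set.indicator_of_mem hx]
      have hn1 := Set.indicator_nonneg (s := old) (fun x _ => hpos x) x
      have hn2 := Set.indicator_nonneg (s := (s : Set (Site d))ᶜ) (fun x _ => hpos x) x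
      by_cases hxs : x ∈ (s : Set (Site d))
      · have hxo : x ∈ old := by
          by_contra hn
          exact hx.1 ⟨hxs, fun h' => h'.elim hx.2 hn⟩
        rw [Set.indicator_of_mem hxo]
        linarith
      · rw [Set.indicator_of_mem (s := (s : Set (Site d))ᶜ) hxs]
        change h x ≤ old.indicator h x + h x
        linarith
    · rw [Set.indicator_of_notMem hx]
      exact add_nonneg (Set.indicator_nonneg (fun x _ => hpos x) x)
        (Set.indicator_nonneg (fun x _ => hpos x) x)
  refine mixing_core (A := A) (V := V) (Δ := (Δ : Set (Site d))) (old := old) ⟨S, hS1, ?_⟩ hrecV holdV ?_ hf hfd hg hgd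
  · intro η hη η' hη' hagree B hB
    refine (hS2 η hη η' hη' hagree B hB).trans ?_
    gcongr
    refine le_trans ?_ hs.1.le
    refine le_trans (mul_le_mul_of_nonneg_right (le_abs_self C) ?_)
      (mul_le_mul_of_nonneg_left hAsum (abs_nonneg C))
    exact tsum_nonneg fun x => tsum_nonneg fun y => (Real.exp_pos _).le
  · rintro x ⟨hx1, hx2⟩
    by_contra hn
    exact hx2 ⟨hx1, hn⟩

/-! ## Interaction of the past with admissible words -/

/-- The sites at which the letters of a word are used. -/
def sites {d : ℕ} (u : List (Letter d)) : Finset (Site d) := by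
  classical exact (Finset.range u.length).image fun i => pos (u.take i)

lemma mem_sites {d : ℕ} {u : List (Letter d)} {x : Site d} :
    x ∈ sites u ↔ ∃ i < u.length, pos (u.take i) = x := by
  classical
  simp [sites]

lemma Adm.height_nonneg {d : ℕ} [NeZero d] {c : ℝ} {u : List (Letter d)} (h : Adm c u) {i : ℕ}
    (hi : i ≤ u.length) : 0 ≤ height u i := by
  rcases Nat.eq_zero_or_pos i with rfl | h0
  · simp
  · exact (h.1 i h0 hi).le

lemma natAbs_le_dist1 {d : ℕ} (x y : Site d) (i : Fin d) : (x i - y i).natAbs ≤ dist1 x y :=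
  Finset.single_le_sum (f := fun i => (x i - y i).natAbs) (fun _ _ => Nat.zero_le _)
    (Finset.mem_univ i)

/-- The constant in the bound on the interaction. -/
def interactionConst (d : ℕ) (c γ : ℝ) : ℝ :=
  (∑' j : ℕ, c * ((j : ℝ) + 1) ^ 2 * Real.exp (-(γ / 2) * j)) *
    ∑' x : Site d, Real.exp (-(γ / 2) * (dist1 x 0 : ℝ))

lemma summable_levels {c γ : ℝ} (hγ : 0 < γ) :
    Summable fun j : ℕ => c * ((j : ℝ) + 1) ^ 2 * Real.exp (-(γ / 2) * j) := by
  have h := fun k => Real.summable_pow_mul_exp_neg_nat_mul k (half_pos hγ)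
  have h2 := ((h 2).add ((h 1).mul_left 2)).add (h 0)
  refine (h2.mul_left c).congr fun j => ?_
  ring

/-- A site of `old` and a site of the word at height `j` are at distance at least `t + j`. Half of
the exponent makes the sum over `old` finite, the other half gives `exp (-(γ/2)(t + j))`; the at
most `c (j+1)²` visits to level `j` leave a convergent sum over `j`. This is the role of the visit
constraint in `R`. -/
lemma interaction_sites_le {d : ℕ} [NeZero d] {c γ : ℝ} (hc : 0 ≤ c) (hγ : 0 < γ)
    {old : Set (Site d)} {t : ℕ} (hold : ∀ x ∈ old, x 0 < -(t : ℤ)) {u : List (Letter d)}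
    (hu : Adm c u) :
    interaction γ old (sites u) ≤ interactionConst d c γ * Real.exp (-(γ / 2) * t) := by
  classical
  have hK := fun y : Site d => summable_exp_dist1 (half_pos hγ) y
  set K := ∑' x : Site d, Real.exp (-(γ / 2) * (dist1 x 0 : ℝ)) with hKdef
  have hK0 : 0 ≤ K := tsum_nonneg fun x => (Real.exp_pos _).le
  have hsum : ∀ y : Site d, Summable fun x => old.indicator (fun x => Real.exp (-γ * (dist1 x y : ℝ))) x :=
    fun y => (summable_exp_dist1 hγ y).indicator old
  have h1 : interaction γ old (sites u) = ∑ y ∈ sites u,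
      ∑' x, old.indicator (fun x => Real.exp (-γ * (dist1 x y : ℝ))) x := by
    rw [interaction, ← Summable.tsum_finsetSum fun y _ => hsum y]
    refine tsum_congr fun x => ?_
    by_cases hx : x ∈ old <;> simp [hx]
  have h2 : ∀ i ≤ u.length, ∑' x, old.indicator
      (fun x => Real.exp (-γ * (dist1 x (pos (u.take i)) : ℝ))) x ≤
      K * Real.exp (-(γ / 2) * t) * Real.exp (-(γ / 2) * ((height u i).toNat : ℝ)) := by
    intro i hi
    rw [hKdef, ← tsum_exp_dist1 (pos (u.take i)), mul_assoc, ← tsum_mul_right]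
    refine (hsum _).tsum_le_tsum (fun x => ?_) ((hK _).mul_right _)
    by_cases hx : x ∈ old
    · rw [Set.indicator_of_mem hx, ← Real.exp_add, ← Real.exp_add]
      apply Real.exp_le_exp.2
      have h3 := natAbs_le_dist1 x (pos (u.take i)) 0
      have h4 := hold x hx
      have h5 := hu.height_nonneg hi
      have h6 : pos (u.take i) 0 = height u i := rfl
      have h7 : (t : ℝ) + ((height u i).toNat : ℝ) ≤ dist1 x (pos (u.take i)) := by
        have : t + (height u i).toNat ≤ dist1 x (pos (u.take i)) := by omega
        exact_mod_cast this
      nlinarith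
    · rw [Set.indicator_of_notMem hx]
      positivity
  have h3 : interaction γ old (sites u) ≤ ∑ i ∈ Finset.range u.length,
      K * Real.exp (-(γ / 2) * t) * Real.exp (-(γ / 2) * ((height u i).toNat : ℝ)) := by
    rw [h1]
    refine (Finset.sum_image_le_of_nonneg (fun y _ => ?_)).trans
      (Finset.sum_le_sum fun i hi => h2 i (Finset.mem_range.1 hi).le)
    exact tsum_nonneg fun x => Set.indicator_nonneg (fun x _ => (Real.exp_pos _).le) x
  refine h3.trans ?_
  rw [← Finset.mul_sum, interactionConst]
  suffices hS : ∑ i ∈ Finset.range u.length, Real.exp (-(γ / 2) * ((height u i).toNat : ℝ)) ≤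
      ∑' j : ℕ, c * ((j : ℝ) + 1) ^ 2 * Real.exp (-(γ / 2) * j) by
    refine (mul_le_mul_of_nonneg_left hS (by positivity)).trans (le_of_eq ?_)
    ring
  -- Group the times of the word by height; the fibre sizes are the visit counts.
  rw [Finset.sum_comp (fun j : ℕ => Real.exp (-(γ / 2) * (j : ℝ))) fun i => (height u i).toNat]
  refine le_trans (Finset.sum_le_sum (g := fun j : ℕ => c * ((j : ℝ) + 1) ^ 2 * Real.exp (-(γ / 2) * j))
    fun j _ => ?_) ((summable_levels hγ).sum_le_tsum _ fun j _ => by positivity)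
  rw [nsmul_eq_mul]
  refine mul_le_mul_of_nonneg_right (le_trans ?_ (hu.2 j)) (Real.exp_pos _).le
  norm_cast
  refine Finset.card_le_card fun i hi => ?_
  simp only [Finset.mem_filter, Finset.mem_range] at hi ⊢
  have := hu.height_nonneg (i := i) (by omega)
  exact ⟨by omega, by omega⟩

lemma interactionConst_nonneg {d : ℕ} {c γ : ℝ} (hc : 0 ≤ c) : 0 ≤ interactionConst d c γ :=
  mul_nonneg (tsum_nonneg fun j => by positivity) (tsum_nonneg fun x => (Real.exp_pos _).le)

/-! ## Decoupling of the past and the future -/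

/-- Functions of the environment above level `0` along admissible words are almost independent of
the environment below level `-t`, up to a factor `θ t`. -/
def Decouples {d : ℕ} [NeZero d] (P : Measure (Env d)) [IsFiniteMeasure P] (c : ℝ) (L : ℕ)
    (θ : ℕ → ℝ≥0∞) : Prop :=
  ∀ (t : ℕ) (u : List (Letter d)), Adm c u → ∀ rec old : Set (Site d),
    (∀ x ∈ rec ∪ old, x 0 < -(L : ℤ)) → (∀ x ∈ old, x 0 < -(t : ℤ)) →
    ∀ f g : Env d → ℝ≥0∞, Measurable f → DependsOn f (rec ∪ old) → Measurable g →
      DependsOn g (rec ∪ sites u) →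
      ∫⁻ ω, condE P rec f ω * g ω ∂P ≤ θ t * ∫⁻ ω, f ω * g ω ∂P ∧
      ∫⁻ ω, f ω * g ω ∂P ≤ θ t * ∫⁻ ω, condE P rec f ω * g ω ∂P

/-- `L ≥ r` provides the distance `r` required by (G), since words live at levels `≥ 0` and the past
below `-L`. The `+ 1` in the constant yields the strict inequality that `mixing` asks for. -/
lemma exists_decouples {d : ℕ} [NeZero d] {P : Measure (Env d)} [IsProbabilityMeasure P] {r : ℕ}
    (hr : 1 ≤ r) (hG : ConditionG P r) {c : ℝ} (hc : 0 ≤ c) :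
    ∃ a : ℝ, 0 < a ∧ ∃ D : ℝ, 0 ≤ D ∧ ∀ L : ℕ, r ≤ L →
      Decouples P c L fun t => ENNReal.ofReal (Real.exp (D * Real.exp (-a * t))) := by
  obtain ⟨γ, hγ, C, hC, hmix⟩ := mixing hr hG
  refine ⟨γ / 2, half_pos hγ, C * interactionConst d c γ + 1,
    add_nonneg (mul_nonneg hC (interactionConst_nonneg hc)) zero_le_one, ?_⟩
  intro L hL t u hu rec old hro hold f g hf hfd hg hgd
  refine hmix (sites u) rec old ?_ f g hf hfd hg hgd _ ?_
  · intro x hx y hy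
    obtain ⟨i, hi, rfl⟩ := mem_sites.1 hx
    have h1 := natAbs_le_dist1 (pos (u.take i)) y 0
    have h2 := hro y hy
    have h3 : 0 ≤ pos (u.take i) 0 := hu.height_nonneg hi.le
    omega
  · have h1 := mul_le_mul_of_nonneg_left (interaction_sites_le hc hγ hold hu) hC
    have h2 := Real.exp_pos (-(γ / 2) * (t : ℝ))
    refine lt_of_le_of_lt h1 ?_
    rw [add_mul, one_mul, ← mul_assoc]
    linarith

/-- The function `g` is almost independent of the environment in `old`, given that in `rec`. -/
def DecFun {d : ℕ} (P : Measure (Env d)) [IsFiniteMeasure P] (θ : ℝ≥0∞) (rec old : Set (Site d))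
    (g : Env d → ℝ≥0∞) : Prop :=
  ∀ f : Env d → ℝ≥0∞, Measurable f → DependsOn f (rec ∪ old) → (∀ ω, f ω ≤ 1) →
    ∫⁻ ω, condE P rec f ω * g ω ∂P ≤ θ * ∫⁻ ω, f ω * g ω ∂P ∧
    ∫⁻ ω, f ω * g ω ∂P ≤ θ * ∫⁻ ω, condE P rec f ω * g ω ∂P

lemma DecFun.tsum {d : ℕ} {P : Measure (Env d)} [IsFiniteMeasure P] {θ : ℝ≥0∞}
    {rec old : Set (Site d)} {ι : Type*} [Countable ι] {g : ι → Env d → ℝ≥0∞}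
    (hg : ∀ i, Measurable (g i)) (h : ∀ i, DecFun P θ rec old (g i)) :
    DecFun P θ rec old fun ω => ∑' i, g i ω := by
  intro f hf hfd hf1
  have e1 : ∫⁻ ω, f ω * ∑' i, g i ω ∂P = ∑' i, ∫⁻ ω, f ω * g i ω ∂P := by
    simp_rw [← ENNReal.tsum_mul_left]
    exact lintegral_tsum fun i => (hf.mul (hg i)).aemeasurable
  have e2 : ∫⁻ ω, condE P rec f ω * ∑' i, g i ω ∂P = ∑' i, ∫⁻ ω, condE P rec f ω * g i ω ∂P := by
    simp_rw [← ENNReal.tsum_mul_left]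
    exact lintegral_tsum fun i => ((measurable_condE hf).mul (hg i)).aemeasurable
  rw [e1, e2, ← ENNReal.tsum_mul_left, ← ENNReal.tsum_mul_left]
  exact ⟨ENNReal.tsum_le_tsum fun i => (h i f hf hfd hf1).1,
    ENNReal.tsum_le_tsum fun i => (h i f hf hfd hf1).2⟩

lemma condE_le_one {d : ℕ} {P : Measure (Env d)} [IsFiniteMeasure P] {Λ : Set (Site d)}
    {f : Env d → ℝ≥0∞} (hf : ∀ ω, f ω ≤ 1) (ω : Env d) : condE P Λ f ω ≤ 1 := by
  have h := condE_mono (P := P) (Λ := Λ) (g := fun _ => 1) hf ω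
  rwa [condE_const] at h

/-- Test the integrated inequality with the conditional expectation, given `rec ∪ old`, of the
indicator of an arbitrary set. Self-adjointness turns the two sides into integrals over that set of
the conditional expectations of `g` given `rec` and given `rec ∪ old`. -/
lemma DecFun.ae {d : ℕ} {P : Measure (Env d)} [IsFiniteMeasure P] {θ : ℝ≥0∞}
    {rec old : Set (Site d)} {g : Env d → ℝ≥0∞} (hg : Measurable g) (h : DecFun P θ rec old g) :
    (∀ᵐ ω ∂P, condE P rec g ω ≤ θ * condE P (rec ∪ old) g ω) ∧
      ∀ᵐ ω ∂P, condE P (rec ∪ old) g ω ≤ θ * condE P rec g ω := by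
  have key : ∀ s : Set (Env d), MeasurableSet s →
      ∫⁻ ω in s, condE P rec g ω ∂P ≤ θ * ∫⁻ ω in s, condE P (rec ∪ old) g ω ∂P ∧
      ∫⁻ ω in s, condE P (rec ∪ old) g ω ∂P ≤ θ * ∫⁻ ω in s, condE P rec g ω ∂P := by
    intro s hs
    set χ : Env d → ℝ≥0∞ := s.indicator fun _ => 1 with hχ
    have hχm : Measurable χ := measurable_const.indicator hs
    have hχ1 : ∀ ω, χ ω ≤ 1 := fun ω => Set.indicator_le_self' (fun _ _ => zero_le) ω
    have hint : ∀ φ : Env d → ℝ≥0∞, ∫⁻ ω in s, φ ω ∂P = ∫⁻ ω, χ ω * φ ω ∂P := by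
      intro φ
      rw [← lintegral_indicator hs]
      refine lintegral_congr fun ω => ?_
      by_cases hω : ω ∈ s <;> simp [hχ, hω]
    have hf := measurable_condE (P := P) (Λ := rec ∪ old) hχm
    have e1 : ∫⁻ ω in s, condE P rec g ω ∂P =
        ∫⁻ ω, condE P rec (condE P (rec ∪ old) χ) ω * g ω ∂P := by
      rw [lintegral_condE_mul hf hg, hint]
      have hd : DependsOn (condE P rec g) (rec ∪ old) :=
        (dependsOn_condE g).mono Set.subset_union_left
      simp_rw [mul_comm _ (condE P rec g _)]
      exact (lintegral_mul_condE hχm (measurable_condE hg) hd).symm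
    have e2 : ∫⁻ ω in s, condE P (rec ∪ old) g ω ∂P =
        ∫⁻ ω, condE P (rec ∪ old) χ ω * g ω ∂P := by
      rw [hint, lintegral_condE_mul hχm hg]
    rw [e1, e2]
    exact h _ hf (dependsOn_condE χ) (condE_le_one hχ1)
  have m1 := measurable_condE (P := P) (Λ := rec) hg
  have m2 := measurable_condE (P := P) (Λ := rec ∪ old) hg
  constructor
  · refine ae_le_of_forall_setLIntegral_le_of_sigmaFinite m1 fun s hs _ => ?_
    rw [lintegral_const_mul _ m2]
    exact (key s hs).1
  · refine ae_le_of_forall_setLIntegral_le_of_sigmaFinite m2 fun s hs _ => ?_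
    rw [lintegral_const_mul _ m1]
    exact (key s hs).2

/-! ## The probability that `R = ∞` -/

/-- The quenched probability of `R = ∞`. -/
def goodProb {d : ℕ} [NeZero d] (κ c : ℝ) (ω : Env d) : ℝ≥0∞ := trackKernel d κ ω (goodSet d c)

lemma measurable_goodProb {d : ℕ} [NeZero d] (κ c : ℝ) : Measurable (goodProb (d := d) κ c) :=
  Kernel.measurable_coe _ (measurableSet_goodSet c)

lemma goodProb_le_one {d : ℕ} [NeZero d] (κ c : ℝ) (ω : Env d) : goodProb κ c ω ≤ 1 := prob_le_one

lemma wordWeight_le_one {d : ℕ} (κ : ℝ) (u : List (Letter d)) (ω : Env d) :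
    wordWeight κ u ω ≤ 1 := by
  rw [← trackKernel_cyl]
  exact prob_le_one

open Classical in
/-- The probability that the first `N` letters are admissible. -/
def admProb {d : ℕ} [NeZero d] (κ c : ℝ) (N : ℕ) (ω : Env d) : ℝ≥0∞ :=
  ∑ u ∈ (finite_words d N).toFinset.filter fun u => Adm c u, wordWeight κ u ω

lemma admProb_eq {d : ℕ} [NeZero d] (κ c : ℝ) (N : ℕ) (ω : Env d) :
    admProb κ c N ω = trackKernel d κ ω {σ | pre σ N ∈ {u | Adm c u}} := by
  classical
  have h := measure_pre_inter (trackKernel d κ ω) N {u | Adm c u} Set.univ MeasurableSet.univ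
  simp only [Set.inter_univ, trackKernel_cyl] at h
  rw [h, admProb, Finset.sum_filter]
  refine Finset.sum_congr rfl fun u _ => ?_
  simp [Set.indicator_apply]

lemma tendsto_admProb {d : ℕ} [NeZero d] (κ c : ℝ) (ω : Env d) :
    Tendsto (fun N => admProb κ c N ω) atTop (𝓝 (goodProb κ c ω)) := by
  simp_rw [admProb_eq]
  rw [goodProb, goodSet_eq_iInter]
  refine tendsto_measure_iInter_atTop
    (fun N => (measurable_pre_preimage N _).nullMeasurableSet) ?_ ⟨0, measure_ne_top _ _⟩
  intro m n hmn σ hσ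
  have h : Adm c (pre σ n) := hσ
  change Adm c (pre σ m)
  rw [← pre_take σ hmn]
  exact h.take m

lemma admProb_le_one {d : ℕ} [NeZero d] (κ c : ℝ) (N : ℕ) (ω : Env d) : admProb κ c N ω ≤ 1 := by
  rw [admProb_eq]
  exact prob_le_one

lemma dependsOn_wordWeight {d : ℕ} (κ : ℝ) (u : List (Letter d)) :
    DependsOn (wordWeight κ u) (sites u) := by
  intro ω ω' h
  rw [wordWeight_eq_prod, wordWeight_eq_prod]
  refine Finset.prod_congr rfl fun i hi => ?_
  rw [h _ (mem_sites.2 ⟨i, Finset.mem_range.1 hi, rfl⟩)]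

lemma sites_append_left {d : ℕ} (u v : List (Letter d)) : sites u ⊆ sites (u ++ v) := by
  intro x hx
  obtain ⟨i, hi, rfl⟩ := mem_sites.1 hx
  exact mem_sites.2 ⟨i, by simp; omega, by rw [List.take_append_of_le_length hi.le]⟩

/-- Decoupling for functions of a word followed by a good track. -/
lemma Decouples.decFun {d : ℕ} [NeZero d] {P : Measure (Env d)} [IsFiniteMeasure P] {c : ℝ} {L : ℕ}
    {θ : ℕ → ℝ≥0∞} (hD : Decouples P c L θ) (hθ : ∀ t, θ t ≠ ∞) (κ : ℝ) {t : ℕ} {w : List (Letter d)}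
    (hw : ∀ v, Adm c v → Adm c (w ++ v)) {rec old : Set (Site d)}
    (hro : ∀ x ∈ rec ∪ old, x 0 < -(L : ℤ)) (hold : ∀ x ∈ old, x 0 < -(t : ℤ))
    {G : Env d → ℝ≥0∞} (hG : Measurable G) (hGd : DependsOn G (rec ∪ sites w))
    (hGi : ∫⁻ ω, G ω ∂P ≠ ∞) :
    DecFun P (θ t) rec old fun ω =>
      G ω * (wordWeight κ w ω * goodProb κ c (shiftEnv (pos w) ω)) := by
  classical
  intro f hf hfd hf1
  -- `goodProb` depends on infinitely many sites, whereas `Decouples` handles one finite word. Hence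
  -- sum over admissible continuations of length `N`, with the same constant for all of them, and
  -- let `N → ∞` by dominated convergence.
  have hprod : ∀ N ω, G ω * (wordWeight κ w ω * admProb κ c N (shiftEnv (pos w) ω)) =
      ∑ v ∈ (finite_words d N).toFinset.filter fun u => Adm c u, G ω * wordWeight κ (w ++ v) ω := by
    intro N ω
    rw [admProb, Finset.mul_sum, Finset.mul_sum]
    refine Finset.sum_congr rfl fun v _ => ?_
    rw [wordWeight_append]
  have hm : ∀ N, Measurable fun ω => G ω * (wordWeight κ w ω * admProb κ c N (shiftEnv (pos w) ω)) := by
    intro N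
    simp_rw [hprod]
    exact Finset.measurable_sum _ fun v _ => hG.mul (measurable_wordWeight κ _)
  have hfin : ∀ N,
      ∫⁻ ω, condE P rec f ω * (G ω * (wordWeight κ w ω * admProb κ c N (shiftEnv (pos w) ω))) ∂P ≤
        θ t * ∫⁻ ω, f ω * (G ω * (wordWeight κ w ω * admProb κ c N (shiftEnv (pos w) ω))) ∂P ∧
      ∫⁻ ω, f ω * (G ω * (wordWeight κ w ω * admProb κ c N (shiftEnv (pos w) ω))) ∂P ≤
        θ t * ∫⁻ ω, condE P rec f ω *
          (G ω * (wordWeight κ w ω * admProb κ c N (shiftEnv (pos w) ω))) ∂P := by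
    intro N
    have hmv : ∀ v, Measurable fun ω => G ω * wordWeight κ (w ++ v) ω :=
      fun v => hG.mul (measurable_wordWeight κ _)
    have e : ∀ φ : Env d → ℝ≥0∞, Measurable φ →
        ∫⁻ ω, φ ω * (G ω * (wordWeight κ w ω * admProb κ c N (shiftEnv (pos w) ω))) ∂P =
        ∑ v ∈ (finite_words d N).toFinset.filter fun u => Adm c u,
          ∫⁻ ω, φ ω * (G ω * wordWeight κ (w ++ v) ω) ∂P := by
      intro φ hφ
      simp_rw [hprod, Finset.mul_sum]
      exact lintegral_finsetSum _ fun v _ => hφ.mul (hmv v)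
    have hv : ∀ v ∈ (finite_words d N).toFinset.filter fun u => Adm c u, _ := fun v hv =>
      hD t (w ++ v) (hw v (Finset.mem_filter.1 hv).2) rec old hro hold f _ hf hfd (hmv v) (by
        intro ω ω' h
        have h1 : G ω = G ω' := hGd fun x hx => h x (hx.imp_right fun hx => sites_append_left w v hx)
        have h2 : wordWeight κ (w ++ v) ω = wordWeight κ (w ++ v) ω' :=
          dependsOn_wordWeight κ (w ++ v) fun x hx => h x (Or.inr hx)
        simp only [h1, h2])
    rw [e _ (measurable_condE hf), e _ hf, Finset.mul_sum, Finset.mul_sum]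
    exact ⟨Finset.sum_le_sum fun v h => (hv v h).1, Finset.sum_le_sum fun v h => (hv v h).2⟩
  have hlim : ∀ φ : Env d → ℝ≥0∞, Measurable φ → (∀ ω, φ ω ≤ 1) →
      Tendsto (fun N => ∫⁻ ω, φ ω *
        (G ω * (wordWeight κ w ω * admProb κ c N (shiftEnv (pos w) ω))) ∂P) atTop
        (𝓝 (∫⁻ ω, φ ω * (G ω * (wordWeight κ w ω * goodProb κ c (shiftEnv (pos w) ω))) ∂P)) := by
    intro φ hφ hφ1
    refine tendsto_lintegral_of_dominated_convergence G (fun N => hφ.mul (hm N)) ?_ hGi ?_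
    · intro N
      refine Eventually.of_forall fun ω => ?_
      calc φ ω * (G ω * (wordWeight κ w ω * admProb κ c N (shiftEnv (pos w) ω)))
          ≤ 1 * (G ω * (1 * 1)) := by
            gcongr
            · exact hφ1 ω
            · exact wordWeight_le_one κ w ω
            · exact admProb_le_one κ c N _
        _ = G ω := by simp
    · filter_upwards [ae_lt_top hG hGi] with ω hω
      have hφtop : φ ω ≠ ∞ := ne_top_of_le_ne_top ENNReal.one_ne_top (hφ1 ω)
      have hwtop : wordWeight κ w ω ≠ ∞ :=
        ne_top_of_le_ne_top ENNReal.one_ne_top (wordWeight_le_one κ w ω)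
      exact ENNReal.Tendsto.const_mul (ENNReal.Tendsto.const_mul (ENNReal.Tendsto.const_mul
        (tendsto_admProb κ c _) (Or.inr hwtop)) (Or.inr hω.ne)) (Or.inr hφtop)
  have l1 := hlim f hf hf1
  have l2 := hlim _ (measurable_condE (P := P) (Λ := rec) hf) (condE_le_one hf1)
  exact ⟨le_of_tendsto_of_tendsto' l2 (ENNReal.Tendsto.const_mul l1 (Or.inr (hθ t)))
      fun N => (hfin N).1,
    le_of_tendsto_of_tendsto' l1 (ENNReal.Tendsto.const_mul l2 (Or.inr (hθ t)))
      fun N => (hfin N).2⟩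

/-! ## Translations and relative weights -/

lemma TranslationInvariant.lintegral_shift {d : ℕ} {P : Measure (Env d)}
    (hP : TranslationInvariant P) (y : Site d) {f : Env d → ℝ≥0∞} (hf : Measurable f) :
    ∫⁻ ω, f (shiftEnv y ω) ∂P = ∫⁻ ω, f ω ∂P := by
  conv_rhs => rw [← hP y]
  rw [lintegral_map hf (measurable_shiftEnv y)]

lemma TranslationInvariant.ae_shift {d : ℕ} {P : Measure (Env d)} (hP : TranslationInvariant P)
    {p : Env d → Prop} (hp : ∀ᵐ ω ∂P, p ω) : ∀ᵐ ω ∂P, ∀ y, p (shiftEnv y ω) := by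
  rw [ae_all_iff]
  intro y
  have h := hp
  rw [← hP y] at h
  exact ae_of_ae_map (measurable_shiftEnv y).aemeasurable h

lemma UniformlyElliptic.two_mul_lt_one {d : ℕ} [NeZero d] {P : Measure (Env d)}
    [IsProbabilityMeasure P] {κ : ℝ} (hell : UniformlyElliptic P κ) : 2 * (d * κ) < 1 := by
  obtain ⟨ω, hω⟩ := hell.exists
  exact RWRE.two_mul_lt_one (ω 0) (hω 0)

/-- The weight of a word, seen from its endpoint. -/
def relWeight {d : ℕ} (κ : ℝ) (u : List (Letter d)) (ω : Env d) : ℝ≥0∞ :=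
  wordWeight κ u (shiftEnv (-pos u) ω)

lemma measurable_relWeight {d : ℕ} (κ : ℝ) (u : List (Letter d)) : Measurable (relWeight κ u) :=
  (measurable_wordWeight κ u).comp (measurable_shiftEnv _)

lemma relWeight_le_one {d : ℕ} (κ : ℝ) (u : List (Letter d)) (ω : Env d) : relWeight κ u ω ≤ 1 :=
  wordWeight_le_one κ u _

lemma relWeight_append_shift {d : ℕ} (κ : ℝ) (u v : List (Letter d)) (ω : Env d) :
    relWeight κ (u ++ v) (shiftEnv (pos v) ω) = relWeight κ u ω * wordWeight κ v ω := by
  simp only [relWeight, shiftEnv_shiftEnv, pos_append, wordWeight_append]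
  have h1 : pos v + -(pos u + pos v) = -pos u := by abel
  rw [h1, neg_add_cancel, shiftEnv_zero]

/-- The sites visited before the last `L` steps of a word, seen from its endpoint. -/
def core {d : ℕ} (L : ℕ) (u : List (Letter d)) : Set (Site d) :=
  {x | x + pos u ∈ sites (u.take (u.length - L))}

lemma CandWord.core_level {d : ℕ} [NeZero d] {L : ℕ} {u : List (Letter d)} (h : CandWord L u)
    {x : Site d} (hx : x ∈ core L u) : x 0 < -(L : ℤ) := by
  obtain ⟨i, hi, hx⟩ := mem_sites.1 hx
  rw [List.length_take] at hi
  have h1 : i < u.length - L := lt_of_lt_of_le hi (min_le_left _ _)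
  have h2 := h.2.1 i h1
  have h3 := h.pos_eq
  rw [List.take_take, min_eq_left h1.le] at hx
  have h4 : height u i = x 0 + pos u 0 := by rw [height, hx]; rfl
  omega

lemma wordWeight_replicate {d : ℕ} [NeZero d] {κ : ℝ} (hκ : 0 < κ) (h2 : 2 * (d * κ) < 1) (L : ℕ)
    (ω : Env d) :
    wordWeight κ (List.replicate L (upLetter d)) ω = ENNReal.ofReal (κ / 2) ^ L := by
  induction L generalizing ω with
  | zero => simp
  | succ n ih =>
    rw [List.replicate_succ, wordWeight, ih, upLetter, letterWeight_true hκ h2, pow_succ, mul_comm]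

lemma CandWord.wordWeight_eq {d : ℕ} [NeZero d] {κ : ℝ} (hκ : 0 < κ) (h2 : 2 * (d * κ) < 1) {L : ℕ}
    {u : List (Letter d)} (h : CandWord L u) (ω : Env d) :
    wordWeight κ u ω = wordWeight κ (u.take (u.length - L)) ω * ENNReal.ofReal (κ / 2) ^ L := by
  conv_lhs => rw [h.eq_append]
  rw [wordWeight_append, wordWeight_replicate hκ h2]

lemma CandWord.dependsOn_relWeight {d : ℕ} [NeZero d] {κ : ℝ} (hκ : 0 < κ)
    (h2 : 2 * (d * κ) < 1) {L : ℕ} {u : List (Letter d)} (h : CandWord L u) :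
    DependsOn (relWeight κ u) (core L u) := by
  intro ω ω' hω
  rw [relWeight, relWeight, h.wordWeight_eq hκ h2, h.wordWeight_eq hκ h2,
    dependsOn_wordWeight κ (u.take (u.length - L)) fun x hx => ?_]
  exact hω _ (by simpa [core] using hx)

lemma trackLaw_markov {d : ℕ} {P : Measure (Env d)} (κ : ℝ)
    (u : List (Letter d)) {E : Set (Track d)} (hE : MeasurableSet E) :
    trackLaw P κ (cyl u ∩ shiftTrack u.length ⁻¹' E) =
      ∫⁻ ω, wordWeight κ u ω * trackKernel d κ (shiftEnv (pos u) ω) E ∂P := by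
  rw [trackLaw_apply P κ ((measurableSet_cyl u).inter (measurable_shiftTrack _ hE))]
  simp_rw [trackKernel_markov κ _ u hE]

lemma TranslationInvariant.trackLaw_markov {d : ℕ} {P : Measure (Env d)}
    (hP : TranslationInvariant P) (κ : ℝ)
    (u : List (Letter d)) {E : Set (Track d)} (hE : MeasurableSet E) :
    trackLaw P κ (cyl u ∩ shiftTrack u.length ⁻¹' E) =
      ∫⁻ ω, relWeight κ u ω * trackKernel d κ ω E ∂P := by
  rw [RWRE.trackLaw_markov κ u hE]
  refine Eq.trans ?_ (hP.lintegral_shift (pos u)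
    ((measurable_relWeight κ u).mul ((trackKernel d κ).measurable_coe hE)))
  refine lintegral_congr fun ω => ?_
  simp [relWeight, shiftEnv_shiftEnv]

/-- The annealed track is not stationary, but its shift by `m` is absolutely continuous: given the
first `m` letters, recentring the environment bounds the probability by that of the unshifted event.
-/
lemma TranslationInvariant.trackLaw_shift_null {d : ℕ} {P : Measure (Env d)}
    (hP : TranslationInvariant P) (κ : ℝ) {E : Set (Track d)} (hE : MeasurableSet E)
    (h0 : trackLaw P κ E = 0) (m : ℕ) : trackLaw P κ (shiftTrack m ⁻¹' E) = 0 := by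
  have h := measure_pre_inter (trackLaw P κ) m Set.univ _ (measurable_shiftTrack m hE)
  simp only [Set.mem_univ, Set.indicator_univ] at h
  rw [show {σ : Track d | True} = Set.univ from rfl, Set.univ_inter] at h
  rw [h]
  refine Finset.sum_eq_zero fun u hu => ?_
  have hu : u.length = m := by simpa using hu
  subst hu
  rw [hP.trackLaw_markov κ u hE, ← nonpos_iff_eq_zero, ← h0, trackLaw_apply P κ hE]
  exact lintegral_mono fun ω => mul_le_of_le_one_left zero_le (relWeight_le_one κ u ω)

/-! ## Regeneration after a record -/

/-- The probability that `R = ∞`. -/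
def goodMass {d : ℕ} [NeZero d] (P : Measure (Env d)) (κ c : ℝ) : ℝ≥0∞ := ∫⁻ ω, goodProb κ c ω ∂P

lemma goodMass_eq {d : ℕ} [NeZero d] (P : Measure (Env d)) (κ c : ℝ) :
    goodMass P κ c = trackLaw P κ (goodSet d c) :=
  (trackLaw_apply P κ (measurableSet_goodSet c)).symm

lemma goodMass_le_one {d : ℕ} [NeZero d] (P : Measure (Env d)) [IsProbabilityMeasure P] (κ c : ℝ) :
    goodMass P κ c ≤ 1 := by
  rw [goodMass_eq]; exact prob_le_one

lemma condE_empty {d : ℕ} {P : Measure (Env d)} [IsProbabilityMeasure P] {f : Env d → ℝ≥0∞}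
    (hf : Measurable f) (ω : Env d) : condE P ∅ f ω = ∫⁻ ω', f ω' ∂P := by
  have h1 : ∀ ω', condE P ∅ f ω' = condE P ∅ f ω := fun ω' =>
    dependsOn_condE f fun x hx => hx.elim
  have h2 := lintegral_mul_condE (P := P) (Λ := ∅) hf (g := fun _ => 1) measurable_const
    (fun _ _ _ => rfl)
  simp only [one_mul] at h2
  rw [← h2]
  simp_rw [h1]
  simp

lemma Decouples.decFun_goodProb {d : ℕ} [NeZero d] {P : Measure (Env d)} [IsProbabilityMeasure P]
    {c : ℝ} {L : ℕ} {θ : ℕ → ℝ≥0∞} (hD : Decouples P c L θ) (hθ : ∀ t, θ t ≠ ∞) (κ : ℝ) {t : ℕ}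
    {rec old : Set (Site d)} (hro : ∀ x ∈ rec ∪ old, x 0 < -(L : ℤ))
    (hold : ∀ x ∈ old, x 0 < -(t : ℤ)) :
    DecFun P (θ t) rec old (goodProb κ c) := by
  have h := hD.decFun hθ κ (t := t) (w := []) (fun v hv => hv) hro hold
    (G := fun _ => 1) measurable_const (fun _ _ _ => rfl) (by simp)
  simpa using h

/-- Decoupling with nothing kept in `rec`: the past below `-L` and the good future are independent
up to the factor `θ L`. -/
lemma Decouples.mul_goodMass_le {d : ℕ} [NeZero d] {P : Measure (Env d)} [IsProbabilityMeasure P]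
    {c : ℝ} {L : ℕ} {θ : ℕ → ℝ≥0∞} (hD : Decouples P c L θ) (hθ : ∀ t, θ t ≠ ∞) (κ : ℝ)
    {f : Env d → ℝ≥0∞} (hf : Measurable f) (hf1 : ∀ ω, f ω ≤ 1) {Λ : Set (Site d)}
    (hΛ : ∀ x ∈ Λ, x 0 < -(L : ℤ)) (hfd : DependsOn f Λ) :
    (∫⁻ ω, f ω ∂P) * goodMass P κ c ≤ θ L * ∫⁻ ω, f ω * goodProb κ c ω ∂P := by
  have h := (hD.decFun_goodProb hθ κ (t := L) (rec := ∅) (old := Λ) (by simpa using hΛ) hΛ f hf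
    (by simpa using hfd) hf1).1
  simp_rw [condE_empty hf] at h
  rwa [lintegral_const_mul _ (measurable_goodProb κ c)] at h

/-- Continue the record by `L` letters `upLetter`, at cost exactly `(κ/2)^L`, and then by a good
track. Seen from the end of these letters the past lies below `-L`, so the good track is almost
independent of it. -/
lemma Decouples.le_regen {d : ℕ} [NeZero d] {P : Measure (Env d)} [IsProbabilityMeasure P]
    (hP : TranslationInvariant P)
    {c : ℝ} {L : ℕ} {θ : ℕ → ℝ≥0∞} (hD : Decouples P c L θ) (hθ : ∀ t, θ t ≠ ∞) {κ : ℝ} (hκ : 0 < κ)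
    (h2 : 2 * (d * κ) < 1) {u : List (Letter d)} (hu : ∀ i < u.length, height u i < pos u 0) :
    trackLaw P κ (cyl u) * (ENNReal.ofReal (κ / 2) ^ L * goodMass P κ c) ≤
      θ L * trackLaw P κ (cyl u ∩ {σ | ∃ m, RegAt c L σ m}) := by
  set v := u ++ List.replicate L (upLetter d) with hv
  have hvlen : v.length - L = u.length := by simp [hv]
  have hcand : CandWord L v := by
    refine ⟨by simp [hv], ?_, ?_⟩
    · rw [hvlen]
      intro i hi
      rw [hv, height_append_left _ _ hi.le, height_append_left _ _ le_rfl, height_length]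
      exact hu i hi
    · rw [hvlen, hv, List.drop_left]
  have hm := measurableSet_goodSet (d := d) c
  have h1 : trackLaw P κ (cyl v ∩ shiftTrack v.length ⁻¹' goodSet d c) ≤
      trackLaw P κ (cyl u ∩ {σ | ∃ m, RegAt c L σ m}) := by
    refine measure_mono ?_
    rintro σ ⟨hσ, hg⟩
    have hσ' : pre σ v.length = v := hσ
    refine ⟨?_, v.length, ?_, hg⟩
    · rw [hv, cyl_append] at hσ
      exact hσ.1
    · rwa [hσ']
  refine le_trans ?_ (mul_le_mul_right h1 _)
  rw [hP.trackLaw_markov κ v hm]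
  refine le_trans (le_of_eq ?_) (hD.mul_goodMass_le hθ κ (measurable_relWeight κ v)
    (relWeight_le_one κ v) (fun x hx => hcand.core_level hx) (hcand.dependsOn_relWeight hκ h2))
  rw [← mul_assoc]
  congr 1
  rw [← lintegral_congr fun ω => (relWeight.eq_1 κ v ω).symm,
    hP.lintegral_shift _ (measurable_wordWeight κ v), trackLaw_apply P κ (measurableSet_cyl u),
    ← lintegral_mul_const _ ((trackKernel d κ).measurable_coe (measurableSet_cyl u))]
  refine lintegral_congr fun ω => ?_
  rw [trackKernel_cyl, hv, wordWeight_append, wordWeight_replicate hκ h2]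

/-! ## Regenerations occur -/

lemma isSetAlgebra_finiteEvents (d : ℕ) : IsSetAlgebra (finiteEvents d) where
  empty_mem := ⟨0, ∅, by simp⟩
  compl_mem := by
    rintro _ ⟨n, S, rfl⟩
    exact ⟨n, Sᶜ, rfl⟩
  union_mem := by
    rintro _ _ ⟨m, S, rfl⟩ ⟨n, S', rfl⟩
    refine ⟨max m n, {u | u.take m ∈ S ∨ u.take n ∈ S'}, ?_⟩
    ext σ
    simp [pre_take σ (le_max_left m n), pre_take σ (le_max_right m n)]

/-- A Lévy zero-one law without martingales. Stopping at the first visit to `Rec` after time `n`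
gives `p μ(A ∩ I) ≤ μ(A ∩ E)` for every finite event `A`. If `I \ E` had positive mass, a finite
event approximating it within half of `p μ(I \ E)` would violate this. -/
lemma measure_infinitely_often_diff {d : ℕ} (μ : Measure (Track d)) [IsProbabilityMeasure μ]
    {E : Set (Track d)} (hE : MeasurableSet E) {p : ℝ≥0∞} (hp : p ≠ 0) (hp1 : p ≤ 1)
    (Rec : Set (List (Letter d))) (h : ∀ u ∈ Rec, p * μ (cyl u) ≤ μ (cyl u ∩ E)) :
    μ ({σ | ∀ n, ∃ m, n ≤ m ∧ pre σ m ∈ Rec} \ E) = 0 := by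
  classical
  set I : Set (Track d) := {σ | ∀ n, ∃ m, n ≤ m ∧ pre σ m ∈ Rec} with hI
  have hfin : ∀ m (S : Set (List (Letter d))), (∀ u ∈ S, u ∈ Rec) →
      p * μ {σ | pre σ m ∈ S} ≤ μ ({σ | pre σ m ∈ S} ∩ E) := by
    intro m S hS
    have h1 := measure_pre_inter μ m S Set.univ MeasurableSet.univ
    rw [Set.inter_univ] at h1
    rw [measure_pre_inter μ m S E hE, h1, Finset.mul_sum]
    refine Finset.sum_le_sum fun u _ => ?_
    by_cases hu : u ∈ S
    · simpa [hu] using h u (hS u hu)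
    · simp [hu]
  have key : ∀ n (S : Set (List (Letter d))), p * μ ({σ | pre σ n ∈ S} ∩ I) ≤ μ ({σ | pre σ n ∈ S} ∩ E) := by
    intro n S
    -- Words whose first prefix in `Rec` from time `n` on is the whole word, of length `m`; these
    -- events are disjoint in `m`.
    set B : ℕ → Set (List (Letter d)) := fun m =>
      {u | n ≤ m ∧ u.take n ∈ S ∧ u ∈ Rec ∧ ∀ k, n ≤ k → k < m → u.take k ∉ Rec} with hB
    have hsub : {σ | pre σ n ∈ S} ∩ I ⊆ ⋃ m, {σ | pre σ m ∈ B m} := by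
      rintro σ ⟨h1, h2⟩
      obtain ⟨h3, h4⟩ := Nat.find_spec (h2 n)
      refine Set.mem_iUnion.2 ⟨Nat.find (h2 n), h3, ?_, h4, fun k hk1 hk2 => ?_⟩
      · rwa [pre_take σ h3]
      · rw [pre_take σ hk2.le]
        exact fun hk3 => Nat.find_min (h2 n) hk2 ⟨hk1, hk3⟩
    have hdisj : Pairwise (Function.onFun Disjoint fun m => {σ : Track d | pre σ m ∈ B m} ∩ E) := by
      have hlt : ∀ k m, k < m → ∀ σ : Track d, pre σ k ∈ B k → pre σ m ∈ B m → False := by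
        intro k m hkm σ h1 h2
        refine h2.2.2.2 k h1.1 hkm ?_
        rw [pre_take σ hkm.le]
        exact h1.2.2.1
      intro k m hkm
      refine Set.disjoint_left.2 fun σ h1 h2 => ?_
      rcases lt_or_gt_of_ne hkm with hlt' | hlt'
      · exact hlt k m hlt' σ h1.1 h2.1
      · exact hlt m k hlt' σ h2.1 h1.1
    calc p * μ ({σ | pre σ n ∈ S} ∩ I) ≤ p * ∑' m, μ {σ | pre σ m ∈ B m} := by
          gcongr
          exact (measure_mono hsub).trans (measure_iUnion_le _)
      _ = ∑' m, p * μ {σ | pre σ m ∈ B m} := ENNReal.tsum_mul_left.symm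
      _ ≤ ∑' m, μ ({σ | pre σ m ∈ B m} ∩ E) :=
          ENNReal.tsum_le_tsum fun m => hfin m _ fun u hu => hu.2.2.1
      _ = μ (⋃ m, {σ | pre σ m ∈ B m} ∩ E) :=
          (measure_iUnion hdisj fun m => (measurable_pre_preimage m _).inter hE).symm
      _ ≤ μ ({σ | pre σ n ∈ S} ∩ E) := by
          refine measure_mono (Set.iUnion_subset fun m => ?_)
          rintro σ ⟨h1, h2⟩
          refine ⟨?_, h2⟩
          have h3 := h1.2.1
          rwa [pre_take σ h1.1] at h3
  have hIm : MeasurableSet I := by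
    have : I = ⋂ n, ⋃ m, {σ : Track d | pre σ m ∈ {u | n ≤ m ∧ u ∈ Rec}} := by
      ext σ; simp [hI]
    rw [this]
    exact MeasurableSet.iInter fun n => MeasurableSet.iUnion fun m => measurable_pre_preimage m _
  have hdense := Measure.MeasureDense.of_generateFrom_isSetAlgebra_finite (μ := μ)
    (isSetAlgebra_finiteEvents d) (generateFrom_finiteEvents d)
  have hF : MeasurableSet (I \ E) := hIm.diff hE
  by_contra hne
  have hpos : p * μ (I \ E) ≠ 0 := mul_ne_zero hp hne
  have hfinite : p * μ (I \ E) ≠ ∞ :=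
    ENNReal.mul_ne_top (ne_top_of_le_ne_top ENNReal.one_ne_top hp1) (measure_ne_top _ _)
  have hε : 0 < (p * μ (I \ E)).toReal / 2 := half_pos (ENNReal.toReal_pos hpos hfinite)
  obtain ⟨_, ⟨n, S, rfl⟩, hA⟩ := hdense.approx _ hF (measure_ne_top _ _) _ hε
  set A := {σ : Track d | pre σ n ∈ S} with hAdef
  have hAm : MeasurableSet A := measurable_pre_preimage n S
  have h1 : p * μ (I \ E) ≤ μ (symmDiff (I \ E) A) := by
    calc p * μ (I \ E) = p * (μ ((I \ E) ∩ A) + μ ((I \ E) \ A)) := by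
          rw [measure_inter_add_sdiff _ hAm]
      _ = p * μ ((I \ E) ∩ A) + p * μ ((I \ E) \ A) := mul_add _ _ _
      _ ≤ μ (A \ (I \ E)) + μ ((I \ E) \ A) := by
          refine add_le_add ?_ (mul_le_of_le_one_left zero_le hp1)
          refine le_trans (mul_le_mul_right (measure_mono ?_) _) ((key n S).trans (measure_mono ?_))
          · exact fun σ hσ => ⟨hσ.2, hσ.1.1⟩
          · exact fun σ hσ => ⟨hσ.1, fun h => h.2 hσ.2⟩
      _ = μ (symmDiff (I \ E) A) := by
          rw [measure_symmDiff_eq hF.nullMeasurableSet hAm.nullMeasurableSet, add_comm]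
  have h2 := h1.trans_lt hA
  rw [ENNReal.ofReal_div_of_pos two_pos, ENNReal.ofReal_toReal hfinite, ENNReal.ofReal_ofNat] at h2
  exact absurd h2 (not_lt.2 ENNReal.half_le_self)

/-- A good track never goes below its start and visits each level finitely often, so it cannot stay
below a fixed height for all times. -/
lemma GoodTrack.unbounded {d : ℕ} [NeZero d] {c : ℝ} {σ : Track d} (h : GoodTrack c σ) (B : ℕ) :
    ∃ m, (B : ℤ) < trackPath σ m 0 := by
  by_contra! hB
  have hnonneg : ∀ m, 0 ≤ trackPath σ m 0 := by
    intro m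
    have := (h m).height_nonneg (i := m) (by simp)
    rwa [height_pre σ le_rfl] at this
  have hcount : ∀ N : ℕ, (N : ℝ) ≤ ∑ j ∈ Finset.range (B + 1), c * ((j : ℝ) + 1) ^ 2 := by
    intro N
    have h1 : (Finset.range (N + 1)).card ≤
        ∑ j ∈ Finset.range (B + 1), visits (pre σ N) j := by
      rw [Finset.card_eq_sum_card_fiberwise (f := fun i => (trackPath σ i 0).toNat)
        (t := Finset.range (B + 1))]
      · refine Finset.sum_le_sum fun j _ => ?_
        rw [visits, length_pre]
        refine Finset.card_le_card fun i hi => ?_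
        simp only [Finset.mem_filter, Finset.mem_range] at hi ⊢
        refine ⟨hi.1, ?_⟩
        rw [height_pre σ (by omega)]
        have := hnonneg i
        omega
      · intro i _
        simp only [Finset.coe_range, Set.mem_Iio]
        have := hB i
        have := hnonneg i
        omega
    rw [Finset.card_range] at h1
    calc (N : ℝ) ≤ ((N + 1 : ℕ) : ℝ) := by push_cast; linarith
      _ ≤ ((∑ j ∈ Finset.range (B + 1), visits (pre σ N) j : ℕ) : ℝ) := by exact_mod_cast h1
      _ = ∑ j ∈ Finset.range (B + 1), (visits (pre σ N) j : ℝ) := by push_cast; rfl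
      _ ≤ _ := Finset.sum_le_sum fun j _ => (h N).2 j
  obtain ⟨N, hN⟩ := exists_nat_gt (∑ j ∈ Finset.range (B + 1), c * ((j : ℝ) + 1) ^ 2)
  exact absurd (hcount N) (not_le.2 hN)

lemma GoodTrack.exists_record {d : ℕ} [NeZero d] {c : ℝ} {σ : Track d} (h : GoodTrack c σ) (n : ℕ) :
    ∃ m, n ≤ m ∧ ∀ i < m, trackPath σ i 0 < trackPath σ m 0 := by
  set B : ℕ := (Finset.range (n + 1)).sup fun i => (trackPath σ i 0).toNat with hB
  have hex := h.unbounded B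
  refine ⟨Nat.find hex, ?_, fun i hi => ?_⟩
  · by_contra! hlt
    have h1 := Nat.find_spec hex
    have h2 : (trackPath σ (Nat.find hex) 0).toNat ≤ B :=
      Finset.le_sup (f := fun i => (trackPath σ i 0).toNat) (Finset.mem_range.2 (by omega))
    omega
  · have h1 := Nat.find_spec hex
    have h2 := Nat.find_min hex hi
    omega

lemma measurableSet_exists_regAt {d : ℕ} [NeZero d] (c : ℝ) (L : ℕ) :
    MeasurableSet {σ : Track d | ∃ m, RegAt c L σ m} := by
  have : {σ : Track d | ∃ m, RegAt c L σ m} =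
      ⋃ m, {σ | pre σ m ∈ {u | CandWord L u}} ∩ shiftTrack m ⁻¹' goodSet d c := by
    ext σ; simp [RegAt, goodSet]
  rw [this]
  exact MeasurableSet.iUnion fun m => (measurable_pre_preimage m _).inter
    (measurable_shiftTrack m (measurableSet_goodSet c))

lemma Decouples.good_regenerates {d : ℕ} [NeZero d] {P : Measure (Env d)} [IsProbabilityMeasure P]
    (hP : TranslationInvariant P)
    {c : ℝ} {L : ℕ} {θ : ℕ → ℝ≥0∞} (hD : Decouples P c L θ) (hθ : ∀ t, θ t ≠ ∞)
    {κ : ℝ} (hκ : 0 < κ) (h2 : 2 * (d * κ) < 1) (hpos : goodMass P κ c ≠ 0) :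
    trackLaw P κ (goodSet d c \ {σ | ∃ m, RegAt c L σ m}) = 0 := by
  have hβ : ENNReal.ofReal (κ / 2) ^ L * goodMass P κ c ≠ 0 :=
    mul_ne_zero (pow_ne_zero _ (by simpa using hκ)) hpos
  set θ' := max 1 (θ L) with hθ'
  have hθ'0 : θ' ≠ 0 := (lt_of_lt_of_le one_pos (le_max_left _ _)).ne'
  have hθ't : θ' ≠ ∞ := (max_lt ENNReal.one_lt_top (hθ L).lt_top).ne
  have hβ1 : ENNReal.ofReal (κ / 2) ^ L * goodMass P κ c ≤ 1 := by
    refine mul_le_one' (pow_le_one₀ zero_le ?_) (goodMass_le_one P κ c)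
    rw [ENNReal.ofReal_le_one]
    have : (1 : ℝ) ≤ d := by exact_mod_cast NeZero.one_le
    nlinarith
  have hnull := measure_infinitely_often_diff (trackLaw P κ) (measurableSet_exists_regAt c L)
    (p := (ENNReal.ofReal (κ / 2) ^ L * goodMass P κ c) / θ')
    (ENNReal.div_ne_zero.2 ⟨hβ, hθ't⟩)
    (ENNReal.div_le_of_le_mul (by rw [one_mul]; exact hβ1.trans (le_max_left _ _)))
    {u | ∀ i < u.length, height u i < pos u 0} (fun u hu => by
      rw [mul_comm, ← mul_div_assoc]
      refine ENNReal.div_le_of_le_mul ?_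
      rw [mul_comm _ θ']
      exact (hD.le_regen hP hθ hκ h2 hu).trans (mul_le_mul_left (le_max_right _ _) _))
  refine measure_mono_null ?_ hnull
  rintro σ ⟨h1, h3⟩
  refine ⟨fun n => ?_, h3⟩
  obtain ⟨m, hm, hrec⟩ := GoodTrack.exists_record h1 n
  refine ⟨m, hm, fun i hi => ?_⟩
  rw [length_pre] at hi
  rw [height_pre σ hi.le]
  exact hrec i hi

/-! ## Decomposition at the first regeneration -/

/-- The probability that the segment `w` is followed and then `R = ∞`. -/
def segProb {d : ℕ} [NeZero d] (κ c : ℝ) (w : List (Letter d)) (ω : Env d) : ℝ≥0∞ :=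
  wordWeight κ w ω * goodProb κ c (shiftEnv (pos w) ω)

lemma measurable_segProb {d : ℕ} [NeZero d] (κ c : ℝ) (w : List (Letter d)) :
    Measurable (segProb κ c w) :=
  (measurable_wordWeight κ w).mul ((measurable_goodProb κ c).comp (measurable_shiftEnv _))

lemma segProb_eq {d : ℕ} [NeZero d] (κ c : ℝ) (w : List (Letter d)) (ω : Env d) :
    segProb κ c w ω = trackKernel d κ ω (cyl w ∩ shiftTrack w.length ⁻¹' goodSet d c) :=
  (trackKernel_markov κ ω w (measurableSet_goodSet c)).symm

/-- The event that the first segment is `w`. -/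
def segEvent {d : ℕ} [NeZero d] (c : ℝ) (w : List (Letter d)) : Set (Track d) :=
  cyl w ∩ shiftTrack w.length ⁻¹' goodSet d c

lemma measurableSet_segEvent {d : ℕ} [NeZero d] (c : ℝ) (w : List (Letter d)) :
    MeasurableSet (segEvent c w) :=
  (measurableSet_cyl w).inter (measurable_shiftTrack _ (measurableSet_goodSet c))

lemma mem_segEvent {d : ℕ} [NeZero d] {c : ℝ} (hc : 0 ≤ c) {L : ℕ} (w : Seg d c L) (σ : Track d) :
    σ ∈ segEvent c w.1 ↔ pre σ w.1.length = w.1 ∧ GoodTrack c σ ∧ RegAt c L σ w.1.length ∧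
      ∀ m < w.1.length, ¬ RegAt c L σ m := by
  constructor
  · rintro ⟨h1, h2⟩
    have h1' : pre σ w.1.length = w.1 := h1
    refine ⟨h1, (isSeg_iff hc h2).1 ?_⟩
    rw [h1']
    exact w.2
  · rintro ⟨h1, -, h2, -⟩
    exact ⟨h1, h2.2⟩

lemma disjoint_segEvent {d : ℕ} [NeZero d] {c : ℝ} (hc : 0 ≤ c) (L : ℕ) :
    Pairwise (Function.onFun Disjoint fun w : Seg d c L => segEvent c w.1) := by
  intro w w' hne
  refine Set.disjoint_left.2 fun σ h1 h2 => hne ?_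
  rw [mem_segEvent hc] at h1 h2
  have hlen : w.1.length = w'.1.length := by
    rcases lt_trichotomy w.1.length w'.1.length with h | h | h
    · exact absurd h1.2.2.1 (h2.2.2.2 _ h)
    · exact h
    · exact absurd h2.2.2.1 (h1.2.2.2 _ h)
  exact Subtype.ext (by rw [← h1.1, ← h2.1, hlen])

lemma iUnion_segEvent {d : ℕ} [NeZero d] {c : ℝ} (hc : 0 ≤ c) (L : ℕ) :
    ⋃ w : Seg d c L, segEvent c w.1 = goodSet d c ∩ {σ | ∃ m, RegAt c L σ m} := by
  classical
  ext σ
  rw [Set.mem_iUnion]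
  constructor
  · rintro ⟨w, hw⟩
    rw [mem_segEvent hc] at hw
    exact ⟨hw.2.1, _, hw.2.2.1⟩
  · rintro ⟨h1, h2⟩
    have h2' : ∃ m, RegAt c L σ m := h2
    have h3 := Nat.find_spec h2'
    have h4 : ∀ m < Nat.find h2', ¬ RegAt c L σ m := fun m hm => Nat.find_min h2' hm
    refine ⟨⟨_, (isSeg_iff hc h3.2).2 ⟨h1, h3, h4⟩⟩, ?_⟩
    rw [mem_segEvent hc]
    simp only [length_pre]
    exact ⟨trivial, h1, h3, h4⟩

lemma tsum_segProb_le {d : ℕ} [NeZero d] {κ c : ℝ} (hc : 0 ≤ c) (L : ℕ) (ω : Env d) :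
    ∑' w : Seg d c L, segProb κ c w.1 ω ≤ goodProb κ c ω := by
  simp_rw [segProb_eq]
  refine (measure_iUnion (μ := trackKernel d κ ω) (disjoint_segEvent hc L)
    fun w => measurableSet_segEvent c w.1).symm.le.trans (measure_mono ?_)
  rw [iUnion_segEvent hc]
  exact Set.inter_subset_left

/-- Good tracks regenerate almost surely, so the disjoint events of the first segment exhaust them.
This conservation of mass makes conditional means over the next segment genuine averages. -/
lemma Decouples.tsum_segProb {d : ℕ} [NeZero d] {P : Measure (Env d)} [IsProbabilityMeasure P]
    (hP : TranslationInvariant P)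
    {c : ℝ} (hc : 0 ≤ c) {L : ℕ} {θ : ℕ → ℝ≥0∞} (hD : Decouples P c L θ) (hθ : ∀ t, θ t ≠ ∞)
    {κ : ℝ} (hκ : 0 < κ) (h2 : 2 * (d * κ) < 1) (hpos : goodMass P κ c ≠ 0) :
    ∀ᵐ ω ∂P, ∑' w : Seg d c L, segProb κ c w.1 ω = goodProb κ c ω := by
  have hm : MeasurableSet (goodSet d c \ {σ | ∃ m, RegAt c L σ m}) :=
    (measurableSet_goodSet c).diff (measurableSet_exists_regAt c L)
  have h := hD.good_regenerates hP hθ hκ h2 hpos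
  rw [trackLaw_apply P κ hm, lintegral_eq_zero_iff ((trackKernel d κ).measurable_coe hm)] at h
  filter_upwards [h] with ω hω
  refine le_antisymm (tsum_segProb_le hc L ω) ?_
  simp_rw [segProb_eq]
  refine le_trans ?_ (measure_iUnion (μ := trackKernel d κ ω) (disjoint_segEvent hc L)
    fun w => measurableSet_segEvent c w.1).le
  rw [iUnion_segEvent hc, goodProb, ← measure_inter_add_sdiff _ (measurableSet_exists_regAt c L)]
  have hω' : trackKernel d κ ω (goodSet d c \ {σ | ∃ m, RegAt c L σ m}) = 0 := hω
  rw [hω', add_zero]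

/-! ## Existence of a good constant -/

lemma match_trackPath {d : ℕ} (σ : Track d) :
    Match (fun p : ℕ × Site d => (σ p.1).2) (trackPath σ) σ := fun i =>
  ⟨by rw [trackPath_succ, add_sub_cancel_left], rfl⟩

lemma measurableSet_stopR {d : ℕ} [NeZero d] (c : ℝ) :
    MeasurableSet {X : Path d | stopR c X = ⊤} := by
  have h0 : ∀ n : ℕ, Measurable fun X : Path d => X n 0 := fun n =>
    (measurable_pi_apply 0).comp (measurable_pi_apply n)
  have hv : ∀ n j : ℕ, Measurable fun X : Path d => (levelVisits X n j : ℝ) := by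
    intro n j
    have : (fun X : Path d => (levelVisits X n j : ℝ)) =
        fun X : Path d => ∑ i ∈ Finset.range (n + 1), if X i 0 = X 0 0 + j then (1 : ℝ) else 0 := by
      funext X
      rw [levelVisits, Finset.card_filter]
      push_cast
      rfl
    rw [this]
    refine Finset.measurable_sum _ fun i _ => Measurable.ite ?_ measurable_const measurable_const
    exact measurableSet_eq_fun (h0 i) ((h0 0).add_const _)
  have : {X : Path d | stopR c X = ⊤} =
      (⋂ n : ℕ, ⋂ j : ℕ, {X | (levelVisits X n j : ℝ) ≤ c * (j + 1) ^ 2}) ∩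
        ⋂ n : ℕ, {X | 1 ≤ n → X 0 0 < X n 0} := by
    ext X
    simp only [stopR, backTime, inf_eq_top_iff, iInf₂_eq_top, Set.mem_ofPred_eq, Set.mem_inter_iff,
      Set.mem_iInter, ENat.natCast_ne_top, imp_false, not_exists, not_lt, not_and, not_le]
  rw [this]
  refine (MeasurableSet.iInter fun n => MeasurableSet.iInter fun j =>
    measurableSet_le (hv n j) measurable_const).inter (MeasurableSet.iInter fun n => ?_)
  by_cases hn : 1 ≤ n
  · simpa [hn] using measurableSet_lt (h0 0) (h0 n)
  · simp [hn]

lemma annealedLaw_stopR {d : ℕ} [NeZero d] {P : Measure (Env d)} [IsProbabilityMeasure P] {κ : ℝ}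
    (hκ : 0 < κ) (hell : UniformlyElliptic P κ) (c : ℝ) :
    annealedLaw P {y | stopR c y.2 = ⊤} = goodMass P κ c := by
  refine (annealedLaw_snd hκ hell (measurableSet_stopR c)).trans ?_
  rw [goodMass_eq]
  congr 1
  ext σ
  exact (match_trackPath σ).stopR_eq_top

lemma GoodTrack.one_le {d : ℕ} [NeZero d] {c : ℝ} {σ : Track d} (h : GoodTrack c σ) : 1 ≤ c := by
  have h1 := (h 0).2 0
  have h2 : visits (pre σ 0) 0 = 1 := by simp [visits, height]
  rw [h2] at h1
  simpa using h1

lemma one_le_of_goodMass {d : ℕ} [NeZero d] {P : Measure (Env d)} {κ c : ℝ}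
    (h : goodMass P κ c ≠ 0) : 1 ≤ c := by
  rw [goodMass_eq] at h
  obtain ⟨σ, hσ⟩ := nonempty_of_measure_ne_zero h
  exact GoodTrack.one_le hσ

/-- Start at the last time when the height is at most its overall minimum: from then on the track
stays strictly above. Linear growth bounds the visits to level `j` by an affine function of `j`,
hence by `C (j+1)²`. -/
lemma exists_goodTrack_shift {d : ℕ} [NeZero d] {v : ℝ} (hv : 0 < v) {σ : Track d} {N : ℕ}
    (hN : ∀ n, N ≤ n → v * n ≤ trackPath σ n 0) :
    ∃ (m C : ℕ), GoodTrack (C : ℝ) (shiftTrack m σ) := by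
  set h : ℕ → ℤ := fun n => trackPath σ n 0 with hh
  obtain ⟨N', hN'⟩ := exists_nat_gt (|(h 0 : ℝ)| / v)
  obtain ⟨m, hm⟩ : ∃ m, ∀ i, 1 ≤ i → h m < h (m + i) := by
    set M := max N N' + 1
    have hMbig : ∀ n, M ≤ n → h 0 < h n := by
      intro n hn
      have h1 := hN n (by omega)
      have h2 : |(h 0 : ℝ)| < v * n := by
        rw [div_lt_iff₀ hv] at hN'
        have : (N' : ℝ) ≤ n := by exact_mod_cast (by omega : N' ≤ n)
        nlinarith
      have h3 : (h 0 : ℝ) < h n := lt_of_le_of_lt (le_abs_self _) (h2.trans_le h1)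
      exact_mod_cast h3
    obtain ⟨m, hmM, hmin⟩ := Finset.exists_min_image (Finset.range M) h ⟨0, by simp [M]⟩
    -- From time `M` on the height exceeds `h 0`, so the minimum over times below `M` is global and
    -- its last occurrence is the maximum of `T`.
    set T := (Finset.range M).filter fun n => h n ≤ h m
    have hT : T.Nonempty := ⟨m, by simp [T, Finset.mem_range.1 hmM]⟩
    refine ⟨T.max' hT, fun i hi => ?_⟩
    have h1 := T.max'_mem hT
    set k := T.max' hT
    have h2 : k < M ∧ h k ≤ h m := by simpa [T] using h1
    by_contra! hlt
    rcases lt_or_ge (k + i) M with h3 | h3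
    · have h4 : k + i ∈ T := by
        simp only [T, Finset.mem_filter, Finset.mem_range]
        exact ⟨h3, hlt.trans h2.2⟩
      have := T.le_max' _ h4
      omega
    · have h4 := hMbig _ h3
      have h5 := hmin 0 (by simp [M])
      omega
  have hheight : ∀ n i, i ≤ n → height (pre (shiftTrack m σ) n) i = h (m + i) - h m := by
    intro n i hi
    rw [height_pre _ hi]
    simp [hh, trackPath_add σ m i]
  -- A visit to relative level `j` after `i` steps has `m + i < N` or `v (m + i) ≤ h m + j`; the
  -- constant covers both cases. An integer `C` allows a countable union later.
  obtain ⟨C, hC⟩ := exists_nat_ge ((N : ℝ) + 2 + (|(h m : ℝ)| + 1) / v)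
  refine ⟨m, C, fun n => ⟨fun i h1 h2 => ?_, fun j => ?_⟩⟩
  · rw [length_pre] at h2
    rw [hheight n i h2]
    have := hm i h1
    omega
  · have hbound : visits (pre (shiftTrack m σ) n) j ≤ N + 1 + ⌊(|(h m : ℝ)| + j) / v⌋₊ := by
      rw [visits]
      refine le_trans (Finset.card_le_card (t := Finset.range (N + 1 + ⌊(|(h m : ℝ)| + j) / v⌋₊)) ?_)
        (by rw [Finset.card_range])
      intro i hi
      simp only [length_pre, Finset.mem_filter, Finset.mem_range] at hi ⊢
      rw [hheight n i (by omega)] at hi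
      by_contra! hlt
      have h1 := hN (m + i) (by omega)
      have h2 : (h (m + i) : ℝ) = h m + j := by
        have : h (m + i) = h m + j := by omega
        rw [this]; push_cast; rfl
      have h3 : (h (m + i) : ℝ) = ((trackPath σ (m + i) 0 : ℤ) : ℝ) := rfl
      rw [← h3, h2] at h1
      have h4 : (i : ℝ) ≤ (|(h m : ℝ)| + j) / v := by
        rw [le_div_iff₀ hv]
        push_cast at h1
        have := le_abs_self (h m : ℝ)
        have : 0 ≤ v * m := by positivity
        nlinarith
      have h5 := Nat.le_floor h4
      omega
    have hfl := Nat.floor_le (show 0 ≤ (|(h m : ℝ)| + j) / v by positivity)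
    have h6 : (visits (pre (shiftTrack m σ) n) j : ℝ) ≤ N + 1 + (|(h m : ℝ)| + j) / v := by
      calc (visits (pre (shiftTrack m σ) n) j : ℝ)
          ≤ ((N + 1 + ⌊(|(h m : ℝ)| + j) / v⌋₊ : ℕ) : ℝ) := by exact_mod_cast hbound
        _ ≤ _ := by push_cast; linarith
    refine h6.trans ?_
    have hj : (0 : ℝ) ≤ j := by positivity
    have h7 : (|(h m : ℝ)| + j) / v ≤ (|(h m : ℝ)| + 1) / v * (j + 1) := by
      rw [div_mul_eq_mul_div]
      gcongr
      nlinarith [abs_nonneg (h m : ℝ)]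
    have h8 : (0 : ℝ) ≤ (|(h m : ℝ)| + 1) / v := by positivity
    have hNn : (0 : ℝ) ≤ N := by positivity
    have h9 : (j : ℝ) + 1 ≤ ((j : ℝ) + 1) ^ 2 := by nlinarith
    calc (N : ℝ) + 1 + (|(h m : ℝ)| + j) / v
        ≤ (N + 2 + (|(h m : ℝ)| + 1) / v) * (j + 1) := by nlinarith
      _ ≤ C * (j + 1) := by gcongr
      _ ≤ C * (j + 1) ^ 2 := by gcongr

/-- Positive speed gives positive probability to `X_n · e_1 ≥ v n / 2` for all large `n`. Such
tracks lie in the countable union over `m` and `C` of shifted good events; if all of these were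
null, so would be the union. -/
lemma exists_goodMass_ne_zero {d : ℕ} [NeZero d] {P : Measure (Env d)} [IsProbabilityMeasure P]
    (hP : TranslationInvariant P) {κ : ℝ} (hκ : 0 < κ) (hell : UniformlyElliptic P κ) {v : ℝ}
    (hv : IsSpeed P v) (hvpos : 0 < v) : ∃ c : ℝ, goodMass P κ c ≠ 0 := by
  set B : Set (Path d) := {X | ∃ N : ℕ, ∀ n, N ≤ n → v / 2 * n ≤ X n 0} with hB
  have hBm : MeasurableSet B := by
    have : B = ⋃ N : ℕ, ⋂ n : ℕ, {X : Path d | N ≤ n → v / 2 * n ≤ X n 0} := by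
      ext X; simp [hB]
    rw [this]
    refine MeasurableSet.iUnion fun N => MeasurableSet.iInter fun n => ?_
    by_cases h : N ≤ n
    · simp only [h, forall_const]
      have h0 : Measurable fun X : Path d => X n 0 :=
        (measurable_pi_apply 0).comp (measurable_pi_apply n)
      exact measurableSet_le measurable_const ((measurable_of_countable (Int.cast : ℤ → ℝ)).comp h0)
    · simp [h]
  have h1 : annealedLaw P {y | y.2 ∈ B} ≠ 0 := by
    intro h0
    refine hvpos.ne' (hv.eq_zero (measure_mono_null_ae ?_ h0))
    filter_upwards [hv.tendsto] with y hy hty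
    have h2 := (hy hty).eventually (eventually_ge_nhds (show v / 2 < v by linarith))
    obtain ⟨N, hN⟩ := eventually_atTop.1 h2
    refine ⟨N + 1, fun n hn => ?_⟩
    have h3 := hN n (by omega)
    have hn0 : (0 : ℝ) < n := by exact_mod_cast (by omega : 0 < n)
    rwa [le_div_iff₀ hn0] at h3
  rw [annealedLaw_snd hκ hell hBm] at h1
  by_contra! hall
  refine h1 (measure_mono_null (t := ⋃ m : ℕ, ⋃ C : ℕ, shiftTrack m ⁻¹' goodSet d (C : ℝ)) ?_ ?_)
  · rintro σ ⟨N, hN⟩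
    obtain ⟨m, C, h⟩ := exists_goodTrack_shift (half_pos hvpos) hN
    exact Set.mem_iUnion₂.2 ⟨m, C, h⟩
  · refine measure_iUnion_null fun m => measure_iUnion_null fun C => ?_
    refine hP.trackLaw_shift_null κ (measurableSet_goodSet _) ?_ m
    rw [← goodMass_eq]
    exact hall C

/-! ## The conditioned law -/

lemma coinAnnealedLaw_match {d : ℕ} (P : Measure (Env d)) [IsProbabilityMeasure P] (κ : ℝ) :
    ∀ᵐ y ∂(coinAnnealedLaw P κ), Match y.1.2 y.2 (trackOf (y.1.2, y.2)) := by
  filter_upwards [coinAnnealedLaw_ae P κ] with y hy i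
  refine ⟨?_, rfl⟩
  have h1 := congrFun hy (i + 1)
  have h2 := congrFun hy i
  rw [trackPath_succ, ← h2] at h1
  rw [h1, add_sub_cancel_left]

lemma measurable_trackOf_snd {d : ℕ} :
    Measurable fun y : (Env d × Coins d) × Path d => trackOf (y.1.2, y.2) :=
  measurable_trackOf.comp ((measurable_snd.comp measurable_fst).prodMk measurable_snd)

lemma coinAnnealedLaw_trackOf {d : ℕ} (P : Measure (Env d)) [IsProbabilityMeasure P] (κ : ℝ)
    {F : Set (Track d)} (hF : MeasurableSet F) :
    coinAnnealedLaw P κ {y | trackOf (y.1.2, y.2) ∈ F} = trackLaw P κ F := by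
  rw [← coinAnnealedLaw_map P κ, Measure.map_apply measurable_trackOf_snd hF]
  rfl

lemma hatLaw_apply {d : ℕ} [NeZero d] (P : Measure (Env d)) [IsProbabilityMeasure P] (κ c : ℝ)
    (E : Set ((Env d × Coins d) × Path d)) :
    hatLaw P κ c E =
      (goodMass P κ c)⁻¹ * coinAnnealedLaw P κ ({y | trackOf (y.1.2, y.2) ∈ goodSet d c} ∩ E) := by
  have hm : MeasurableSet {y : (Env d × Coins d) × Path d | stopR c y.2 = ⊤} :=
    measurable_snd (measurableSet_stopR c)
  have hae : ({y : (Env d × Coins d) × Path d | stopR c y.2 = ⊤} : Set _) =ᵐ[coinAnnealedLaw P κ]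
      {y | trackOf (y.1.2, y.2) ∈ goodSet d c} := by
    filter_upwards [coinAnnealedLaw_match P κ] with y hy
    exact propext hy.stopR_eq_top
  rw [hatLaw, cond_apply hm, measure_congr hae, measure_congr (hae.inter (ae_eq_refl E)),
    coinAnnealedLaw_trackOf P κ (measurableSet_goodSet c), goodMass_eq]

/-- Only the track event `F` has to be measurable; the event `E`, defined through `τ_n`, is treated
as an outer-measure set. -/
lemma hatLaw_le {d : ℕ} [NeZero d] (P : Measure (Env d)) [IsProbabilityMeasure P] (κ c : ℝ)
    {E : Set ((Env d × Coins d) × Path d)} {F : Set (Track d)} (hF : MeasurableSet F)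
    (h : ∀ ε X σ, Match ε X σ → X 0 = 0 → GoodTrack c σ → (∃ ω, ((ω, ε), X) ∈ E) → σ ∈ F) :
    hatLaw P κ c E ≤ (goodMass P κ c)⁻¹ * trackLaw P κ F := by
  rw [hatLaw_apply, ← coinAnnealedLaw_trackOf P κ hF]
  refine mul_le_mul_right (measure_mono_ae ?_) _
  filter_upwards [coinAnnealedLaw_match P κ, coinAnnealedLaw_ae P κ] with y hy hy0 hyE
  exact h _ _ _ hy (by rw [hy0, trackPath_zero]) hyE.1 ⟨y.1.1, hyE.2⟩

/-- The track is good after each finite `τ_n`. Discarding the null event that some shift is good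
without regenerating yields `τ_{n+1} < ∞` simultaneously for all `n`. -/
lemma Decouples.regTime_lt_top {d : ℕ} [NeZero d] {P : Measure (Env d)} [IsProbabilityMeasure P]
    (hP : TranslationInvariant P)
    {c : ℝ} {L : ℕ} {θ : ℕ → ℝ≥0∞} (hD : Decouples P c L θ) (hθ : ∀ t, θ t ≠ ∞)
    {κ : ℝ} (hκ : 0 < κ) (h2 : 2 * (d * κ) < 1) (hpos : goodMass P κ c ≠ 0) (n : ℕ) :
    ∀ᵐ y ∂(hatLaw P κ c), regTime c L n y < ⊤ := by
  have hc := one_le_of_goodMass hpos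
  set F : Set (Track d) := goodSet d c \ {σ | ∃ m, RegAt c L σ m} with hFdef
  have hF : MeasurableSet F := (measurableSet_goodSet c).diff (measurableSet_exists_regAt c L)
  have h0 := hD.good_regenerates hP hθ hκ h2 hpos
  have hF' : MeasurableSet (⋃ m, shiftTrack m ⁻¹' F) :=
    MeasurableSet.iUnion fun m => measurable_shiftTrack m hF
  have hnull : trackLaw P κ (⋃ m, shiftTrack m ⁻¹' F) = 0 :=
    measure_iUnion_null fun m => hP.trackLaw_shift_null κ hF h0 m
  rw [ae_iff, ← nonpos_iff_eq_zero]
  refine (hatLaw_le P κ c hF' fun ε X σ hm _ hg hE => ?_).trans (by rw [hnull, mul_zero])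
  obtain ⟨ω, hE⟩ := hE
  by_contra hσ
  refine hE ?_
  have hreg : ∀ N, GoodTrack c (shiftTrack N σ) → ∃ m, RegAt c L (shiftTrack N σ) m := by
    intro N hN
    by_contra hno
    exact hσ (Set.mem_iUnion.2 ⟨N, hN, hno⟩)
  change tau c L ε X n < ⊤
  clear hE
  induction n with
  | zero => exact ENat.natCast_lt_top 0
  | succ n ih =>
    obtain ⟨N, hN⟩ := ENat.ne_top_iff_exists.1 ih.ne
    obtain ⟨a, -, -, hga⟩ := hm.tau_spec hc hg n N hN.symm
    obtain ⟨m, hm'⟩ := hreg N hga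
    exact hm.tau_succ hc n N m hN.symm hm'

/-- The probability that the first segment is `w`. -/
def segMass {d : ℕ} [NeZero d] (P : Measure (Env d)) (κ c : ℝ) (w : List (Letter d)) : ℝ≥0∞ :=
  (goodMass P κ c)⁻¹ * ∫⁻ ω, segProb κ c w ω ∂P

lemma tsum_segMass_mul_length_le {d : ℕ} [NeZero d] {P : Measure (Env d)} [IsProbabilityMeasure P]
    {κ c : ℝ} (hpos : goodMass P κ c ≠ 0) (L : ℕ) :
    ∑' w : Seg d c L, segMass P κ c w.1 * w.1.length ≤ meanTau P κ c L := by
  have hc := one_le_of_goodMass hpos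
  have hc0 : 0 ≤ c := by linarith
  set E : Seg d c L → Set ((Env d × Coins d) × Path d) :=
    fun w => {y | trackOf (y.1.2, y.2) ∈ segEvent c w.1} with hE
  have hEm : ∀ w, MeasurableSet (E w) := fun w =>
    measurable_trackOf_snd (measurableSet_segEvent c w.1)
  have hmass : ∀ w, hatLaw P κ c (E w) = segMass P κ c w.1 := by
    intro w
    have hsub : E w ⊆ {y | trackOf (y.1.2, y.2) ∈ goodSet d c} := fun y hy =>
      ((mem_segEvent hc0 w _).1 hy).2.1
    rw [hatLaw_apply, Set.inter_eq_self_of_subset_right hsub,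
      coinAnnealedLaw_trackOf P κ (measurableSet_segEvent c w.1), segMass, segEvent,
      trackLaw_markov κ w.1 (measurableSet_goodSet c)]
    rfl
  have hae : ∀ᵐ y ∂(hatLaw P κ c), ∑' w : Seg d c L, (E w).indicator (fun _ => (w.1.length : ℝ≥0∞)) y ≤
      (regTime c L 1 y : ℝ≥0∞) := by
    have h1 : ∀ᵐ y ∂(hatLaw P κ c), Match y.1.2 y.2 (trackOf (y.1.2, y.2)) :=
      (cond_absolutelyContinuous (μ := coinAnnealedLaw P κ)).ae_le (coinAnnealedLaw_match P κ)
    filter_upwards [h1] with y hy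
    by_cases hex : ∃ w, y ∈ E w
    · obtain ⟨w, hw⟩ := hex
      have h2 := (mem_segEvent hc0 w _).1 hw
      have h3 : regTime c L 1 y = (w.1.length : ℕ∞) := by
        have h4 := (hy.tauOne_first hc).2 h2.2.2
        have h5 : regTime c L 1 y = 0 + tauOne c L (shiftCoins 0 y.1.2) (shiftPath 0 y.2) := rfl
        have h6 : shiftCoins 0 y.1.2 = y.1.2 := by funext u; simp [shiftCoins]
        have h7 : shiftPath 0 y.2 = y.2 := by funext u; simp [shiftPath]
        rw [h5, h6, h7, zero_add]
        exact h4
      rw [h3, tsum_eq_single w]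
      · simp [hw]
      · intro w' hw'
        rw [Set.indicator_of_notMem]
        intro hmem
        exact Set.disjoint_left.1 (disjoint_segEvent hc0 L hw') hmem hw
    · push Not at hex
      simp [hex]
  rw [meanTau]
  refine le_trans (le_of_eq ?_) (lintegral_mono_ae hae)
  rw [lintegral_tsum fun w => (measurable_const.indicator (hEm w)).aemeasurable]
  refine tsum_congr fun w => ?_
  rw [lintegral_indicator_const (hEm w), hmass, mul_comm]

/-! ## Convolution operators on the lattice -/

/-- The operator `g ↦ ∑ i, p i * g (· + z i)`. -/
def convOp {d : ℕ} {ι : Type*} (p : ι → ℝ≥0∞) (z : ι → Site d) :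
    Module.End ℝ≥0∞ (Site d → ℝ≥0∞) where
  toFun g s := ∑' i, p i * g (s + z i)
  map_add' g h := by
    funext s
    simp only [Pi.add_apply, mul_add, ENNReal.tsum_add]
  map_smul' a g := by
    funext s
    simp only [Pi.smul_apply, smul_eq_mul, RingHom.id_apply, ← ENNReal.tsum_mul_left]
    exact tsum_congr fun i => by ring

lemma convOp_apply {d : ℕ} {ι : Type*} (p : ι → ℝ≥0∞) (z : ι → Site d) (g : Site d → ℝ≥0∞)
    (s : Site d) : convOp p z g s = ∑' i, p i * g (s + z i) := rfl

lemma convOp_commute {d : ℕ} {ι ι' : Type*} (p : ι → ℝ≥0∞) (z : ι → Site d) (q : ι' → ℝ≥0∞)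
    (y : ι' → Site d) : Commute (convOp p z) (convOp q y) := by
  refine LinearMap.ext fun g => funext fun s => ?_
  simp only [Module.End.mul_apply, convOp_apply, ← ENNReal.tsum_mul_left]
  rw [ENNReal.tsum_comm]
  refine tsum_congr fun i => tsum_congr fun j => ?_
  rw [mul_left_comm, add_right_comm]

lemma tsum_convOp {d : ℕ} {ι : Type*} (p : ι → ℝ≥0∞) (z : ι → Site d) (g : Site d → ℝ≥0∞) :
    ∑' s, convOp p z g s = (∑' i, p i) * ∑' s, g s := by
  simp only [convOp_apply]
  rw [ENNReal.tsum_comm, ← ENNReal.tsum_mul_right]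
  refine tsum_congr fun i => ?_
  rw [ENNReal.tsum_mul_left]
  exact congrArg _ ((Equiv.addRight (z i)).tsum_eq g)

lemma tsum_convOp_pow {d : ℕ} {ι : Type*} {p : ι → ℝ≥0∞} (hp : ∑' i, p i = 1) (z : ι → Site d)
    (m : ℕ) (g : Site d → ℝ≥0∞) : ∑' s, (convOp p z ^ m) g s = ∑' s, g s := by
  induction m with
  | zero => simp
  | succ m ih => rw [pow_succ', Module.End.mul_apply, tsum_convOp, hp, one_mul, ih]

/-! ## The lazy walk -/

/-- The binomial weights. -/
def binomWeight : ℕ → ℤ → ℝ≥0∞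
  | 0, t => if t = 0 then 1 else 0
  | j + 1, t => 2⁻¹ * binomWeight j t + 2⁻¹ * binomWeight j (t - 1)

lemma binomWeight_eq (j : ℕ) (t : ℤ) :
    binomWeight j t = ENNReal.ofReal ((if 0 ≤ t then (j.choose t.toNat : ℝ) else 0) / 2 ^ j) := by
  induction j generalizing t with
  | zero =>
    rw [binomWeight]
    rcases lt_trichotomy t 0 with h | h | h
    · simp [h.ne, not_le.2 h]
    · simp [h]
    · obtain ⟨k, rfl⟩ := Int.eq_succ_of_zero_lt h
      have h1 : ((k : ℤ) + 1) ≠ 0 := by omega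
      have h2 : (0 : ℤ) ≤ (k : ℤ) + 1 := by omega
      have h3 : ((k : ℤ) + 1).toNat = k + 1 := by omega
      simp [h1, h2, h3]
  | succ j ih =>
    have h2 : (2⁻¹ : ℝ≥0∞) = ENNReal.ofReal (1 / 2) := by
      rw [ENNReal.ofReal_div_of_pos two_pos]; simp
    have hnn : ∀ t : ℤ, 0 ≤ (if 0 ≤ t then (j.choose t.toNat : ℝ) else 0) / 2 ^ j := by
      intro t; split_ifs <;> positivity
    rw [binomWeight, ih, ih, h2, ← ENNReal.ofReal_mul (by norm_num),
      ← ENNReal.ofReal_mul (by norm_num), ← ENNReal.ofReal_add (by have := hnn t; positivity)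
        (by have := hnn (t - 1); positivity)]
    congr 1
    rcases lt_trichotomy t 0 with h | h | h
    · rw [if_neg (by omega), if_neg (by omega), if_neg (by omega)]; simp
    · subst h
      rw [if_pos le_rfl, if_neg (by omega), if_pos le_rfl]
      simp [pow_succ]
    · obtain ⟨k, rfl⟩ := Int.eq_succ_of_zero_lt h
      rw [if_pos (by omega), if_pos (by omega), if_pos (by omega)]
      have h3 : ((k : ℤ) + 1).toNat = k + 1 := by omega
      have h4 : ((k : ℤ) + 1 - 1).toNat = k := by omega
      simp only [h3, h4, Nat.choose_succ_succ]
      push_cast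
      rw [pow_succ]
      field_simp
      ring

/-- The factor `2n + 1` is chosen so that the induction closes through `(2n+1)(2n+3) ≤ 4(n+1)²`. -/
lemma centralBinom_sq_le (n : ℕ) : n.centralBinom ^ 2 * (2 * n + 1) ≤ 16 ^ n := by
  induction n with
  | zero => simp
  | succ n ih =>
    have h := Nat.succ_mul_centralBinom_succ n
    have h1 : (n + 1) ^ 2 * ((n + 1).centralBinom ^ 2 * (2 * (n + 1) + 1)) ≤
        (n + 1) ^ 2 * 16 ^ (n + 1) := by
      calc (n + 1) ^ 2 * ((n + 1).centralBinom ^ 2 * (2 * (n + 1) + 1))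
          = ((n + 1) * (n + 1).centralBinom) ^ 2 * (2 * n + 3) := by ring
        _ = (n.centralBinom ^ 2 * (2 * n + 1)) * (4 * ((2 * n + 1) * (2 * n + 3))) := by
            rw [h]; ring
        _ ≤ 16 ^ n * (4 * (4 * (n + 1) ^ 2)) := by
            refine Nat.mul_le_mul ih (Nat.mul_le_mul_left _ ?_)
            ring_nf
            omega
        _ = (n + 1) ^ 2 * 16 ^ (n + 1) := by ring
    exact Nat.le_of_mul_le_mul_left h1 (by positivity)

lemma choose_sq_mul_le (j k : ℕ) : j.choose k ^ 2 * j ≤ 4 ^ j := by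
  obtain ⟨n, rfl | rfl⟩ := Nat.even_or_odd' j
  · have h1 := Nat.choose_le_centralBinom k n
    calc (2 * n).choose k ^ 2 * (2 * n) ≤ n.centralBinom ^ 2 * (2 * n + 1) := by gcongr; omega
      _ ≤ 16 ^ n := centralBinom_sq_le n
      _ = 4 ^ (2 * n) := by rw [pow_mul]; norm_num
  · have h1 : (2 * n + 1).choose k ≤ 2 * n.centralBinom := by
      cases k with
      | zero => simpa using Nat.one_le_iff_ne_zero.2 (by have := n.centralBinom_pos; omega)
      | succ k =>
        rw [Nat.choose_succ_succ']
        have := Nat.choose_le_centralBinom k n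
        have := Nat.choose_le_centralBinom (k + 1) n
        omega
    calc (2 * n + 1).choose k ^ 2 * (2 * n + 1) ≤ (2 * n.centralBinom) ^ 2 * (2 * n + 1) := by gcongr
      _ = 4 * (n.centralBinom ^ 2 * (2 * n + 1)) := by ring
      _ ≤ 4 * 16 ^ n := by gcongr; exact centralBinom_sq_le n
      _ = 4 ^ (2 * n + 1) := by rw [pow_succ, pow_mul]; norm_num; ring

lemma binomWeight_le {j : ℕ} (hj : 1 ≤ j) (t : ℤ) :
    binomWeight j t ≤ ENNReal.ofReal ((j : ℝ) ^ (-(1 / 2) : ℝ)) := by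
  rw [binomWeight_eq]
  refine ENNReal.ofReal_le_ofReal ?_
  have hj0 : (0 : ℝ) < j := by exact_mod_cast hj
  rw [Real.rpow_neg hj0.le, ← Real.sqrt_eq_rpow]
  split_ifs with h
  · have h1 : ((j.choose t.toNat : ℝ)) ^ 2 * j ≤ (2 ^ j) ^ 2 := by
      have h2 := choose_sq_mul_le j t.toNat
      have h3 : ((2 : ℝ) ^ j) ^ 2 = 4 ^ j := by rw [← pow_mul, mul_comm, pow_mul]; norm_num
      rw [h3]
      exact_mod_cast h2
    rw [div_le_iff₀ (by positivity), inv_mul_eq_div, le_div_iff₀ (Real.sqrt_pos.2 hj0)]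
    refine abs_le_of_sq_le_sq' ?_ (by positivity) |>.2
    rw [mul_pow, Real.sq_sqrt hj0.le]
    exact h1
  · simp

lemma binomWeight_le_one (j : ℕ) (t : ℤ) : binomWeight j t ≤ 1 := by
  induction j generalizing t with
  | zero => rw [binomWeight]; split_ifs <;> simp
  | succ j ih =>
    rw [binomWeight]
    calc 2⁻¹ * binomWeight j t + 2⁻¹ * binomWeight j (t - 1) ≤ 2⁻¹ * 1 + 2⁻¹ * 1 := by
          gcongr <;> exact ih _
      _ = 1 := by rw [mul_one, ENNReal.inv_two_add_inv_two]

/-- The site with coordinates `0` or `1`. -/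
def boolSite {d : ℕ} (I : Fin d → Bool) : Site d := fun i => if I i then 1 else 0

/-- The operator of a walk whose coordinates, after a translation by `b`, make independent steps
that are `0` or `1` with probability `1 / 2`. -/
def lazyOp {d : ℕ} (b : Site d) : Module.End ℝ≥0∞ (Site d → ℝ≥0∞) :=
  convOp (fun _ : Fin d → Bool => (2⁻¹ : ℝ≥0∞) ^ d) (fun I => b + boolSite I)

lemma binomWeight_prod_succ {d : ℕ} (j : ℕ) (x : Site d) :
    ∏ i, binomWeight (j + 1) (x i) =
      ∑ I : Fin d → Bool, (2⁻¹ : ℝ≥0∞) ^ d * ∏ i, binomWeight j ((x - boolSite I) i) := by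
  classical
  have h1 : ∀ i, binomWeight (j + 1) (x i) =
      ∑ b : Bool, 2⁻¹ * binomWeight j (x i - if b then 1 else 0) := by
    intro i
    rw [binomWeight, Fintype.sum_bool, add_comm]
    simp
  simp_rw [h1]
  rw [Finset.prod_univ_sum, Fintype.piFinset_univ]
  refine Finset.sum_congr rfl fun I _ => ?_
  rw [Finset.prod_mul_distrib, Finset.prod_const, Finset.card_univ, Fintype.card_fin]
  rfl

lemma lazyOp_pow_apply {d : ℕ} (b : Site d) (j : ℕ) (g : Site d → ℝ≥0∞) (s : Site d) :
    (lazyOp b ^ j) g s = ∑' x : Site d, (∏ i, binomWeight j (x i)) * g (s + j • b + x) := by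
  induction j generalizing s with
  | zero =>
    rw [tsum_eq_single 0]
    · simp [binomWeight]
    · intro x hx
      obtain ⟨i, hi⟩ := Function.ne_iff.1 hx
      rw [Finset.prod_eq_zero (Finset.mem_univ i), zero_mul]
      simpa [binomWeight] using hi
  | succ j ih =>
    rw [pow_succ', Module.End.mul_apply, lazyOp, convOp_apply, tsum_fintype]
    simp_rw [← lazyOp.eq_1, ih, binomWeight_prod_succ, Finset.sum_mul, ← ENNReal.tsum_mul_left]
    rw [Summable.tsum_finsetSum fun _ _ => ENNReal.summable]
    refine Finset.sum_congr rfl fun I _ => ?_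
    rw [← (Equiv.subRight (boolSite I)).tsum_eq]
    refine tsum_congr fun x => ?_
    rw [mul_assoc, Equiv.subRight_apply]
    congr 3
    rw [add_smul, one_smul]
    abel

lemma lazyOp_pow_le {d : ℕ} (b : Site d) (j : ℕ) {a : ℝ≥0∞} (ha : ∀ t, binomWeight j t ≤ a)
    (g : Site d → ℝ≥0∞) (s : Site d) : (lazyOp b ^ j) g s ≤ a ^ d * ∑' x, g x := by
  rw [lazyOp_pow_apply, ← (Equiv.addLeft (s + j • b)).tsum_eq g, ← ENNReal.tsum_mul_left]
  refine ENNReal.tsum_le_tsum fun x => ?_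
  rw [Equiv.coe_addLeft]
  gcongr
  calc ∏ i, binomWeight j (x i) ≤ ∏ _i : Fin d, a := Finset.prod_le_prod' fun i _ => ha _
    _ = a ^ d := by simp

/-! ## The local bound -/

lemma exp_neg_le_rpow (d : ℕ) {q : ℝ} (hq : 0 < q) :
    ∃ C : ℝ, 0 < C ∧ ∀ n : ℕ, 1 ≤ n → Real.exp (-q * n) ≤ C * (n : ℝ) ^ (-(d : ℝ) / 2) := by
  refine ⟨d.factorial / q ^ d, by positivity, fun n hn => ?_⟩
  have hn1 : (1 : ℝ) ≤ n := by exact_mod_cast hn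
  have hn0 : (0 : ℝ) < n := by linarith
  have h1 := Real.pow_div_factorial_le_exp (q * n) (by positivity) d
  have h2 : (n : ℝ) ^ (-(d : ℝ)) ≤ (n : ℝ) ^ (-(d : ℝ) / 2) := by
    refine Real.rpow_le_rpow_of_exponent_le hn1 ?_
    have : (0 : ℝ) ≤ d := by positivity
    linarith
  refine le_trans ?_ (mul_le_mul_of_nonneg_left h2 (by positivity))
  rw [Real.rpow_neg hn0.le, Real.rpow_natCast, neg_mul, Real.exp_neg]
  rw [← one_div, ← div_eq_mul_inv, div_div, div_le_div_iff₀ (Real.exp_pos _) (by positivity), one_mul]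
  rw [div_le_iff₀ (by positivity), mul_pow] at h1
  linarith

/-- A Chernoff bound on operators. Each step of `T = convOp p z` is a lazy step with probability `l`
and some other step otherwise; with a binomial number of lazy steps, `2^{-j}` is multiplied in mean
by `l/2 + 1 - l` per step. Since the operators commute, all lazy steps can be collected at the end.
-/
lemma convOp_pow_lazyOp_pow_le {d : ℕ} {ι : Type*} {p : ι → ℝ≥0∞} (hp : ∑' i, p i = 1)
    (z : ι → Site d) (b : Site d) {l : ℝ≥0∞} (hl : l ≤ 1)
    (hle : ∀ g s, l * lazyOp b g s ≤ convOp p z g s) {A B : ℝ≥0∞}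
    (hAB : ∀ j g s, (lazyOp b ^ j) g s ≤ (A + B * 2⁻¹ ^ j) * ∑' x, g x) (m j : ℕ)
    (g : Site d → ℝ≥0∞) (hg : ∑' x, g x ≠ ∞) (s : Site d) :
    (convOp p z ^ m * lazyOp b ^ j) g s ≤
      (A + B * 2⁻¹ ^ j * (l * 2⁻¹ + (1 - l)) ^ m) * ∑' x, g x := by
  induction m generalizing j g s with
  | zero => simpa using hAB j g s
  | succ m ih =>
    set T := convOp p z with hT
    set S := lazyOp b with hS
    set N := ∑' x, g x with hN
    -- The remainder after splitting off the lazy part, of total mass `(1 - l) N`. Finiteness of the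
    -- sum of `g` is needed to cancel here.
    set Q : Site d → ℝ≥0∞ := fun s => T g s - l * S g s with hQ
    have hcomm : Commute T (S ^ j) := (convOp_commute _ _ _ _).pow_right j
    have hTg : T g = l • S g + Q := by
      funext s
      exact (add_tsub_cancel_of_le (hle g s)).symm
    have hlt : l ≠ ∞ := ne_top_of_le_ne_top ENNReal.one_ne_top hl
    have hQsum : ∑' x, Q x = (1 - l) * N := by
      have h1 : ∑' x, T g x = N := by rw [hT, tsum_convOp, hp, one_mul]
      have h2 : ∑' x, S g x = N := by
        rw [hS, lazyOp, tsum_convOp, tsum_fintype, Finset.sum_const, Finset.card_univ,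
          Fintype.card_fun, Fintype.card_bool, Fintype.card_fin, nsmul_eq_mul]
        push_cast
        rw [← mul_pow, ENNReal.mul_inv_cancel two_ne_zero ENNReal.ofNat_ne_top, one_pow, one_mul]
      have h3 : N = l * N + ∑' x, Q x := by
        conv_lhs => rw [← h1, hTg]
        simp only [Pi.add_apply, Pi.smul_apply, smul_eq_mul]
        rw [ENNReal.tsum_add, ENNReal.tsum_mul_left, h2]
      have h4 : l * N + (1 - l) * N = N := by
        rw [← add_mul, add_tsub_cancel_of_le hl, one_mul]
      have hfin : l * N ≠ ∞ := ENNReal.mul_ne_top hlt hg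
      exact (ENNReal.add_right_inj hfin).1 (h3.symm.trans h4.symm)
    have hQfin : ∑' x, Q x ≠ ∞ := by
      rw [hQsum]
      exact ENNReal.mul_ne_top (ne_top_of_le_ne_top ENNReal.one_ne_top tsub_le_self) hg
    have h5 : (T ^ (m + 1) * S ^ j) g = l • (T ^ m * S ^ (j + 1)) g + (T ^ m * S ^ j) Q := by
      rw [pow_succ, mul_assoc, hcomm.eq, ← mul_assoc, Module.End.mul_apply, hTg, map_add, map_smul,
        ← Module.End.mul_apply, mul_assoc, ← pow_succ]
    rw [h5, Pi.add_apply, Pi.smul_apply, smul_eq_mul]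
    set R := (l * 2⁻¹ + (1 - l)) with hR
    calc l * (T ^ m * S ^ (j + 1)) g s + (T ^ m * S ^ j) Q s
        ≤ l * ((A + B * 2⁻¹ ^ (j + 1) * R ^ m) * N) + (A + B * 2⁻¹ ^ j * R ^ m) * ((1 - l) * N) := by
          gcongr
          · exact ih (j + 1) g hg s
          · rw [← hQsum]; exact ih j Q hQfin s
      _ = ((l + (1 - l)) * A + B * 2⁻¹ ^ j * (R ^ m * (l * 2⁻¹ + (1 - l)))) * N := by ring
      _ = (A + B * 2⁻¹ ^ j * R ^ (m + 1)) * N := by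
          rw [add_tsub_cancel_of_le hl, one_mul, ← hR, ← pow_succ]

/-- Among `n` steps at least `δ n` are lazy up to exponentially small probability, and `j ≥ 1` lazy
steps spread the mass to height at most `j^{-d/2}`. -/
lemma convOp_pow_le {d : ℕ} {ι : Type*} {p : ι → ℝ≥0∞} (hp : ∑' i, p i = 1)
    (z : ι → Site d) (b : Site d) {l : ℝ} (hl0 : 0 < l) (hl : l ≤ 1)
    (hle : ∀ g s, ENNReal.ofReal l * lazyOp b g s ≤ convOp p z g s) :
    ∃ C : ℝ, 0 < C ∧ ∀ n : ℕ, 1 ≤ n → ∀ (g : Site d → ℝ≥0∞) (s : Site d), ∑' x, g x ≠ ∞ →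
      (convOp p z ^ n) g s ≤ ENNReal.ofReal (C * (n : ℝ) ^ (-(d : ℝ) / 2)) * ∑' x, g x := by
  set ρ : ℝ := 1 - l / 2 with hρ
  have hρ0 : 0 < ρ := by rw [hρ]; linarith
  have hρ1 : ρ < 1 := by rw [hρ]; linarith
  have hlog : Real.log ρ < 0 := Real.log_neg hρ0 hρ1
  have hlog2 : 0 < Real.log 2 := Real.log_pos one_lt_two
  -- Chosen so that `2^{δ n} = ρ^{-n/2}`; hence `2^{j₀} ρ^n` is still of order `ρ^{n/2}`.
  set δ : ℝ := -Real.log ρ / (2 * Real.log 2) with hδ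
  have hδ0 : 0 < δ := div_pos (by linarith) (by positivity)
  obtain ⟨C, hC, hexp⟩ := exp_neg_le_rpow d (q := -Real.log ρ / 2) (by linarith)
  refine ⟨δ ^ (-(d : ℝ) / 2) + 2 * C, by positivity, fun n hn g s hg => ?_⟩
  have hn1 : (1 : ℝ) ≤ n := by exact_mod_cast hn
  have hn0 : (0 : ℝ) < n := by linarith
  set j₀ := ⌈δ * n⌉₊ with hj₀
  have hj1 : δ * n ≤ j₀ := Nat.le_ceil _
  have hj2 : (j₀ : ℝ) < δ * n + 1 := Nat.ceil_lt_add_one (by positivity)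
  have hjpos : 0 < j₀ := Nat.ceil_pos.2 (by positivity)
  -- For `j < j₀` only the trivial bound `1 ≤ 2^{j₀ - j}` is used; for `j ≥ j₀`, the binomial bound.
  have hAB : ∀ j g s, (lazyOp b ^ j) g s ≤
      (ENNReal.ofReal ((j₀ : ℝ) ^ (-(d : ℝ) / 2)) + 2 ^ j₀ * 2⁻¹ ^ j) * ∑' x, g x := by
    intro j g s
    rcases lt_or_ge j j₀ with h | h
    · refine (lazyOp_pow_le b j (binomWeight_le_one j) g s).trans ?_
      rw [one_pow]
      refine mul_le_mul_left ?_ _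
      refine le_trans ?_ le_add_self
      have h1 : (2 : ℝ≥0∞) ^ j₀ * 2⁻¹ ^ j = 2 ^ (j₀ - j) := by
        rw [← Nat.sub_add_cancel h.le, pow_add, mul_assoc, ← mul_pow,
          ENNReal.mul_inv_cancel two_ne_zero ENNReal.ofNat_ne_top, one_pow, mul_one]
        simp
      rw [h1]
      exact one_le_pow₀ (by norm_num)
    · have hj : 1 ≤ j := by omega
      refine (lazyOp_pow_le b j (binomWeight_le hj) g s).trans ?_
      refine mul_le_mul_left ?_ _
      refine le_trans ?_ le_self_add
      rw [← ENNReal.ofReal_pow (by positivity)]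
      refine ENNReal.ofReal_le_ofReal ?_
      rw [← Real.rpow_natCast, ← Real.rpow_mul (by positivity)]
      rw [show -(1 / 2 : ℝ) * (d : ℝ) = -(d : ℝ) / 2 by ring]
      refine Real.rpow_le_rpow_of_nonpos (by exact_mod_cast hjpos) (by exact_mod_cast h) ?_
      have : (0 : ℝ) ≤ d := by positivity
      linarith
  have h := convOp_pow_lazyOp_pow_le hp z b (ENNReal.ofReal_le_one.2 hl) hle hAB n 0 g hg s
  rw [pow_zero, mul_one] at h
  refine h.trans (mul_le_mul_left ?_ _)
  have hR : ENNReal.ofReal l * 2⁻¹ + (1 - ENNReal.ofReal l) = ENNReal.ofReal ρ := by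
    have h2 : (2⁻¹ : ℝ≥0∞) = ENNReal.ofReal (1 / 2) := by
      rw [ENNReal.ofReal_div_of_pos two_pos]; simp
    rw [h2, ← ENNReal.ofReal_mul hl0.le, ← ENNReal.ofReal_one, ← ENNReal.ofReal_sub _ hl0.le,
      ← ENNReal.ofReal_add (by positivity) (by linarith)]
    congr 1
    rw [hρ]; ring
  have h2 : (2 : ℝ≥0∞) = ENNReal.ofReal 2 := by simp
  rw [hR, pow_zero, mul_one, h2, ← ENNReal.ofReal_pow (by norm_num), ← ENNReal.ofReal_pow hρ0.le,
    ← ENNReal.ofReal_mul (by positivity), ← ENNReal.ofReal_add (by positivity) (by positivity)]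
  refine ENNReal.ofReal_le_ofReal ?_
  rw [add_mul]
  refine add_le_add ?_ ?_
  · rw [← Real.mul_rpow hδ0.le hn0.le]
    refine Real.rpow_le_rpow_of_nonpos (by positivity) hj1 ?_
    have : (0 : ℝ) ≤ d := by positivity
    linarith
  · rw [mul_assoc]
    refine le_trans ?_ (mul_le_mul_of_nonneg_left (hexp n hn) two_pos.le)
    have h3 : (2 : ℝ) ^ j₀ ≤ 2 * Real.exp (-Real.log ρ / 2 * n) := by
      rw [← Real.rpow_natCast, Real.rpow_def_of_pos two_pos]
      calc Real.exp (Real.log 2 * j₀) ≤ Real.exp (Real.log 2 * (δ * n + 1)) := by gcongr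
        _ = 2 * Real.exp (-Real.log ρ / 2 * n) := by
            rw [mul_add, Real.exp_add, mul_one, Real.exp_log two_pos, mul_comm]
            congr 2
            rw [hδ]; field_simp
    have h4 : ρ ^ n = Real.exp (Real.log ρ * n) := by
      rw [← Real.rpow_natCast, Real.rpow_def_of_pos hρ0]
    calc (2 : ℝ) ^ j₀ * ρ ^ n ≤ 2 * Real.exp (-Real.log ρ / 2 * n) * Real.exp (Real.log ρ * n) := by
          rw [h4]; gcongr
      _ = 2 * Real.exp (-(-Real.log ρ / 2) * n) := by
          rw [mul_assoc, ← Real.exp_add]; congr 2; ring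

/-! ## The step distribution of the regeneration positions -/

lemma goodMass_ne_top {d : ℕ} [NeZero d] (P : Measure (Env d)) [IsProbabilityMeasure P] (κ c : ℝ) :
    goodMass P κ c ≠ ∞ := ne_top_of_le_ne_top ENNReal.one_ne_top (goodMass_le_one P κ c)

lemma Decouples.tsum_segMass {d : ℕ} [NeZero d] {P : Measure (Env d)} [IsProbabilityMeasure P]
    (hP : TranslationInvariant P)
    {c : ℝ} (hc : 0 ≤ c) {L : ℕ} {θ : ℕ → ℝ≥0∞} (hD : Decouples P c L θ) (hθ : ∀ t, θ t ≠ ∞)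
    {κ : ℝ} (hκ : 0 < κ) (h2 : 2 * (d * κ) < 1) (hpos : goodMass P κ c ≠ 0) :
    ∑' w : Seg d c L, segMass P κ c w.1 = 1 := by
  simp_rw [segMass]
  rw [ENNReal.tsum_mul_left, ← lintegral_tsum (f := fun (w : Seg d c L) => segProb κ c w.1)
    fun w => (measurable_segProb κ c w.1).aemeasurable,
    lintegral_congr_ae (hD.tsum_segProb hP hc hθ hκ h2 hpos)]
  exact ENNReal.inv_mul_cancel hpos (goodMass_ne_top P κ c)

/-- Admissible words that end at a strict record. -/
def AdmRec {d : ℕ} [NeZero d] (c : ℝ) (u : List (Letter d)) : Prop :=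
  Adm c u ∧ ∀ i < u.length, height u i < pos u 0

lemma AdmRec.append {d : ℕ} [NeZero d] {c : ℝ} (hc : 0 ≤ c) {u v : List (Letter d)}
    (hu : AdmRec c u) (hv : AdmRec c v) : AdmRec c (u ++ v) := by
  refine ⟨hu.1.append hc hu.2 hv.1, fun i hi => ?_⟩
  rw [pos_append, Pi.add_apply]
  rcases lt_or_ge i u.length with h | h
  · rw [height_append_left _ _ h.le]
    have h1 := hu.2 i h
    have h2 := hv.1.height_nonneg le_rfl
    rw [height_length] at h2
    omega
  · obtain ⟨k, rfl⟩ := Nat.exists_eq_add_of_le h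
    rw [height_append_right]
    have := hv.2 k (by rw [List.length_append] at hi; omega)
    omega

/-! ### Explicit segments realising a lazy step -/

lemma adm_of_length_le_three {d : ℕ} [NeZero d] {c : ℝ} (hc : 1 ≤ c) {u : List (Letter d)}
    (hu : u.length ≤ 3) (h : ∀ i, 1 ≤ i → i ≤ u.length → 0 < height u i) : Adm c u := by
  refine ⟨h, fun j => ?_⟩
  rcases Nat.eq_zero_or_pos j with rfl | hj
  · have h1 : visits u 0 ≤ 1 := by
      rw [visits, Finset.card_le_one]
      have key : ∀ i ∈ (Finset.range (u.length + 1)).filter fun i => height u i = (0 : ℕ), i = 0 := by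
        intro i hi
        simp only [Finset.mem_filter, Finset.mem_range] at hi
        by_contra hne
        have := h i (by omega) (by omega)
        have := hi.2
        push_cast at this
        omega
      intro a ha b hb
      rw [key a ha, key b hb]
    have h2 : (visits u 0 : ℝ) ≤ 1 := by exact_mod_cast h1
    simpa using h2.trans hc
  · have h1 : visits u j ≤ 4 := (Finset.card_filter_le _ _).trans (by rw [Finset.card_range]; omega)
    have h2 : (visits u j : ℝ) ≤ 4 := by exact_mod_cast h1
    have h3 : (1 : ℝ) ≤ j := by exact_mod_cast hj
    have h4 : (4 : ℝ) ≤ ((j : ℝ) + 1) ^ 2 := by nlinarith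
    nlinarith

/-- The letter of a positive unit step with the coin `0`. -/
def plainLetter {d : ℕ} (i : Fin d) : Letter d := (some (i, true), false)

/-- Two steps `e_1`, with or without a step `e_i` in between. -/
def block {d : ℕ} [NeZero d] (i : Fin d) (b : Bool) : List (Letter d) :=
  if b then [plainLetter 0, plainLetter i, plainLetter 0] else [plainLetter 0, plainLetter 0]

/-- A word all coins of which are `0`. -/
def blocks {d : ℕ} [NeZero d] (I : Fin d → Bool) (l : List (Fin d)) : List (Letter d) :=
  l.flatMap fun i => block i (I i)

lemma admRec_block {d : ℕ} [NeZero d] {c : ℝ} (hc : 1 ≤ c) (i : Fin d) (b : Bool) :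
    AdmRec c (block i b) := by
  have h0 : (0 : ℤ) ≤ (Pi.single i 1 : Site d) 0 := by
    rw [Pi.single_apply]; split_ifs <;> simp
  cases b
  · constructor
    · refine adm_of_length_le_three hc (by simp [block]) fun k h1 h2 => ?_
      have h3 : k ≤ 2 := by simpa [block] using h2
      interval_cases k <;> simp [block, height, plainLetter, stepVec]
    · intro k hk
      have h3 : k < 2 := by simpa [block] using hk
      interval_cases k <;> simp [block, height, plainLetter, stepVec]
  · constructor
    · refine adm_of_length_le_three hc (by simp [block]) fun k h1 h2 => ?_
      have h3 : k ≤ 3 := by simpa [block] using h2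
      interval_cases k <;> simp [block, height, plainLetter, stepVec] <;> omega
    · intro k hk
      have h3 : k < 3 := by simpa [block] using hk
      interval_cases k <;> simp [block, height, plainLetter, stepVec] <;> omega

lemma admRec_nil {d : ℕ} [NeZero d] {c : ℝ} (hc : 1 ≤ c) : AdmRec c ([] : List (Letter d)) :=
  ⟨adm_of_length_le_three hc (by simp) fun i h1 h2 => by simp at h2; omega, by simp⟩

lemma admRec_blocks {d : ℕ} [NeZero d] {c : ℝ} (hc : 1 ≤ c) (I : Fin d → Bool)
    (l : List (Fin d)) : AdmRec c (blocks I l) := by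
  induction l with
  | nil => exact admRec_nil hc
  | cons i l ih => exact (admRec_block hc i (I i)).append (by linarith) ih

lemma admRec_replicate {d : ℕ} [NeZero d] {c : ℝ} (hc : 1 ≤ c) (L : ℕ) :
    AdmRec c (List.replicate L (upLetter d)) := by
  induction L with
  | zero => exact admRec_nil hc
  | succ n ih =>
    have h1 : AdmRec c [upLetter d] := by
      constructor
      · refine adm_of_length_le_three hc (by simp) fun k h1 h2 => ?_
        have h3 : k ≤ 1 := by simpa using h2
        interval_cases k
        simp [height, upLetter, stepVec]
      · intro k hk
        have h3 : k < 1 := by simpa using hk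
        interval_cases k
        simp [upLetter, stepVec]
    exact h1.append (by linarith) ih

lemma mem_blocks {d : ℕ} [NeZero d] {I : Fin d → Bool} {l : List (Fin d)} {a : Letter d}
    (h : a ∈ blocks I l) : ∃ i, a = plainLetter i := by
  simp only [blocks, List.mem_flatMap] at h
  obtain ⟨i, -, h⟩ := h
  unfold block at h
  split_ifs at h <;> simp only [List.mem_cons, List.not_mem_nil, or_false] at h <;>
    rcases h with rfl | h <;> first | exact ⟨_, rfl⟩ | skip
  · rcases h with rfl | rfl <;> exact ⟨_, rfl⟩
  · exact ⟨_, h⟩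

lemma length_blocks_le {d : ℕ} [NeZero d] (I : Fin d → Bool) (l : List (Fin d)) :
    (blocks I l).length ≤ 3 * l.length := by
  induction l with
  | nil => simp [blocks]
  | cons i l ih =>
    have h : (block i (I i)).length ≤ 3 := by unfold block; split_ifs <;> simp
    have h1 : blocks I (i :: l) = block i (I i) ++ blocks I l := rfl
    rw [h1, List.length_append, List.length_cons]
    omega

lemma pos_blocks {d : ℕ} [NeZero d] (I : Fin d → Bool) (l : List (Fin d)) :
    pos (blocks I l) = (l.map fun i => Pi.single 0 2 + Pi.single i (if I i then 1 else 0)).sum := by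
  induction l with
  | nil => simp [blocks]
  | cons i l ih =>
    have h1 : blocks I (i :: l) = block i (I i) ++ blocks I l := rfl
    rw [h1, pos_append, ih, List.map_cons, List.sum_cons]
    congr 1
    have h2 : (Pi.single 0 2 : Site d) = Pi.single 0 1 + Pi.single 0 1 := by
      rw [← Pi.single_add]; rfl
    unfold block
    split_ifs
    · simp [plainLetter, stepVec, h2]; abel
    · simp [plainLetter, stepVec, h2]

lemma pos_replicate_upLetter {d : ℕ} [NeZero d] (L : ℕ) :
    pos (List.replicate L (upLetter d)) = Pi.single 0 (L : ℤ) := by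
  induction L with
  | zero => simp
  | succ n ih =>
    rw [List.replicate_succ, pos_cons, ih]
    simp only [upLetter, stepVec]
    rw [← Pi.single_add]
    push_cast
    rw [add_comm]

/-- A segment with displacement prescribed by `I`. -/
def lazyWord {d : ℕ} [NeZero d] (L : ℕ) (I : Fin d → Bool) : List (Letter d) :=
  blocks I (List.finRange d) ++ List.replicate L (upLetter d)

lemma pos_lazyWord {d : ℕ} [NeZero d] (L : ℕ) (I : Fin d → Bool) :
    pos (lazyWord L I) = Pi.single 0 ((d : ℤ) * 2 + L) + boolSite I := by
  rw [lazyWord, pos_append, pos_blocks, pos_replicate_upLetter, ← Fin.sum_univ_def,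
    Finset.sum_add_distrib, Finset.sum_const, Finset.card_univ, Fintype.card_fin,
    Finset.univ_sum_single, Pi.single_add]
  have h : (d • Pi.single 0 2 : Site d) = Pi.single 0 ((d : ℤ) * 2) := by
    rw [← Pi.single_smul]; simp
  rw [h]
  have h3 : (fun i => if I i = true then (1 : ℤ) else 0) = boolSite I := rfl
  rw [h3]
  abel

/-- No proper prefix is a candidate: its run of `L ≥ 1` letters `upLetter` would begin inside the
blocks, where all coins are `0`. So minimality holds without examining the suffixes. -/
lemma isSeg_lazyWord {d : ℕ} [NeZero d] {c : ℝ} (hc : 1 ≤ c) {L : ℕ} (hL : 1 ≤ L)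
    (I : Fin d → Bool) : IsSeg c L (lazyWord L I) := by
  set B := blocks I (List.finRange d) with hB
  have hlen : (lazyWord L I).length = B.length + L := by simp [lazyWord, hB]
  have hsub : (lazyWord L I).length - L = B.length := by omega
  have hBrec := admRec_blocks hc I (List.finRange d)
  refine ⟨⟨by omega, ?_, ?_⟩, (hBrec.append (by linarith) (admRec_replicate hc L)).1, ?_⟩
  · rw [hsub]
    intro i hi
    rw [lazyWord, height_append_left _ _ hi.le, height_append_left _ _ le_rfl, height_length]
    exact hBrec.2 i hi
  · rw [hsub, lazyWord, ← hB, List.drop_left]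
  · intro m hm hcand
    exfalso
    have hmlen : ((lazyWord L I).take m).length = m := by
      rw [List.length_take]; omega
    have h1 := hcand.1
    have h2 := hcand.2.2
    rw [hmlen] at h1 h2
    have h3 : ((lazyWord L I).take m)[m - L]? = some (upLetter d) := by
      have h4 : (((lazyWord L I).take m).drop (m - L))[0]? = some (upLetter d) := by
        rw [h2, List.getElem?_replicate, if_pos (by omega)]
      rw [List.getElem?_drop] at h4
      simpa using h4
    rw [List.getElem?_take_of_lt (by omega), lazyWord,
      List.getElem?_append_left (by rw [← hB]; omega)] at h3
    obtain ⟨i, hi⟩ := mem_blocks (List.mem_of_getElem? h3)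
    have := congrArg Prod.snd hi
    simp [upLetter, plainLetter] at this

lemma le_wordWeight {d : ℕ} [NeZero d] {κ : ℝ} (hκ : 0 < κ) {u : List (Letter d)}
    (hu : ∀ a ∈ u, ∃ e b, a = (some e, b)) {ω : Env d} (hω : Elliptic κ ω) :
    ENNReal.ofReal (κ / 2) ^ u.length ≤ wordWeight κ u ω := by
  induction u generalizing ω with
  | nil => simp
  | cons a u ih =>
    obtain ⟨e, b, rfl⟩ := hu a (by simp)
    rw [List.length_cons, pow_succ', wordWeight]
    exact mul_le_mul' (le_letterWeight hκ _ (hω 0) e b)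
      (ih (fun a ha => hu a (by simp [ha])) (hω.shift _))

lemma le_segMass {d : ℕ} [NeZero d] {P : Measure (Env d)} [IsProbabilityMeasure P]
    (hP : TranslationInvariant P) {κ : ℝ} (hκ : 0 < κ) (hell : UniformlyElliptic P κ) {c : ℝ}
    (hpos : goodMass P κ c ≠ 0) {u : List (Letter d)} (hu : ∀ a ∈ u, ∃ e b, a = (some e, b)) :
    ENNReal.ofReal (κ / 2) ^ u.length ≤ segMass P κ c u := by
  have h1 : ENNReal.ofReal (κ / 2) ^ u.length * goodMass P κ c ≤ ∫⁻ ω, segProb κ c u ω ∂P := by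
    rw [goodMass, ← hP.lintegral_shift (pos u) (measurable_goodProb κ c),
      ← lintegral_const_mul _ (show Measurable fun ω => goodProb κ c (shiftEnv (pos u) ω) from
        (measurable_goodProb κ c).comp (measurable_shiftEnv _))]
    refine lintegral_mono_ae ?_
    filter_upwards [hell] with ω hω
    exact mul_le_mul_left (le_wordWeight hκ hu hω) _
  calc ENNReal.ofReal (κ / 2) ^ u.length
      = (goodMass P κ c)⁻¹ * (ENNReal.ofReal (κ / 2) ^ u.length * goodMass P κ c) := by
        rw [mul_left_comm, ENNReal.inv_mul_cancel hpos (goodMass_ne_top P κ c), mul_one]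
    _ ≤ segMass P κ c u := mul_le_mul_right h1 _

/-- The operator of a step of the walk at regeneration times. -/
def regOp {d : ℕ} [NeZero d] (P : Measure (Env d)) (κ c : ℝ) (L : ℕ) :
    Module.End ℝ≥0∞ (Site d → ℝ≥0∞) :=
  convOp (fun w : Seg d c L => segMass P κ c w.1) (fun w => pos w.1)

/-- The `2^d` words `lazyWord L I` are distinct segments with displacements a fixed vector plus
`{0,1}^d`. Ellipticity gives each of them mass at least `(κ/2)^(3d+L)`, so `convOp_pow_le` applies.
-/
lemma regOp_pow_le {d : ℕ} [NeZero d] {P : Measure (Env d)} [IsProbabilityMeasure P]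
    (hP : TranslationInvariant P) {c : ℝ} {L : ℕ} (hL : 1 ≤ L) {κ : ℝ} (hκ : 0 < κ)
    (hell : UniformlyElliptic P κ) (hpos : goodMass P κ c ≠ 0)
    (hsum : ∑' w : Seg d c L, segMass P κ c w.1 = 1) :
    ∃ C : ℝ, 0 < C ∧ ∀ n : ℕ, 1 ≤ n → ∀ (g : Site d → ℝ≥0∞) (s : Site d), ∑' x, g x ≠ ∞ →
      (regOp P κ c L ^ n) g s ≤ ENNReal.ofReal (C * (n : ℝ) ^ (-(d : ℝ) / 2)) * ∑' x, g x := by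
  have hc := one_le_of_goodMass hpos
  have hκ1 : κ / 2 ≤ 1 := by
    have h2 := hell.two_mul_lt_one
    have : (1 : ℝ) ≤ d := by exact_mod_cast NeZero.one_le
    nlinarith
  have hβ1 : ENNReal.ofReal (κ / 2) ≤ 1 := ENNReal.ofReal_le_one.2 hκ1
  refine convOp_pow_le hsum _ (Pi.single 0 ((d : ℤ) * 2 + L)) (l := (κ / 2) ^ (3 * d + L))
    (by positivity) (pow_le_one₀ (by positivity) hκ1) fun g s => ?_
  have hinj : Function.Injective fun I : Fin d → Bool =>
      (⟨lazyWord L I, isSeg_lazyWord hc hL I⟩ : Seg d c L) := by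
    intro I J h
    have h1 : pos (lazyWord L I) = pos (lazyWord L J) := congrArg (fun w : Seg d c L => pos w.1) h
    rw [pos_lazyWord, pos_lazyWord, add_right_inj] at h1
    funext i
    have h2 := congrFun h1 i
    unfold boolSite at h2
    cases hI : I i <;> cases hJ : J i <;> simp [hI, hJ] at h2 ⊢
  rw [convOp_apply]
  refine le_trans ?_ (ENNReal.tsum_comp_le_tsum_of_injective hinj _)
  rw [lazyOp, convOp_apply, ← ENNReal.tsum_mul_left]
  refine ENNReal.tsum_le_tsum fun I => ?_
  rw [pos_lazyWord, ← mul_assoc]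
  refine mul_le_mul_left ?_ _
  have hlen : (lazyWord L I).length ≤ 3 * d + L := by
    have := length_blocks_le I (List.finRange d)
    rw [List.length_finRange] at this
    rw [lazyWord, List.length_append, List.length_replicate]
    omega
  calc ENNReal.ofReal ((κ / 2) ^ (3 * d + L)) * 2⁻¹ ^ d
      ≤ ENNReal.ofReal (κ / 2) ^ (3 * d + L) * 1 := by
        rw [ENNReal.ofReal_pow (by positivity)]
        gcongr
        exact pow_le_one₀ zero_le (by simp)
    _ ≤ ENNReal.ofReal (κ / 2) ^ (lazyWord L I).length := by
        rw [mul_one]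
        exact pow_le_pow_of_le_one zero_le hβ1 hlen
    _ ≤ segMass P κ c (lazyWord L I) := by
        refine le_segMass hP hκ hell hpos fun a ha => ?_
        rw [lazyWord, List.mem_append] at ha
        rcases ha with ha | ha
        · obtain ⟨i, rfl⟩ := mem_blocks ha
          exact ⟨_, _, rfl⟩
        · rw [List.eq_of_mem_replicate ha]
          exact ⟨_, _, rfl⟩

/-! ## Sums over lists of given length -/

/-- The sum of `f` over all lists of length `k`. -/
def listSum {α : Type*} : ℕ → (List α → ℝ≥0∞) → ℝ≥0∞
  | 0, f => f []
  | k + 1, f => listSum k fun a => ∑' w, f (w :: a)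

lemma listSum_mono {α : Type*} {k : ℕ} {f g : List α → ℝ≥0∞}
    (h : ∀ a, a.length = k → f a ≤ g a) : listSum k f ≤ listSum k g := by
  induction k generalizing f g with
  | zero => exact h [] rfl
  | succ k ih => exact ih fun a ha => ENNReal.tsum_le_tsum fun w => h _ (by simp [ha])

lemma listSum_congr {α : Type*} {k : ℕ} {f g : List α → ℝ≥0∞}
    (h : ∀ a, a.length = k → f a = g a) : listSum k f = listSum k g :=
  le_antisymm (listSum_mono fun a ha => (h a ha).le) (listSum_mono fun a ha => (h a ha).ge)

lemma listSum_add {α : Type*} (k : ℕ) (f g : List α → ℝ≥0∞) :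
    listSum k (fun a => f a + g a) = listSum k f + listSum k g := by
  induction k generalizing f g with
  | zero => rfl
  | succ k ih => simp only [listSum, ENNReal.tsum_add, ih]

lemma listSum_mul_left {α : Type*} (k : ℕ) (b : ℝ≥0∞) (f : List α → ℝ≥0∞) :
    listSum k (fun a => b * f a) = b * listSum k f := by
  induction k generalizing f with
  | zero => rfl
  | succ k ih => simp only [listSum, ENNReal.tsum_mul_left, ih]

lemma listSum_tsum {α ι : Type*} (k : ℕ) (f : ι → List α → ℝ≥0∞) :
    listSum k (fun a => ∑' i, f i a) = ∑' i, listSum k (f i) := by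
  induction k generalizing f with
  | zero => rfl
  | succ k ih =>
    simp only [listSum]
    rw [← ih]
    congr 1
    funext a
    exact ENNReal.tsum_comm

lemma measure_exists_list_le {α Ω : Type*} [Countable α] [MeasurableSpace Ω] (μ : Measure Ω)
    (k : ℕ) (E : List α → Set Ω) :
    μ {σ | ∃ a : List α, a.length = k ∧ σ ∈ E a} ≤ listSum k fun a => μ (E a) := by
  induction k generalizing E with
  | zero =>
    refine measure_mono ?_
    rintro σ ⟨a, ha, h⟩
    rwa [List.length_eq_zero_iff.1 ha] at h
  | succ k ih =>
    refine le_trans (measure_mono ?_) ((ih fun a => ⋃ w, E (w :: a)).trans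
      (listSum_mono fun a _ => measure_iUnion_le _))
    rintro σ ⟨a, ha, h⟩
    match a, ha with
    | w :: a, ha => exact ⟨a, by simpa using ha, Set.mem_iUnion.2 ⟨w, h⟩⟩

/-! ## The past of the walk -/

lemma DependsOn.shiftEnv {d : ℕ} {f : Env d → ℝ≥0∞} {Λ Λ' : Set (Site d)} (hf : DependsOn f Λ) (y : Site d)
    (h : ∀ x ∈ Λ, x + y ∈ Λ') : DependsOn (fun ω => f (shiftEnv y ω)) Λ' := by
  intro ω ω' hω
  exact hf fun x hx => hω (x + y) (h x hx)

lemma condE_const_mul {d : ℕ} {P : Measure (Env d)} [IsFiniteMeasure P] {Λ : Set (Site d)} {f : Env d → ℝ≥0∞} (hf : Measurable f) (b : ℝ≥0∞)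
    (ω : Env d) : condE P Λ (fun ω => b * f ω) ω = b * condE P Λ f ω :=
  lintegral_const_mul b hf

section past

variable {d : ℕ} [NeZero d] {c : ℝ} {L : ℕ}

/-- The sites visited in the segments, except for the last `L` steps of each of them, seen from the
present position. -/
def past : List (Seg d c L) → Set (Site d)
  | [] => ∅
  | w :: a => core L w.1 ∪ {x | x + pos w.1 ∈ past a}

lemma le_pos_seg (w : Seg d c L) : (L : ℤ) ≤ pos w.1 0 := by
  have h1 := w.2.1.pos_eq
  have h2 := w.2.2.1.height_nonneg (Nat.sub_le w.1.length L)
  omega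

lemma past_level {a : List (Seg d c L)} {x : Site d} (hx : x ∈ past a) : x 0 < -(L : ℤ) := by
  induction a generalizing x with
  | nil => exact hx.elim
  | cons w a ih =>
    rcases hx with hx | hx
    · exact w.2.1.core_level hx
    · have h1 := ih hx
      have h2 := le_pos_seg w
      rw [Pi.add_apply] at h1
      omega

lemma past_take_mono (a : List (Seg d c L)) {j k : ℕ} (h : j ≤ k) :
    past (a.take j) ⊆ past (a.take k) := by
  induction a generalizing j k with
  | nil => simp [past]
  | cons w a ih =>
    cases j with
    | zero => simp [past]
    | succ j =>
      obtain ⟨k, rfl⟩ : ∃ k', k = k' + 1 := ⟨k - 1, by omega⟩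
      rintro x (hx | hx)
      · exact Or.inl hx
      · exact Or.inr (ih (by omega) hx)

/-- The last `j` segments raise the walk by at least `j L`, and the next older one adds its final
`L` steps. This turns the age of a segment into the depth that `Decouples` needs. -/
lemma past_old_level (a : List (Seg d c L)) (j : ℕ) {x : Site d} (hx : x ∈ past (a.take (j + 1)))
    (hx' : x ∉ past (a.take j)) : x 0 < -(((j + 1) * L : ℕ) : ℤ) := by
  induction a generalizing j x with
  | nil => simp [past] at hx
  | cons w a ih =>
    cases j with
    | zero => simpa using past_level hx
    | succ j =>
      rw [List.take_succ_cons] at hx hx'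
      have h1 : x + pos w.1 ∈ past (a.take (j + 1)) := by
        rcases hx with hx | hx
        · exact absurd (Or.inl hx) hx'
        · exact hx
      have h2 := ih j h1 fun h => hx' (Or.inr h)
      have h3 := le_pos_seg w
      rw [Pi.add_apply] at h2
      push_cast at h2 ⊢
      nlinarith

lemma relWeight_segWord_cons {κ : ℝ} (w : Seg d c L) (a : List (Seg d c L)) (ω : Env d) :
    relWeight κ (segWord (w :: a)) ω =
      relWeight κ (segWord a) (shiftEnv (-pos w.1) ω) * relWeight κ w.1 ω := by
  have h := relWeight_append_shift κ (segWord a) w.1 (shiftEnv (-pos w.1) ω)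
  rw [shiftEnv_shiftEnv, neg_add_cancel, shiftEnv_zero] at h
  exact h

lemma dependsOn_relWeight_segWord {κ : ℝ} (hκ : 0 < κ) (h2 : 2 * (d * κ) < 1)
    (a : List (Seg d c L)) : DependsOn (relWeight κ (segWord a)) (past a) := by
  induction a with
  | nil => intro ω ω' _; rfl
  | cons w a ih =>
    intro ω ω' hω
    rw [relWeight_segWord_cons, relWeight_segWord_cons]
    congr 1
    · exact DependsOn.shiftEnv ih (-pos w.1) (Λ' := past (w :: a))
        (fun x hx => Or.inr (by simpa using hx)) hω
    · exact w.2.1.dependsOn_relWeight hκ h2 fun x hx => hω x (Or.inl hx)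

end past

/-! ## Functionals of the recent past -/

section functionals

variable {d : ℕ} [NeZero d] {P : Measure (Env d)} {κ c : ℝ} {L : ℕ}

/-- The mean of `G` over the next segment. -/
def future (κ : ℝ) (G : List (Seg d c L) → Site d → Env d → ℝ≥0∞) (a : List (Seg d c L))
    (s : Site d) (ω : Env d) : ℝ≥0∞ :=
  ∑' w : Seg d c L, G (w :: a) (s + pos w.1) (shiftEnv (pos w.1) ω) * segProb κ c w.1 ω

/-- The conditional mean of `G` over the next segment, given the environment at the sites visited in
the last `j` segments. -/
def condOp (P : Measure (Env d)) [IsFiniteMeasure P] (κ : ℝ) (j : ℕ)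
    (G : List (Seg d c L) → Site d → Env d → ℝ≥0∞) (a : List (Seg d c L)) (s : Site d)
    (ω : Env d) : ℝ≥0∞ :=
  condE P (past (a.take j)) (future κ G (a.take j) s) ω /
    condE P (past (a.take j)) (goodProb κ c) ω

/-- The mean of `G` over an independent segment. -/
def meanOp (P : Measure (Env d)) (κ : ℝ) (G : List (Seg d c L) → Site d → Env d → ℝ≥0∞)
    (a : List (Seg d c L)) (s : Site d) (ω : Env d) : ℝ≥0∞ :=
  regOp P κ c L (fun s' => G a s' ω) s

/-- The mean of `G` over the first `k` segments. -/
def energy (P : Measure (Env d)) (κ : ℝ) (k : ℕ)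
    (G : List (Seg d c L) → Site d → Env d → ℝ≥0∞) : ℝ≥0∞ :=
  listSum k fun a => ∫⁻ ω, relWeight κ (segWord a) ω * G a (pos (segWord a)) ω * goodProb κ c ω ∂P

/-- The functionals of the last `ℓ` segments, and of the environment seen in them, with mass `N`. -/
structure RecentPast (P : Measure (Env d)) (ℓ : ℕ) (N : ℝ≥0∞)
    (G : List (Seg d c L) → Site d → Env d → ℝ≥0∞) : Prop where
  meas : ∀ a s, Measurable (G a s)
  trunc : ∀ a, G (a.take ℓ) = G a
  dep : ∀ a s, DependsOn (G a s) (past (a.take ℓ))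
  mass : ∀ a, ∀ᵐ ω ∂P, ∑' s, G a s ω = N

lemma measurable_future {G : List (Seg d c L) → Site d → Env d → ℝ≥0∞}
    (hG : ∀ a s, Measurable (G a s)) (a : List (Seg d c L)) (s : Site d) :
    Measurable (future κ G a s) :=
  Measurable.tsum fun w =>
    ((hG _ _).comp (measurable_shiftEnv _)).mul (measurable_segProb κ c w.1)

lemma iterate_meanOp (m : ℕ) (G : List (Seg d c L) → Site d → Env d → ℝ≥0∞)
    (a : List (Seg d c L)) (s : Site d) (ω : Env d) :
    (meanOp P κ)^[m] G a s ω = (regOp P κ c L ^ m) (fun s' => G a s' ω) s := by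
  induction m generalizing s with
  | zero => rfl
  | succ m ih =>
    rw [Function.iterate_succ_apply', pow_succ', Module.End.mul_apply, meanOp]
    exact congrArg (fun g => regOp P κ c L g s) (funext ih)

lemma measurable_iterate_meanOp (m : ℕ) {G : List (Seg d c L) → Site d → Env d → ℝ≥0∞}
    (hG : ∀ a s, Measurable (G a s)) (a : List (Seg d c L)) (s : Site d) :
    Measurable ((meanOp P κ)^[m] G a s) := by
  induction m generalizing s with
  | zero => exact hG a s
  | succ m ih =>
    rw [Function.iterate_succ_apply']
    exact Measurable.tsum fun _ => (ih _).const_mul _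

lemma tsum_future {N : ℝ≥0∞} (hP : TranslationInvariant P)
    (hseg : ∀ᵐ ω ∂P, ∑' w : Seg d c L, segProb κ c w.1 ω = goodProb κ c ω)
    {G : List (Seg d c L) → Site d → Env d → ℝ≥0∞}
    (hG : ∀ a, ∀ᵐ ω ∂P, ∑' s, G a s ω = N) (a : List (Seg d c L)) :
    ∀ᵐ ω ∂P, ∑' s, future κ G a s ω = N * goodProb κ c ω := by
  have h1 : ∀ᵐ ω ∂P, ∀ w : Seg d c L, ∑' s, G (w :: a) s (shiftEnv (pos w.1) ω) = N := by
    rw [ae_all_iff]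
    intro w
    filter_upwards [hP.ae_shift (hG (w :: a))] with ω hω using hω _
  filter_upwards [h1, hseg] with ω h1 h2
  simp only [future]
  rw [ENNReal.tsum_comm, ← h2, ← ENNReal.tsum_mul_left]
  refine tsum_congr fun w => ?_
  rw [ENNReal.tsum_mul_right]
  congr 1
  rw [← h1 w]
  exact (Equiv.addRight (pos w.1)).tsum_eq fun s => G (w :: a) s (shiftEnv (pos w.1) ω)

lemma energy_eq_add {F D F' : List (Seg d c L) → Site d → Env d → ℝ≥0∞} {b : ℝ≥0∞} (m k : ℕ)
    (hD : ∀ a s, Measurable (D a s)) (hF' : ∀ a s, Measurable (F' a s))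
    (h : ∀ a s, ∀ᵐ ω ∂P, F a s ω = D a s ω + b * F' a s ω) :
    energy P κ k ((meanOp P κ)^[m] F) =
      energy P κ k ((meanOp P κ)^[m] D) + b * energy P κ k ((meanOp P κ)^[m] F') := by
  simp only [energy]
  rw [← listSum_mul_left, ← listSum_add]
  refine listSum_congr fun a _ => ?_
  have hDm := measurable_iterate_meanOp (P := P) (κ := κ) m hD a (pos (segWord a))
  have hFm := measurable_iterate_meanOp (P := P) (κ := κ) m hF' a (pos (segWord a))
  have hrel := measurable_relWeight κ (segWord a)
  have hgood := measurable_goodProb (d := d) κ c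
  have h1 : Measurable fun ω => relWeight κ (segWord a) ω *
      (meanOp P κ)^[m] F' a (pos (segWord a)) ω * goodProb κ c ω := (hrel.mul hFm).mul hgood
  have h2 : Measurable fun ω => relWeight κ (segWord a) ω *
      (meanOp P κ)^[m] D a (pos (segWord a)) ω * goodProb κ c ω := (hrel.mul hDm).mul hgood
  rw [← lintegral_const_mul b h1, ← lintegral_add_left h2]
  refine lintegral_congr_ae ?_
  filter_upwards [ae_all_iff.2 (h a)] with ω hω
  have h1 : (fun s => F a s ω) = (fun s => D a s ω) + b • fun s => F' a s ω := by
    funext s; exact hω s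
  simp only [iterate_meanOp]
  rw [h1, map_add, map_smul, Pi.add_apply, Pi.smul_apply, smul_eq_mul]
  ring

variable [IsProbabilityMeasure P]

lemma measurable_condOp {G : List (Seg d c L) → Site d → Env d → ℝ≥0∞}
    (hG : ∀ a s, Measurable (G a s)) (j : ℕ) (a : List (Seg d c L)) (s : Site d) :
    Measurable (condOp P κ j G a s) :=
  (measurable_condE (measurable_future hG _ _)).div (measurable_condE (measurable_goodProb κ c))

/-- An independent step only translates the position variable, so it commutes with averaging over
the next segment. Independent steps can thus be accumulated as a power of `meanOp`. -/
lemma condOp_meanOp {G : List (Seg d c L) → Site d → Env d → ℝ≥0∞}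
    (hG : ∀ a s, Measurable (G a s)) (j : ℕ) :
    condOp P κ j (meanOp P κ G) = meanOp P κ (condOp P κ j G) := by
  funext a s ω
  have h1 : future κ (meanOp P κ G) (a.take j) s = fun ω => ∑' v : Seg d c L,
      segMass P κ c v.1 * future κ G (a.take j) (s + pos v.1) ω := by
    funext ω
    simp only [future, meanOp, regOp, convOp_apply, ← ENNReal.tsum_mul_left,
      ← ENNReal.tsum_mul_right]
    rw [ENNReal.tsum_comm]
    refine tsum_congr fun v => tsum_congr fun w => ?_
    rw [add_right_comm, mul_assoc]
  rw [condOp, h1, condE_tsum fun v => (measurable_future hG _ _).const_mul _]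
  simp only [meanOp, regOp, convOp_apply, condOp, div_eq_mul_inv, ← ENNReal.tsum_mul_right]
  refine tsum_congr fun v => ?_
  rw [condE_const_mul (measurable_future hG _ _), mul_assoc]

lemma condOp_iterate_meanOp {G : List (Seg d c L) → Site d → Env d → ℝ≥0∞}
    (hG : ∀ a s, Measurable (G a s)) (j m : ℕ) :
    condOp P κ j ((meanOp P κ)^[m] G) = (meanOp P κ)^[m] (condOp P κ j G) := by
  induction m with
  | zero => rfl
  | succ m ih =>
    rw [Function.iterate_succ_apply', Function.iterate_succ_apply', ← ih,
      condOp_meanOp fun a s => measurable_iterate_meanOp m hG a s]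

/-- With memory zero, `G` depends on the position only and nothing is conditioned on. The average
over the next segment is then exactly a convolution with `segMass`. -/
lemma RecentPast.condOp_zero {N : ℝ≥0∞} {G : List (Seg d c L) → Site d → Env d → ℝ≥0∞}
    (hG : RecentPast P 0 N G) : condOp P κ 0 G = meanOp P κ G := by
  have hconst : ∀ a s ω ω', G a s ω = G [] s ω' := by
    intro a s ω ω'
    have h1 := hG.trunc a
    rw [List.take_zero] at h1
    rw [← h1]
    exact hG.dep [] s fun x hx => hx.elim
  funext a s ω
  have h1 : ∫⁻ ω', future κ G [] s ω' ∂P =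
      ∑' w : Seg d c L, G a (s + pos w.1) ω * ∫⁻ ω', segProb κ c w.1 ω' ∂P := by
    simp only [future]
    rw [lintegral_tsum (f := fun (w : Seg d c L) ω' =>
        G [w] (s + pos w.1) (shiftEnv (pos w.1) ω') * segProb κ c w.1 ω')
      fun w => (((hG.meas _ _).comp (measurable_shiftEnv _)).mul
      (measurable_segProb κ c w.1)).aemeasurable]
    refine tsum_congr fun w => ?_
    rw [← lintegral_const_mul _ (measurable_segProb κ c w.1)]
    refine lintegral_congr fun ω' => ?_
    rw [hconst _ _ _ ω, hconst a _ ω ω]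
  rw [condOp, List.take_zero, past, condE_empty (measurable_goodProb κ c),
    condE_empty (measurable_future hG.meas _ _), h1, meanOp, regOp, convOp_apply, div_eq_mul_inv,
    ← ENNReal.tsum_mul_right]
  refine tsum_congr fun w => ?_
  rw [segMass, goodMass]
  ring

/-! ### Bounds for the conditional means -/

variable {θ : ℕ → ℝ≥0∞}

/-- Decoupling bounds the conditional probability of `R = ∞` below by `goodMass / θ L`, so the
quotient defining `condOp` is not degenerate. -/
lemma Decouples.condE_goodProb_ne (hD : Decouples P c L θ) (hθ : ∀ t, θ t ≠ ∞)
    (hpos : goodMass P κ c ≠ 0) {Λ : Set (Site d)} (hΛ : ∀ x ∈ Λ, x 0 < -(L : ℤ)) :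
    ∀ᵐ ω ∂P, condE P Λ (goodProb κ c) ω ≠ 0 ∧ condE P Λ (goodProb κ c) ω ≠ ∞ := by
  have h := (hD.decFun_goodProb hθ κ (t := L) (rec := ∅) (old := Λ) (by simpa using hΛ) hΛ).ae
    (measurable_goodProb κ c)
  filter_upwards [h.1] with ω hω
  rw [condE_empty (measurable_goodProb κ c), Set.empty_union] at hω
  refine ⟨fun h0 => hpos ?_,
    ne_top_of_le_ne_top ENNReal.one_ne_top (condE_le_one (goodProb_le_one κ c) ω)⟩
  rw [h0, mul_zero] at hω
  exact nonpos_iff_eq_zero.1 hω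

/-- `condOp P κ j` has memory exactly the `j` segments it conditions on. It preserves mass because
the segments exhaust the good event, the denominator being the conditional probability of that
event. -/
lemma Decouples.recentPast_condOp (hD : Decouples P c L θ) (hθ : ∀ t, θ t ≠ ∞)
    (hP : TranslationInvariant P) (hpos : goodMass P κ c ≠ 0)
    (hseg : ∀ᵐ ω ∂P, ∑' w : Seg d c L, segProb κ c w.1 ω = goodProb κ c ω)
    {ℓ : ℕ} {N : ℝ≥0∞} {G : List (Seg d c L) → Site d → Env d → ℝ≥0∞} (hG : RecentPast P ℓ N G)
    (j : ℕ) : RecentPast P j N (condOp P κ j G) where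
  meas := measurable_condOp hG.meas j
  trunc a := by
    funext s ω
    simp only [condOp, List.take_take, min_self]
  dep a s := by
    intro ω ω' h
    simp only [condOp]
    rw [dependsOn_condE _ h, dependsOn_condE _ h]
  mass a := by
    have h1 := condE_congr_ae (Λ := past (a.take j)) (tsum_future hP hseg hG.mass (a.take j))
    rw [condE_tsum fun s => measurable_future hG.meas _ s] at h1
    filter_upwards [h1, hD.condE_goodProb_ne hθ hpos (Λ := past (a.take j))
      fun x hx => past_level hx] with ω hω hne
    simp only [condOp, div_eq_mul_inv]
    rw [ENNReal.tsum_mul_right, hω, condE_const_mul (measurable_goodProb κ c), mul_assoc,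
      ENNReal.mul_inv_cancel hne.1 hne.2, mul_one]

/-- Sites added by the segment of age `j + 1` lie below `-(j+1)L`. Forgetting them costs one factor
`θ ((j+1)L)` in the numerator and one in the denominator of `condOp`. -/
lemma Decouples.mul_condOp_le (hD : Decouples P c L θ) (hθ : ∀ t, θ t ≠ ∞) (hθ1 : ∀ t, 1 ≤ θ t)
    (hc : 0 ≤ c) (hP : TranslationInvariant P) {ℓ : ℕ} {N : ℝ≥0∞} (hN : N ≠ ∞)
    {G : List (Seg d c L) → Site d → Env d → ℝ≥0∞} (hG : RecentPast P ℓ N G)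
    {j : ℕ} (hj : ℓ ≤ j + 1) (a : List (Seg d c L)) (s : Site d) :
    ∀ᵐ ω ∂P, (θ ((j + 1) * L) * θ ((j + 1) * L))⁻¹ * condOp P κ j G a s ω ≤
      condOp P κ (j + 1) G a s ω := by
  set t := (j + 1) * L with ht
  set rec := past (a.take j) with hrec
  set old := past (a.take (j + 1)) \ past (a.take j) with hold
  have hunion : rec ∪ old = past (a.take (j + 1)) :=
    Set.union_sdiff_cancel (past_take_mono a (Nat.le_succ j))
  have hro : ∀ x ∈ rec ∪ old, x 0 < -(L : ℤ) := by
    rw [hunion]; exact fun x hx => past_level hx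
  have hold' : ∀ x ∈ old, x 0 < -(t : ℤ) := fun x hx => past_old_level a j hx.1 hx.2
  -- After a new segment, `G` sees only `ℓ - 1 ≤ j` of the old ones, so the older segment matters
  -- only through the conditioning.
  have hfut : future κ G (a.take (j + 1)) s = future κ G (a.take j) s := by
    funext ω
    refine tsum_congr fun w => ?_
    have h1 : G (w :: a.take (j + 1)) = G (w :: a.take j) := by
      rw [← hG.trunc (w :: a.take (j + 1)), ← hG.trunc (w :: a.take j)]
      congr 1
      cases ℓ with
      | zero => rfl
      | succ ℓ =>
        rw [List.take_succ_cons, List.take_succ_cons, List.take_take, List.take_take,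
          min_eq_left (by omega), min_eq_left (by omega)]
    rw [h1]
  have hdec : DecFun P (θ t) rec old (future κ G (a.take j) s) := by
    refine DecFun.tsum (fun w => ((hG.meas _ _).comp (measurable_shiftEnv _)).mul
      (measurable_segProb κ c w.1)) fun w => ?_
    refine hD.decFun hθ κ (fun v hv => w.2.2.1.append hc w.2.1.record hv) hro hold'
      ((hG.meas _ _).comp (measurable_shiftEnv _)) ?_ ?_
    · refine DependsOn.shiftEnv (hG.dep _ _) (pos w.1) fun x hx => ?_
      cases ℓ with
      | zero => exact hx.elim
      | succ ℓ =>
        rw [List.take_succ_cons] at hx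
        rcases hx with hx | hx
        · refine Or.inr ?_
          have h1 := sites_append_left (w.1.take (w.1.length - L)) (w.1.drop (w.1.length - L)) hx
          rwa [List.take_append_drop] at h1
        · refine Or.inl ?_
          rw [List.take_take, min_eq_left (by omega : ℓ ≤ j)] at hx
          exact past_take_mono a (by omega : ℓ ≤ j) hx
    · refine ne_top_of_le_ne_top hN ?_
      have h1 := hP.lintegral_shift (pos w.1) (hG.meas (w :: a.take j) (s + pos w.1))
      refine h1.le.trans ?_
      calc ∫⁻ ω, G (w :: a.take j) (s + pos w.1) ω ∂P ≤ ∫⁻ _, N ∂P := by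
            refine lintegral_mono_ae ?_
            filter_upwards [hG.mass (w :: a.take j)] with ω hω
            rw [← hω]
            exact ENNReal.le_tsum _
        _ = N := by simp
  have h1 := (hdec.ae (measurable_future hG.meas _ _)).1
  have h2 := ((hD.decFun_goodProb hθ κ hro hold').ae (measurable_goodProb κ c)).2
  filter_upwards [h1, h2] with ω h1 h2
  rw [hunion] at h1 h2
  simp only [condOp]
  rw [hfut]
  set x := condE P rec (future κ G (a.take j) s) ω
  set x' := condE P (past (a.take (j + 1))) (future κ G (a.take j) s) ω
  set y := condE P rec (goodProb κ c) ω
  set y' := condE P (past (a.take (j + 1))) (goodProb κ c) ω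
  have hθ0 : θ t ≠ 0 := (lt_of_lt_of_le one_pos (hθ1 t)).ne'
  have h3 : y⁻¹ ≤ θ t * y'⁻¹ := by
    calc y⁻¹ = θ t * (θ t * y)⁻¹ := by
          rw [ENNReal.mul_inv (Or.inl hθ0) (Or.inl (hθ t)), ← mul_assoc,
            ENNReal.mul_inv_cancel hθ0 (hθ t), one_mul]
      _ ≤ θ t * y'⁻¹ := by gcongr
  calc (θ t * θ t)⁻¹ * (x / y) ≤ (θ t * θ t)⁻¹ * (θ t * x' * (θ t * y'⁻¹)) := by
        rw [div_eq_mul_inv]; gcongr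
    _ = ((θ t * θ t)⁻¹ * (θ t * θ t)) * (x' / y') := by rw [div_eq_mul_inv]; ring
    _ = x' / y' := by
        rw [ENNReal.inv_mul_cancel (mul_ne_zero hθ0 hθ0) (ENNReal.mul_ne_top (hθ t) (hθ t)), one_mul]

/-! ### The recursion -/

/-- The word of the older segments has a weight depending only on the environment in `past a`.
Condition the rest on that environment and write the result as `condOp` times the conditional
probability of `R = ∞`; undoing the conditioning gives the energy at `k`. -/
lemma Decouples.energy_succ (hD : Decouples P c L θ) (hθ : ∀ t, θ t ≠ ∞)
    (hP : TranslationInvariant P) (hpos : goodMass P κ c ≠ 0) (hκ : 0 < κ) (h2 : 2 * (d * κ) < 1)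
    {G : List (Seg d c L) → Site d → Env d → ℝ≥0∞} (hG : ∀ a s, Measurable (G a s)) (k : ℕ) :
    energy P κ (k + 1) G = energy P κ k (condOp P κ k G) := by
  rw [energy, energy, listSum]
  refine listSum_congr fun a ha => ?_
  set A := segWord a with hA
  have hrel := measurable_relWeight κ A
  have hfut : Measurable (future κ G a (pos A)) := measurable_future hG _ _
  have htake : a.take k = a := by rw [← ha, List.take_length]
  have h1 : ∑' w : Seg d c L, ∫⁻ ω, relWeight κ (segWord (w :: a)) ω *
      G (w :: a) (pos (segWord (w :: a))) ω * goodProb κ c ω ∂P =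
      ∫⁻ ω, relWeight κ A ω * future κ G a (pos A) ω ∂P := by
    simp only [future, ← ENNReal.tsum_mul_left]
    rw [lintegral_tsum (f := fun (w : Seg d c L) ω => relWeight κ A ω *
        (G (w :: a) (pos A + pos w.1) (shiftEnv (pos w.1) ω) * segProb κ c w.1 ω))
      fun w => (hrel.mul (((hG _ _).comp (measurable_shiftEnv _)).mul
      (measurable_segProb κ c w.1))).aemeasurable]
    refine tsum_congr fun w => ?_
    have hm : Measurable fun ω => relWeight κ (segWord (w :: a)) ω *
        G (w :: a) (pos (segWord (w :: a))) ω * goodProb κ c ω :=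
      ((measurable_relWeight κ _).mul (hG _ _)).mul (measurable_goodProb κ c)
    rw [← hP.lintegral_shift (pos w.1) hm]
    refine lintegral_congr fun ω => ?_
    rw [segWord, relWeight_append_shift, pos_append, segProb]
    ring
  rw [h1, ← lintegral_mul_condE hfut hrel (dependsOn_relWeight_segWord hκ h2 a)]
  have h3 : ∫⁻ ω, relWeight κ A ω * condE P (past a) (future κ G a (pos A)) ω ∂P =
      ∫⁻ ω, relWeight κ A ω * condOp P κ k G a (pos A) ω * condE P (past a) (goodProb κ c) ω ∂P := by
    refine lintegral_congr_ae ?_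
    filter_upwards [hD.condE_goodProb_ne hθ hpos (Λ := past a) fun x hx => past_level hx]
      with ω hne
    rw [condOp, htake, mul_assoc, ENNReal.div_mul_cancel hne.1 hne.2]
  rw [h3]
  refine lintegral_mul_condE (measurable_goodProb κ c) (hrel.mul (measurable_condOp hG k a _)) ?_
  intro ω ω' h
  simp only [condOp, htake]
  rw [dependsOn_relWeight_segWord hκ h2 a h, dependsOn_condE _ h, dependsOn_condE _ h]

/-- `m` counts the independent steps gained, `ℓ` the current memory. At each step either `ℓ` drops
by one or, if `ℓ = 0`, `m` grows by one; both multiply `4^(ℓ-m)` by `1/4`. The resets to memory `j +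
1`, of mass `q j`, add at most `η` in total. -/
lemma Decouples.energy_le (hD : Decouples P c L θ) (hθ : ∀ t, θ t ≠ ∞) (hθ1 : ∀ t, 1 ≤ θ t)
    (hc : 0 ≤ c) (hP : TranslationInvariant P) (hpos : goodMass P κ c ≠ 0) (hκ : 0 < κ)
    (h2 : 2 * (d * κ) < 1)
    (hseg : ∀ᵐ ω ∂P, ∑' w : Seg d c L, segProb κ c w.1 ω = goodProb κ c ω)
    {A B η ρ : ℝ≥0∞}
    (hAB : ∀ m (g : Site d → ℝ≥0∞) s, ∑' x, g x ≠ ∞ →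
      (regOp P κ c L ^ m) g s ≤ (A + B * 4⁻¹ ^ m) * ∑' x, g x)
    {p q : ℕ → ℝ≥0∞} (hpq : ∀ j, p j + q j = 1)
    (hp : ∀ j, p j ≤ (θ ((j + 1) * L) * θ ((j + 1) * L))⁻¹)
    (hq : ∑' j, q j * 4 ^ (j + 1) ≤ η) (hρ : 4⁻¹ + η ≤ ρ)
    (k m ℓ : ℕ) {N : ℝ≥0∞} (hN : N ≠ ∞) {G : List (Seg d c L) → Site d → Env d → ℝ≥0∞}
    (hG : RecentPast P ℓ N G) :
    energy P κ k ((meanOp P κ)^[m] G) ≤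
      N * goodMass P κ c * (A + B * 4⁻¹ ^ m * 4 ^ ℓ * ρ ^ k) := by
  have h4 : (4⁻¹ : ℝ≥0∞) * 4 = 1 := ENNReal.inv_mul_cancel (by norm_num) (by norm_num)
  induction k generalizing m ℓ N G with
  | zero =>
    have h1 : ∀ᵐ ω ∂P, relWeight κ (segWord ([] : List (Seg d c L))) ω *
        (meanOp P κ)^[m] G [] (pos (segWord ([] : List (Seg d c L)))) ω * goodProb κ c ω ≤
        (A + B * 4⁻¹ ^ m) * N * goodProb κ c ω := by
      filter_upwards [hG.mass []] with ω hω
      rw [iterate_meanOp]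
      refine mul_le_mul_left ?_ _
      refine le_trans (mul_le_of_le_one_left zero_le (relWeight_le_one _ _ _)) ?_
      refine (hAB m _ _ ?_).trans ?_
      · rw [hω]; exact hN
      · rw [hω]
    rw [energy, listSum]
    refine (lintegral_mono_ae h1).trans ?_
    rw [lintegral_const_mul _ (measurable_goodProb κ c), ← goodMass, pow_zero, mul_one,
      mul_comm _ N, mul_assoc, mul_comm _ (goodMass P κ c), ← mul_assoc]
    exact mul_le_mul_right (add_le_add_right
      (le_mul_of_one_le_right zero_le (one_le_pow₀ (by norm_num))) _) _
  | succ k ih =>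
    rw [hD.energy_succ hθ hP hpos hκ h2 (fun a s => measurable_iterate_meanOp m hG.meas a s) k,
      condOp_iterate_meanOp hG.meas]
    have hcls : ∀ j, RecentPast P j N (condOp P κ j G) :=
      hD.recentPast_condOp hθ hP hpos hseg hG
    set M := N * goodMass P κ c with hM
    set V := B * 4⁻¹ ^ m * ρ ^ k with hV
    -- Here `j` is the truncated `ℓ - 1`, the memory left after one step; for `ℓ = 0` it is `0` and
    -- an independent step is gained instead.
    have hfirst : ∀ j, ℓ ≤ j + 1 → j ≤ ℓ - 1 → energy P κ k ((meanOp P κ)^[m] (condOp P κ j G)) ≤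
        M * (A + V * (4⁻¹ * 4 ^ ℓ)) := by
      intro j hj1 hj2
      cases ℓ with
      | zero =>
        obtain rfl : j = 0 := by omega
        rw [hG.condOp_zero, ← Function.iterate_succ_apply]
        refine (ih (m + 1) 0 hN hG).trans (le_of_eq ?_)
        rw [hV, pow_succ]; ring
      | succ ℓ =>
        obtain rfl : j = ℓ := by omega
        refine (ih m j hN (hcls j)).trans (le_of_eq ?_)
        have h5 : (4⁻¹ : ℝ≥0∞) * 4 ^ (j + 1) = 4 ^ j := by rw [pow_succ', ← mul_assoc, h4, one_mul]
        rw [h5, hV]; ring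
    -- Refine the conditioning one segment at a time, from `ℓ - 1` up to all `k` segments; passing
    -- from `j` to `j + 1` costs `q j * 4 ^ (j + 1)`.
    have hstep : ∀ j, ℓ ≤ j + 1 → energy P κ k ((meanOp P κ)^[m] (condOp P κ j G)) ≤
        M * (A + V * (4⁻¹ * 4 ^ ℓ + ∑ i ∈ Finset.range j, q i * 4 ^ (i + 1))) := by
      intro j
      induction j with
      | zero =>
        intro hj
        refine (hfirst 0 hj (by omega)).trans ?_
        simp
      | succ j ihj =>
        intro hj
        rcases lt_or_ge (j + 1) ℓ with h | h
        · refine (hfirst (j + 1) hj (by omega)).trans ?_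
          gcongr
          exact le_self_add
        · have hle : ∀ a s, ∀ᵐ ω ∂P, p j * condOp P κ j G a s ω ≤ condOp P κ (j + 1) G a s ω := by
            intro a s
            filter_upwards [hD.mul_condOp_le hθ hθ1 hc hP hN hG h a s (κ := κ)] with ω hω
            exact le_trans (mul_le_mul_left (hp j) _) hω
          -- The part not explained by the coarser conditioning: nonnegative where `hle` holds, of
          -- mass `q j * N`, and with memory `j + 1`. The outer induction applies to it.
          set D : List (Seg d c L) → Site d → Env d → ℝ≥0∞ := fun a s ω =>
            condOp P κ (j + 1) G a s ω - p j * condOp P κ j G a s ω with hDdef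
          have hp1 : p j ≠ ∞ :=
            ne_top_of_le_ne_top ENNReal.one_ne_top (by rw [← hpq j]; exact le_self_add)
          have hq1 : q j ≠ ∞ :=
            ne_top_of_le_ne_top ENNReal.one_ne_top (by rw [← hpq j]; exact le_add_self)
          have hDcls : RecentPast P (j + 1) (q j * N) D := by
            refine ⟨fun a s => ((hcls (j + 1)).meas a s).sub (((hcls j).meas a s).const_mul _),
              fun a => ?_, fun a s ω ω' hω => ?_, fun a => ?_⟩
            · funext s ω
              simp only [hDdef]
              rw [(hcls (j + 1)).trunc a, ← (hcls j).trunc (a.take (j + 1)), List.take_take,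
                min_eq_left (Nat.le_succ j), (hcls j).trunc a]
            · simp only [hDdef]
              rw [(hcls (j + 1)).dep a s hω,
                (hcls j).dep a s fun x hx => hω x (past_take_mono a (Nat.le_succ j) hx)]
            · filter_upwards [ae_all_iff.2 (hle a), (hcls (j + 1)).mass a, (hcls j).mass a]
                with ω h1 h3 h5
              have h6 : ∑' s, D a s ω + p j * N = q j * N + p j * N := by
                rw [← add_mul, add_comm (q j), hpq, one_mul, ← h5, ← ENNReal.tsum_mul_left,
                  ← ENNReal.tsum_add, h5, ← h3]
                exact tsum_congr fun s => tsub_add_cancel_of_le (h1 s)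
              exact (ENNReal.add_left_inj (ENNReal.mul_ne_top hp1 hN)).1 h6
          rw [energy_eq_add (F' := condOp P κ j G) (D := D) (b := p j) m k hDcls.meas (hcls j).meas
            fun a s => by
              filter_upwards [hle a s] with ω hω
              exact (tsub_add_cancel_of_le hω).symm]
          calc energy P κ k ((meanOp P κ)^[m] D) +
                p j * energy P κ k ((meanOp P κ)^[m] (condOp P κ j G))
              ≤ q j * N * goodMass P κ c * (A + B * 4⁻¹ ^ m * 4 ^ (j + 1) * ρ ^ k) +
                p j * (M * (A + V * (4⁻¹ * 4 ^ ℓ + ∑ i ∈ Finset.range j, q i * 4 ^ (i + 1)))) := by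
                gcongr
                · exact ih m (j + 1) (ENNReal.mul_ne_top hq1 hN) hDcls
                · exact ihj h
            _ = M * ((p j + q j) * A + V * (q j * 4 ^ (j + 1)) +
                p j * (V * (4⁻¹ * 4 ^ ℓ + ∑ i ∈ Finset.range j, q i * 4 ^ (i + 1)))) := by
                rw [hM, hV]; ring
            _ ≤ M * (1 * A + V * (q j * 4 ^ (j + 1)) +
                1 * (V * (4⁻¹ * 4 ^ ℓ + ∑ i ∈ Finset.range j, q i * 4 ^ (i + 1)))) := by
                rw [hpq j]
                gcongr
                rw [← hpq j]; exact le_self_add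
            _ = M * (A + V * (4⁻¹ * 4 ^ ℓ + ∑ i ∈ Finset.range (j + 1), q i * 4 ^ (i + 1))) := by
                rw [Finset.sum_range_succ]; ring
    have hlast : energy P κ k ((meanOp P κ)^[m] (condOp P κ k G)) ≤
        M * (A + V * ((4⁻¹ + η) * 4 ^ ℓ)) := by
      -- If `ℓ > k + 1`, conditioning on all `k` existing segments already reduces the memory below
      -- `ℓ - 1`.
      rcases lt_or_ge (k + 1) ℓ with h | h
      · refine (ih m k hN (hcls k)).trans ?_
        have h5 : (4 : ℝ≥0∞) ^ k ≤ (4⁻¹ + η) * 4 ^ ℓ := by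
          calc (4 : ℝ≥0∞) ^ k = 4⁻¹ * 4 ^ (k + 1) := by rw [pow_succ', ← mul_assoc, h4, one_mul]
            _ ≤ (4⁻¹ + η) * 4 ^ ℓ := by
              gcongr
              · exact le_self_add
              · norm_num
        rw [hV, mul_right_comm (B * 4⁻¹ ^ m)]
        gcongr
      · refine (hstep k h).trans ?_
        gcongr
        rw [add_mul]
        gcongr
        calc ∑ i ∈ Finset.range k, q i * 4 ^ (i + 1) ≤ η := (ENNReal.sum_le_tsum _).trans hq
          _ ≤ η * 4 ^ ℓ := le_mul_of_one_le_right zero_le (one_le_pow₀ (by norm_num))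
    refine hlast.trans ?_
    rw [hV, pow_succ]
    calc M * (A + B * 4⁻¹ ^ m * ρ ^ k * ((4⁻¹ + η) * 4 ^ ℓ))
        ≤ M * (A + B * 4⁻¹ ^ m * ρ ^ k * (ρ * 4 ^ ℓ)) := by gcongr
      _ = M * (A + B * 4⁻¹ ^ m * 4 ^ ℓ * (ρ ^ k * ρ)) := by ring

end functionals

/-! ## The law of the regeneration positions -/

lemma card_sites_le {d : ℕ} (u : List (Letter d)) : (sites u).card ≤ u.length := by
  classical
  unfold sites
  exact Finset.card_image_le.trans (by rw [Finset.card_range])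

/-- The square sum is at most the supremum, bounded by `M ∑ q`, times the total mass, bounded by `∑
q`. -/
lemma tsum_conv_sq_le {d : ℕ} {f q : Site d → ℝ≥0∞} {M : ℝ≥0∞} (hM : ∀ z, f z ≤ M) (hf : ∑' z, f z ≤ 1) :
    ∑' x, (∑' z, f z * q (x - z)) ^ 2 ≤ M * (∑' y, q y) ^ 2 := by
  have hsub : ∀ z, ∑' x, q (x - z) = ∑' y, q y := fun z => (Equiv.subRight z).tsum_eq q
  have hsub' : ∀ x, ∑' z, q (x - z) = ∑' y, q y := fun x => (Equiv.subLeft x).tsum_eq q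
  have h1 : ∀ x, ∑' z, f z * q (x - z) ≤ M * ∑' y, q y := by
    intro x
    rw [← hsub' x, ← ENNReal.tsum_mul_left]
    exact ENNReal.tsum_le_tsum fun z => mul_le_mul_left (hM z) _
  have h2 : ∑' x, ∑' z, f z * q (x - z) ≤ ∑' y, q y := by
    rw [ENNReal.tsum_comm]
    simp_rw [ENNReal.tsum_mul_left, hsub]
    rw [ENNReal.tsum_mul_right]
    exact mul_le_of_le_one_left zero_le hf
  calc ∑' x, (∑' z, f z * q (x - z)) ^ 2
      ≤ ∑' x, (M * ∑' y, q y) * ∑' z, f z * q (x - z) := by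
        refine ENNReal.tsum_le_tsum fun x => ?_
        rw [sq]
        exact mul_le_mul_left (h1 x) _
    _ = (M * ∑' y, q y) * ∑' x, ∑' z, f z * q (x - z) := ENNReal.tsum_mul_left
    _ ≤ (M * ∑' y, q y) * ∑' y, q y := mul_le_mul_right h2 _
    _ = M * (∑' y, q y) ^ 2 := by ring

section positions

variable {d : ℕ} [NeZero d] {P : Measure (Env d)} [IsProbabilityMeasure P] {κ c : ℝ} {L : ℕ}
  {θ : ℕ → ℝ≥0∞}

open Classical in
/-- The probability of being at `x` after `n` segments. -/
def regDist (P : Measure (Env d)) (κ c : ℝ) (L n : ℕ) (x : Site d) : ℝ≥0∞ :=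
  (goodMass P κ c)⁻¹ * energy (c := c) (L := L) P κ n fun _ s _ => if s = x then 1 else 0

lemma Decouples.energy_one_le (hD : Decouples P c L θ) (hθ : ∀ t, θ t ≠ ∞)
    (hP : TranslationInvariant P) (hpos : goodMass P κ c ≠ 0) (hκ : 0 < κ) (h2 : 2 * (d * κ) < 1)
    (hc : 0 ≤ c) (n : ℕ) :
    energy (c := c) (L := L) P κ n (fun _ _ _ => 1) ≤ goodMass P κ c := by
  induction n with
  | zero => simp [energy, listSum, segWord, relWeight, goodMass]
  | succ n ih =>
    rw [hD.energy_succ hθ hP hpos hκ h2 (fun _ _ => measurable_const)]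
    refine le_trans (listSum_mono fun a _ => lintegral_mono fun ω => ?_) ih
    refine mul_le_mul_left (mul_le_mul_right ?_ _) _
    refine le_trans (ENNReal.div_le_div_right (condE_mono (fun ω' => ?_) ω) _) ENNReal.div_self_le_one
    simpa [future] using tsum_segProb_le hc L ω'

lemma Decouples.tsum_regDist_le (hD : Decouples P c L θ) (hθ : ∀ t, θ t ≠ ∞)
    (hP : TranslationInvariant P) (hpos : goodMass P κ c ≠ 0) (hκ : 0 < κ) (h2 : 2 * (d * κ) < 1)
    (hc : 0 ≤ c) (n : ℕ) : ∑' x, regDist P κ c L n x ≤ 1 := by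
  classical
  simp only [regDist]
  rw [ENNReal.tsum_mul_left]
  have h1 : ∑' x, energy (c := c) (L := L) P κ n (fun _ s _ => if s = x then 1 else 0) =
      energy (c := c) (L := L) P κ n (fun _ _ _ => 1) := by
    simp only [energy]
    rw [← listSum_tsum]
    refine listSum_congr fun a _ => ?_
    rw [tsum_eq_single (pos (segWord a))]
    · simp
    · intro x hx
      simp [hx.symm]
  rw [h1]
  calc (goodMass P κ c)⁻¹ * energy (c := c) (L := L) P κ n (fun _ _ _ => 1)
      ≤ (goodMass P κ c)⁻¹ * goodMass P κ c :=
        mul_le_mul_right (hD.energy_one_le hθ hP hpos hκ h2 hc n) _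
    _ = 1 := ENNReal.inv_mul_cancel hpos (goodMass_ne_top P κ c)

/-- The event that the first segments are those of `a`. -/
def listEvent (c : ℝ) {L : ℕ} (a : List (Seg d c L)) (E : Set (Track d)) : Set (Track d) :=
  cyl (segWord a) ∩ shiftTrack (segWord a).length ⁻¹' E

lemma measurableSet_listEvent (a : List (Seg d c L)) {E : Set (Track d)} (hE : MeasurableSet E) :
    MeasurableSet (listEvent c a E) :=
  (measurableSet_cyl _).inter (measurable_shiftTrack _ hE)

lemma mem_listEvent {a : List (Seg d c L)} {σ : Track d} {N : ℕ} (h : segWord a = pre σ N)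
    {E : Set (Track d)} (hE : shiftTrack N σ ∈ E) : σ ∈ listEvent c a E := by
  have hN : (segWord a).length = N := by rw [h, length_pre]
  refine ⟨?_, ?_⟩
  · change pre σ (segWord a).length = segWord a
    rw [hN, h]
  · rwa [Set.mem_preimage, hN]

lemma regPosition_le (hP : TranslationInvariant P) (hpos : goodMass P κ c ≠ 0) (n : ℕ)
    (x : Site d) : hatLaw P κ c (regPosition c L n x) ≤ regDist P κ c L n x := by
  classical
  have hc := one_le_of_goodMass hpos
  set E : List (Seg d c L) → Set (Track d) := fun a =>
    if pos (segWord a) = x then listEvent c a (goodSet d c) else ∅ with hE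
  have hEm : ∀ a, MeasurableSet (E a) := by
    intro a
    simp only [hE]
    split_ifs
    · exact measurableSet_listEvent a (measurableSet_goodSet c)
    · exact MeasurableSet.empty
  have hF : MeasurableSet {σ | ∃ a : List (Seg d c L), a.length = n ∧ σ ∈ E a} := by
    have : {σ | ∃ a : List (Seg d c L), a.length = n ∧ σ ∈ E a} =
        ⋃ a : List (Seg d c L), ⋃ _ : a.length = n, E a := by ext σ; simp
    rw [this]
    exact MeasurableSet.iUnion fun a => MeasurableSet.iUnion fun _ => hEm a
  refine (hatLaw_le P κ c hF fun ε X σ hm h0 hg hy => ?_).trans ?_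
  · obtain ⟨ω, m, hτ, hX⟩ := hy
    obtain ⟨a, ha, hseg, hgm⟩ := hm.tau_spec hc hg n m hτ
    refine ⟨a, ha, ?_⟩
    change X m = x at hX
    have hposa : pos (segWord a) = x := by
      rw [hseg, ← hX, hm.path m, h0, zero_add]; rfl
    simp only [hE, if_pos hposa]
    exact mem_listEvent hseg hgm
  · rw [regDist]
    refine mul_le_mul_right ?_ _
    refine (measure_exists_list_le _ n E).trans (listSum_mono fun a _ => ?_)
    simp only [hE]
    split_ifs with h
    · rw [listEvent, hP.trackLaw_markov κ _ (measurableSet_goodSet c)]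
      simp only [mul_one]
      rfl
    · simp

/-! ### Visits between consecutive regenerations -/

open Classical in
/-- The expected number of visits of a segment to `y`, where a multiple visit is counted once. -/
def segVisit (P : Measure (Env d)) (κ c : ℝ) (L : ℕ) (y : Site d) : ℝ≥0∞ :=
  ∑' w : Seg d c L, if y ∈ sites w.1 then segMass P κ c w.1 else 0

lemma tsum_segVisit_le (hpos : goodMass P κ c ≠ 0) :
    ∑' y, segVisit P κ c L y ≤ meanTau P κ c L := by
  classical
  refine le_trans ?_ (tsum_segMass_mul_length_le hpos L)
  simp only [segVisit]
  rw [ENNReal.tsum_comm]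
  refine ENNReal.tsum_le_tsum fun w => ?_
  rw [tsum_eq_sum (s := sites w.1) fun y hy => by rw [if_neg hy],
    Finset.sum_congr rfl fun y hy => if_pos hy, Finset.sum_const, nsmul_eq_mul, mul_comm]
  refine mul_le_mul_right ?_ _
  exact_mod_cast card_sites_le w.1

/-- Near independence of the past and the next segment, as an upper bound by a product. One factor
`θ L` separates the segment from the past, the other restores the event `R = ∞` after the past, so
that both factors are conditioned probabilities. -/
lemma Decouples.lintegral_relWeight_mul_le (hD : Decouples P c L θ) (hθ : ∀ t, θ t ≠ ∞)
    (hpos : goodMass P κ c ≠ 0) (hκ : 0 < κ) (h2 : 2 * (d * κ) < 1)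
    (hc : 0 ≤ c) (a : List (Seg d c L)) (w : Seg d c L) :
    (goodMass P κ c)⁻¹ * ∫⁻ ω, relWeight κ (segWord a) ω * segProb κ c w.1 ω ∂P ≤
      θ L * θ L * (((goodMass P κ c)⁻¹ * ∫⁻ ω, relWeight κ (segWord a) ω * goodProb κ c ω ∂P) *
        segMass P κ c w.1) := by
  have hrel := measurable_relWeight κ (segWord a)
  have hdep := dependsOn_relWeight_segWord hκ h2 a
  have hlev : ∀ x ∈ past a, x 0 < -(L : ℤ) := fun x hx => past_level hx
  have h1 := hD.decFun hθ κ (t := L) (w := w.1) (fun v hv => w.2.2.1.append hc w.2.1.record hv)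
    (rec := ∅) (old := past a) (by simpa using hlev) hlev (G := fun _ => 1) measurable_const
    (fun _ _ _ => rfl) (by simp)
  have h3 := (h1 (relWeight κ (segWord a)) hrel (by simpa using hdep) (relWeight_le_one κ _)).2
  simp_rw [condE_empty hrel, one_mul] at h3
  change ∫⁻ ω, relWeight κ (segWord a) ω * segProb κ c w.1 ω ∂P ≤
    θ L * ∫⁻ ω, (∫⁻ ω', relWeight κ (segWord a) ω' ∂P) * segProb κ c w.1 ω ∂P at h3
  rw [lintegral_const_mul _ (measurable_segProb κ c w.1)] at h3
  have h4 := hD.mul_goodMass_le hθ κ hrel (relWeight_le_one κ _) hlev hdep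
  set I := ∫⁻ ω, relWeight κ (segWord a) ω ∂P
  set J := ∫⁻ ω, relWeight κ (segWord a) ω * goodProb κ c ω ∂P
  set S := ∫⁻ ω, segProb κ c w.1 ω ∂P with hS
  set g := goodMass P κ c
  have hg : g⁻¹ * g = 1 := ENNReal.inv_mul_cancel hpos (goodMass_ne_top P κ c)
  calc g⁻¹ * ∫⁻ ω, relWeight κ (segWord a) ω * segProb κ c w.1 ω ∂P
      ≤ g⁻¹ * (θ L * (I * S)) := mul_le_mul_right h3 _
    _ = (g⁻¹ * g) * (g⁻¹ * (θ L * (I * S))) := by rw [hg, one_mul]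
    _ = θ L * (g⁻¹ * g⁻¹) * S * (I * g) := by ring
    _ ≤ θ L * (g⁻¹ * g⁻¹) * S * (θ L * J) := mul_le_mul_right h4 _
    _ = θ L * θ L * ((g⁻¹ * J) * (g⁻¹ * S)) := by ring

/-- A visit to `x` between `τ_k` and `τ_{k+1}` is a visit of the next segment to `x` minus the
position at `τ_k`. Sum the product bound over the first `k` segments and group them by their
displacement `z`. -/
lemma Decouples.visitProb_le (hD : Decouples P c L θ) (hθ : ∀ t, θ t ≠ ∞)
    (hP : TranslationInvariant P) (hpos : goodMass P κ c ≠ 0) (hκ : 0 < κ) (h2 : 2 * (d * κ) < 1)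
    (k : ℕ) (x : Site d) :
    visitProb P κ c L (k + 1) x ≤
      θ L * θ L * ∑' z, regDist P κ c L k z * segVisit P κ c L (x - z) := by
  classical
  have hc := one_le_of_goodMass hpos
  have hc0 : 0 ≤ c := by linarith
  set E : List (Seg d c L) → Set (Track d) := fun a =>
    ⋃ w : Seg d c L, if x - pos (segWord a) ∈ sites w.1 then listEvent c a (segEvent c w.1) else ∅
    with hE
  have hEm : ∀ a, MeasurableSet (E a) := by
    intro a
    refine MeasurableSet.iUnion fun w => ?_
    split_ifs
    · exact measurableSet_listEvent a (measurableSet_segEvent c w.1)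
    · exact MeasurableSet.empty
  have hF : MeasurableSet {σ | ∃ a : List (Seg d c L), a.length = k ∧ σ ∈ E a} := by
    have : {σ | ∃ a : List (Seg d c L), a.length = k ∧ σ ∈ E a} =
        ⋃ a : List (Seg d c L), ⋃ _ : a.length = k, E a := by ext σ; simp
    rw [this]
    exact MeasurableSet.iUnion fun a => MeasurableSet.iUnion fun _ => hEm a
  have hfin := hD.regTime_lt_top hP hθ hκ h2 hpos (k + 1)
  have h1 : visitProb P κ c L (k + 1) x ≤ hatLaw P κ c {y | regTime c L (k + 1) y < ⊤ ∧
      ∃ m : ℕ, regTime c L k y ≤ m ∧ (m : ℕ∞) < regTime c L (k + 1) y ∧ y.2 m = x} := by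
    refine measure_mono_ae ?_
    filter_upwards [hfin] with y hy hy'
    exact ⟨hy, hy'⟩
  refine h1.trans ((hatLaw_le P κ c hF fun ε X σ hm h0 hg hy => ?_).trans ?_)
  · obtain ⟨ω, hlt, m, hm1, hm2, hX⟩ := hy
    change tau c L ε X (k + 1) < ⊤ at hlt
    change tau c L ε X k ≤ m at hm1
    change (m : ℕ∞) < tau c L ε X (k + 1) at hm2
    change X m = x at hX
    obtain ⟨N, hN⟩ := ENat.ne_top_iff_exists.1 (ne_top_of_le_ne_top (ENat.natCast_ne_top m) hm1)
    obtain ⟨a, ha, hseg, hgN⟩ := hm.tau_spec hc hg k N hN.symm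
    have hsucc : tau c L ε X (k + 1) = N + tauOne c L (shiftCoins N ε) (shiftPath N X) := by
      have h5 : tau c L ε X (k + 1) = tau c L ε X k +
        tauOne c L (shiftCoins (tau c L ε X k).toNat ε) (shiftPath (tau c L ε X k).toNat X) := rfl
      rwa [← hN, ENat.toNat_natCast] at h5
    have hne : tauOne c L (shiftCoins N ε) (shiftPath N X) ≠ ⊤ := by
      intro htop
      rw [hsucc, htop] at hlt
      simp at hlt
    obtain ⟨l, hl⟩ := ENat.ne_top_iff_exists.1 hne
    rw [hsucc, ← hl] at hm2
    rw [← hN] at hm1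
    norm_cast at hm1 hm2
    have hreg := ((hm.shift N).tauOne_first hc).1 hl.symm
    set w : Seg d c L := ⟨_, (isSeg_iff hc0 hreg.1.2).2 ⟨hgN, hreg⟩⟩ with hw
    refine ⟨a, ha, Set.mem_iUnion.2 ⟨w, ?_⟩⟩
    have hsite : x - pos (segWord a) ∈ sites w.1 := by
      refine mem_sites.2 ⟨m - N, ?_, ?_⟩
      · simp only [hw, length_pre]; omega
      · simp only [hw]
        rw [pre_take _ (by omega), ← hX, hm.path m, h0, zero_add, hseg,
          show m = N + (m - N) by omega, trackPath_add, Nat.add_sub_cancel_left]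
        exact (add_sub_cancel_left _ _).symm
    rw [if_pos hsite]
    refine mem_listEvent hseg ((mem_segEvent hc0 w _).2 ?_)
    simp only [hw, length_pre]
    exact ⟨trivial, hgN, hreg⟩
  · set F : List (Seg d c L) → ℝ≥0∞ := fun a =>
      (goodMass P κ c)⁻¹ * ∫⁻ ω, relWeight κ (segWord a) ω * goodProb κ c ω ∂P with hFdef
    have h3 : ∀ a : List (Seg d c L), (goodMass P κ c)⁻¹ * trackLaw P κ (E a) ≤
        θ L * θ L * (F a * segVisit P κ c L (x - pos (segWord a))) := by
      intro a
      refine (mul_le_mul_right (measure_iUnion_le _) _).trans ?_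
      rw [segVisit, ← ENNReal.tsum_mul_left, ← ENNReal.tsum_mul_left, ← ENNReal.tsum_mul_left]
      refine ENNReal.tsum_le_tsum fun w => ?_
      split_ifs with h
      · rw [listEvent, hP.trackLaw_markov κ _ (measurableSet_segEvent c w.1)]
        refine le_trans (le_of_eq ?_)
          (hD.lintegral_relWeight_mul_le hθ hpos hκ h2 hc0 a w)
        simp_rw [segProb_eq]
        rfl
      · simp
    calc (goodMass P κ c)⁻¹ * trackLaw P κ {σ | ∃ a : List (Seg d c L), a.length = k ∧ σ ∈ E a}
        ≤ (goodMass P κ c)⁻¹ * listSum k fun a => trackLaw P κ (E a) :=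
          mul_le_mul_right (measure_exists_list_le _ k E) _
      _ ≤ θ L * θ L * listSum k fun a => F a * segVisit P κ c L (x - pos (segWord a)) := by
          rw [← listSum_mul_left, ← listSum_mul_left]
          exact listSum_mono fun a _ => h3 a
      _ = θ L * θ L * ∑' z, regDist P κ c L k z * segVisit P κ c L (x - z) := by
          congr 1
          simp only [regDist, energy, ← listSum_mul_left]
          have h5 : ∀ z, listSum k (fun a : List (Seg d c L) => (goodMass P κ c)⁻¹ *
              ∫⁻ ω, relWeight κ (segWord a) ω * (if pos (segWord a) = z then 1 else 0) *
                goodProb κ c ω ∂P) * segVisit P κ c L (x - z) =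
              listSum k (fun a : List (Seg d c L) => (if pos (segWord a) = z then F a else 0) *
                segVisit P κ c L (x - z)) := by
            intro z
            rw [mul_comm, ← listSum_mul_left]
            refine listSum_congr fun a _ => ?_
            rw [mul_comm]
            congr 1
            split_ifs
            · simp [hFdef]
            · simp
          simp_rw [h5]
          rw [← listSum_tsum]
          refine listSum_congr fun a _ => ?_
          rw [tsum_eq_single (pos (segWord a))]
          · simp
          · intro z hz
            simp [hz.symm]

/-- `energy_le` starts from the indicator of `x` in the position variable, with no memory and mass
`1`. With `ρ = 1/4 + 1/8 = 3/8` and `B = 2^n` the error is `(3/4)^n`. -/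
lemma Decouples.regDist_le (hD : Decouples P c L θ) (hθ : ∀ t, θ t ≠ ∞) (hθ1 : ∀ t, 1 ≤ θ t)
    (hP : TranslationInvariant P) (hpos : goodMass P κ c ≠ 0) (hκ : 0 < κ)
    (hell : UniformlyElliptic P κ) (hL : 1 ≤ L)
    {p q : ℕ → ℝ≥0∞} (hpq : ∀ j, p j + q j = 1)
    (hp : ∀ j, p j ≤ (θ ((j + 1) * L) * θ ((j + 1) * L))⁻¹)
    (hq : ∑' j, q j * 4 ^ (j + 1) ≤ ENNReal.ofReal (1 / 8)) :
    ∃ C : ℝ, 0 < C ∧ ∀ n : ℕ, 1 ≤ n → ∀ x,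
      regDist P κ c L n x ≤ ENNReal.ofReal (C * (n : ℝ) ^ (-(d : ℝ) / 2)) := by
  classical
  have hc := one_le_of_goodMass hpos
  have hc0 : 0 ≤ c := by linarith
  have h2 := hell.two_mul_lt_one
  have hsum := hD.tsum_segMass hP hc0 hθ hκ h2 hpos
  obtain ⟨C₁, hC₁, hloc⟩ := regOp_pow_le hP hL hκ hell hpos hsum
  obtain ⟨C₂, hC₂, hexp⟩ := exp_neg_le_rpow d (q := -Real.log (3 / 4))
    (by have := Real.log_neg (x := 3 / 4) (by norm_num) (by norm_num); linarith)
  refine ⟨C₁ * (1 / 2) ^ (-(d : ℝ) / 2) + C₂, by positivity, fun n hn x => ?_⟩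
  have hn0 : (0 : ℝ) < n := by exact_mod_cast hn
  have hd0 : -(d : ℝ) / 2 ≤ 0 := by
    have : (0 : ℝ) ≤ d := by positivity
    linarith
  -- The local bound is used for `m ≥ n/2`. For fewer independent steps the trivial bound `1 ≤
  -- 2^(n-2m)` is charged to the exponential term.
  have hAB : ∀ m (g : Site d → ℝ≥0∞) s, ∑' x, g x ≠ ∞ → (regOp P κ c L ^ m) g s ≤
      (ENNReal.ofReal (C₁ * (n / 2 : ℝ) ^ (-(d : ℝ) / 2)) + 2 ^ n * 4⁻¹ ^ m) * ∑' x, g x := by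
    intro m g s hg
    rcases le_or_gt n (2 * m) with h | h
    · refine (hloc m (by omega) g s hg).trans (mul_le_mul_left ?_ _)
      refine le_trans (ENNReal.ofReal_le_ofReal ?_) le_self_add
      refine mul_le_mul_of_nonneg_left ?_ hC₁.le
      refine Real.rpow_le_rpow_of_nonpos (by positivity) ?_ hd0
      have : (n : ℝ) ≤ 2 * m := by exact_mod_cast h
      linarith
    · have h3 : (regOp P κ c L ^ m) g s ≤ ∑' x, g x := by
        rw [← tsum_convOp_pow hsum (fun w => pos w.1) m g]
        exact ENNReal.le_tsum s
      refine h3.trans (le_mul_of_one_le_left zero_le (le_trans ?_ le_add_self))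
      have h4 : (2 : ℝ≥0∞) ^ n * 4⁻¹ ^ m = 2 ^ (n - 2 * m) := by
        have h5 : (4 : ℝ≥0∞) ^ m * 4⁻¹ ^ m = 1 := by
          rw [← mul_pow, ENNReal.mul_inv_cancel (by norm_num) (by norm_num), one_pow]
        have h6 : (2 : ℝ≥0∞) ^ (2 * m) = 4 ^ m := by rw [pow_mul]; norm_num
        rw [← Nat.sub_add_cancel h.le, pow_add, h6, mul_assoc, h5, mul_one]
        simp
      rw [h4]
      exact one_le_pow₀ (by norm_num)
  have hG : RecentPast (c := c) (L := L) P 0 1 fun _ s _ => if s = x then 1 else 0 := by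
    refine ⟨fun a s => measurable_const, fun a => rfl, fun a s ω ω' _ => rfl, fun a => ?_⟩
    exact Eventually.of_forall fun ω => by simp
  have hρ : (4⁻¹ : ℝ≥0∞) + ENNReal.ofReal (1 / 8) ≤ ENNReal.ofReal (3 / 8) := by
    have h4 : (4⁻¹ : ℝ≥0∞) = ENNReal.ofReal (1 / 4) := by
      rw [ENNReal.ofReal_div_of_pos (by norm_num)]; simp
    rw [h4, ← ENNReal.ofReal_add (by norm_num) (by norm_num)]
    exact ENNReal.ofReal_le_ofReal (by norm_num)
  have key := hD.energy_le hθ hθ1 hc0 hP hpos hκ h2 (hD.tsum_segProb hP hc0 hθ hκ h2 hpos) hAB hpq hp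
    hq hρ n 0 0 ENNReal.one_ne_top hG
  rw [Function.iterate_zero, id, one_mul, pow_zero, pow_zero, mul_one, mul_one] at key
  rw [regDist]
  refine (mul_le_mul_right key _).trans ?_
  rw [← mul_assoc, ENNReal.inv_mul_cancel hpos (goodMass_ne_top P κ c), one_mul]
  have h3 : (2 : ℝ≥0∞) = ENNReal.ofReal 2 := by simp
  rw [h3, ← mul_pow, ← ENNReal.ofReal_mul (by norm_num), ← ENNReal.ofReal_pow (by norm_num),
    ← ENNReal.ofReal_add (by positivity) (by positivity)]
  refine ENNReal.ofReal_le_ofReal ?_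
  rw [add_mul]
  refine add_le_add (le_of_eq ?_) ?_
  · rw [mul_assoc, ← Real.mul_rpow (by norm_num) hn0.le]
    congr 2
    ring
  · refine le_trans (le_of_eq ?_) (hexp n hn)
    rw [neg_neg, show (2 : ℝ) * (3 / 8) = 3 / 4 by norm_num, ← Real.rpow_natCast,
      Real.rpow_def_of_pos (by norm_num)]

lemma Decouples.estimates (hD : Decouples P c L θ) (hθ : ∀ t, θ t ≠ ∞) (hθ1 : ∀ t, 1 ≤ θ t)
    (hP : TranslationInvariant P) (hpos : goodMass P κ c ≠ 0) (hκ : 0 < κ)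
    (hell : UniformlyElliptic P κ) (hL : 1 ≤ L)
    {p q : ℕ → ℝ≥0∞} (hpq : ∀ j, p j + q j = 1)
    (hp : ∀ j, p j ≤ (θ ((j + 1) * L) * θ ((j + 1) * L))⁻¹)
    (hq : ∑' j, q j * 4 ^ (j + 1) ≤ ENNReal.ofReal (1 / 8)) :
    ∃ C : ℝ, 0 < C ∧ ∀ n : ℕ, 1 ≤ n →
      (∀ x : Site d, hatLaw P κ c (regPosition c L n x) ≤
        ENNReal.ofReal (C * (n : ℝ) ^ (-(d : ℝ) / 2))) ∧
      ∑' x : Site d, visitProb P κ c L n x ^ 2 ≤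
        ENNReal.ofReal (C * (n : ℝ) ^ (-(d : ℝ) / 2)) * meanTau P κ c L ^ 2 := by
  have hc := one_le_of_goodMass hpos
  have hc0 : 0 ≤ c := by linarith
  have h2 := hell.two_mul_lt_one
  obtain ⟨C, hC, hreg⟩ := hD.regDist_le hθ hθ1 hP hpos hκ hell hL hpq hp hq
  set C' : ℝ := max 1 (C * (1 / 2) ^ (-(d : ℝ) / 2)) with hC'
  have hC'0 : 0 < C' := lt_of_lt_of_le one_pos (le_max_left _ _)
  have hd0 : -(d : ℝ) / 2 ≤ 0 := by
    have : (0 : ℝ) ≤ d := by positivity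
    linarith
  -- `Q(n, ·)` starts at `τ_{n-1}`: pass from `k = n - 1` to `k + 1` using `k ≥ (k+1)/2`, with the
  -- trivial bound `1` at `k = 0`.
  have hprev : ∀ k z, regDist P κ c L k z ≤
      ENNReal.ofReal (C' * ((k + 1 : ℕ) : ℝ) ^ (-(d : ℝ) / 2)) := by
    intro k z
    rcases Nat.eq_zero_or_pos k with rfl | hk
    · refine (ENNReal.le_tsum z).trans ((hD.tsum_regDist_le hθ hP hpos hκ h2 hc0 0).trans ?_)
      rw [← ENNReal.ofReal_one]
      refine ENNReal.ofReal_le_ofReal ?_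
      simp [hC']
    · refine (hreg k hk z).trans (ENNReal.ofReal_le_ofReal ?_)
      have hk1 : (1 : ℝ) ≤ k := by exact_mod_cast hk
      calc C * (k : ℝ) ^ (-(d : ℝ) / 2)
          ≤ C * (1 / 2 * ((k + 1 : ℕ) : ℝ)) ^ (-(d : ℝ) / 2) := by
            refine mul_le_mul_of_nonneg_left ?_ hC.le
            refine Real.rpow_le_rpow_of_nonpos (by positivity) ?_ hd0
            push_cast
            linarith
        _ = C * (1 / 2) ^ (-(d : ℝ) / 2) * ((k + 1 : ℕ) : ℝ) ^ (-(d : ℝ) / 2) := by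
            rw [Real.mul_rpow (by norm_num) (by positivity), mul_assoc]
        _ ≤ C' * ((k + 1 : ℕ) : ℝ) ^ (-(d : ℝ) / 2) := by
            gcongr
            exact le_max_right _ _
  set Θ : ℝ := ((θ L * θ L) ^ 2).toReal with hΘ
  have hΘeq : ENNReal.ofReal Θ = (θ L * θ L) ^ 2 :=
    ENNReal.ofReal_toReal (ENNReal.pow_ne_top (ENNReal.mul_ne_top (hθ L) (hθ L)))
  have hΘ0 : 0 ≤ Θ := ENNReal.toReal_nonneg
  refine ⟨C + Θ * C', by positivity, fun n hn => ⟨fun x => ?_, ?_⟩⟩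
  · refine (regPosition_le hP hpos n x).trans ((hreg n hn x).trans (ENNReal.ofReal_le_ofReal ?_))
    gcongr
    exact le_add_of_nonneg_right (by positivity)
  · obtain ⟨k, rfl⟩ : ∃ k, n = k + 1 := ⟨n - 1, by omega⟩
    calc ∑' x : Site d, visitProb P κ c L (k + 1) x ^ 2
        ≤ ∑' x : Site d, (θ L * θ L) ^ 2 *
          (∑' z, regDist P κ c L k z * segVisit P κ c L (x - z)) ^ 2 := by
          refine ENNReal.tsum_le_tsum fun x => ?_
          rw [← mul_pow]
          exact pow_le_pow_left' (hD.visitProb_le hθ hP hpos hκ h2 k x) 2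
      _ = (θ L * θ L) ^ 2 * ∑' x : Site d,
          (∑' z, regDist P κ c L k z * segVisit P κ c L (x - z)) ^ 2 := ENNReal.tsum_mul_left
      _ ≤ (θ L * θ L) ^ 2 * (ENNReal.ofReal (C' * ((k + 1 : ℕ) : ℝ) ^ (-(d : ℝ) / 2)) *
          (∑' y, segVisit P κ c L y) ^ 2) :=
          mul_le_mul_right (tsum_conv_sq_le (hprev k) (hD.tsum_regDist_le hθ hP hpos hκ h2 hc0 k)) _
      _ ≤ (θ L * θ L) ^ 2 * (ENNReal.ofReal (C' * ((k + 1 : ℕ) : ℝ) ^ (-(d : ℝ) / 2)) *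
          meanTau P κ c L ^ 2) :=
          mul_le_mul_right (mul_le_mul_right (pow_le_pow_left' (tsum_segVisit_le hpos) 2) _) _
      _ ≤ ENNReal.ofReal ((C + Θ * C') * ((k + 1 : ℕ) : ℝ) ^ (-(d : ℝ) / 2)) *
          meanTau P κ c L ^ 2 := by
          rw [← mul_assoc, ← hΘeq, ← ENNReal.ofReal_mul hΘ0, ← mul_assoc]
          refine mul_le_mul_left (ENNReal.ofReal_le_ofReal ?_) _
          gcongr
          exact le_add_of_nonneg_left hC.le

end positions

/-! ## The choice of `L` -/

lemma exists_large {a D : ℝ} (ha : 0 < a) (hD : 0 ≤ D) (r : ℕ) :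
    ∃ L₀ : ℕ, r ≤ L₀ ∧ 1 ≤ L₀ ∧ ∀ L : ℕ, L₀ ≤ L →
      4 * Real.exp (-a * L) ≤ 1 / 2 ∧ 8 * D * Real.exp (-a * L) ≤ 1 / 16 := by
  have h1 : Tendsto (fun L : ℕ => Real.exp (-a * L)) atTop (𝓝 0) := by
    refine Real.tendsto_exp_atBot.comp ?_
    exact tendsto_natCast_atTop_atTop.const_mul_atTop_of_neg (neg_neg_of_pos ha)
  have h2 : Tendsto (fun L : ℕ => 4 * Real.exp (-a * L)) atTop (𝓝 0) := by
    simpa using h1.const_mul 4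
  have h3 : Tendsto (fun L : ℕ => 8 * D * Real.exp (-a * L)) atTop (𝓝 0) := by
    simpa using h1.const_mul (8 * D)
  have h4 := (h2.eventually (eventually_le_nhds (show (0 : ℝ) < 1 / 2 by norm_num))).and
    (h3.eventually (eventually_le_nhds (show (0 : ℝ) < 1 / 16 by norm_num)))
  obtain ⟨N, hN⟩ := eventually_atTop.1 h4
  exact ⟨max (max r 1) N, (le_max_left r 1).trans (le_max_left _ _),
    (le_max_right r 1).trans (le_max_left _ _), fun L hL => hN L ((le_max_right _ _).trans hL)⟩

/-- With `x = exp (-a L)`, take `p j = θ((j+1)L)^{-2} = exp (-2D x^{j+1})`. Then `q j ≤ 2D x^{j+1}`,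
and the weighted sum is at most the geometric series `∑ 8Dx (4x)^j ≤ (1/16) · 2`. Taking `L` large
makes both `4x ≤ 1/2` and `8Dx ≤ 1/16`. -/
lemma exists_weights {a D : ℝ} (hD : 0 ≤ D) {L : ℕ}
    (h1 : 4 * Real.exp (-a * L) ≤ 1 / 2) (h2 : 8 * D * Real.exp (-a * L) ≤ 1 / 16)
    {θ : ℕ → ℝ≥0∞} (hθ : θ = fun t : ℕ => ENNReal.ofReal (Real.exp (D * Real.exp (-a * t)))) :
    ∃ p q : ℕ → ℝ≥0∞, (∀ j, p j + q j = 1) ∧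
      (∀ j, p j ≤ (θ ((j + 1) * L) * θ ((j + 1) * L))⁻¹) ∧
      ∑' j, q j * 4 ^ (j + 1) ≤ ENNReal.ofReal (1 / 8) := by
  set x := Real.exp (-a * L) with hx
  have hx0 : 0 < x := Real.exp_pos _
  have hexp : ∀ j : ℕ, Real.exp (-a * (((j + 1) * L : ℕ) : ℝ)) = x ^ (j + 1) := by
    intro j
    rw [hx, ← Real.exp_nat_mul]
    congr 1
    push_cast
    ring
  have hle : ∀ j : ℕ, Real.exp (-(2 * D * x ^ (j + 1))) ≤ 1 := fun j => by
    rw [Real.exp_le_one_iff]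
    have : 0 ≤ 2 * D * x ^ (j + 1) := by positivity
    linarith
  refine ⟨fun j => ENNReal.ofReal (Real.exp (-(2 * D * x ^ (j + 1)))),
    fun j => ENNReal.ofReal (1 - Real.exp (-(2 * D * x ^ (j + 1)))), fun j => ?_, fun j => ?_, ?_⟩
  · rw [← ENNReal.ofReal_add (Real.exp_pos _).le (by linarith [hle j])]
    simp
  · rw [hθ]
    simp only [hexp]
    rw [← ENNReal.ofReal_mul (Real.exp_pos _).le, ← Real.exp_add,
      ← ENNReal.ofReal_inv_of_pos (Real.exp_pos _), ← Real.exp_neg]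
    refine ENNReal.ofReal_le_ofReal (Real.exp_le_exp.2 ?_)
    linarith
  · have h3 : ∀ j : ℕ, ENNReal.ofReal (1 - Real.exp (-(2 * D * x ^ (j + 1)))) * 4 ^ (j + 1) ≤
        ENNReal.ofReal (1 / 16) * 2⁻¹ ^ j := by
      intro j
      have h4 : (4 : ℝ≥0∞) = ENNReal.ofReal 4 := by simp
      have h5 : (2⁻¹ : ℝ≥0∞) = ENNReal.ofReal (1 / 2) := by
        rw [ENNReal.ofReal_div_of_pos two_pos]; simp
      rw [h4, h5, ← ENNReal.ofReal_pow (by norm_num), ← ENNReal.ofReal_pow (by norm_num),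
        ← ENNReal.ofReal_mul (by linarith [hle j]), ← ENNReal.ofReal_mul (by norm_num)]
      refine ENNReal.ofReal_le_ofReal ?_
      have h6 : 1 - Real.exp (-(2 * D * x ^ (j + 1))) ≤ 2 * D * x ^ (j + 1) := by
        have := Real.add_one_le_exp (-(2 * D * x ^ (j + 1)))
        linarith
      calc (1 - Real.exp (-(2 * D * x ^ (j + 1)))) * 4 ^ (j + 1)
          ≤ 2 * D * x ^ (j + 1) * 4 ^ (j + 1) := by gcongr
        _ = 8 * D * x * (4 * x) ^ j := by
            rw [pow_succ, pow_succ, mul_pow]; ring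
        _ ≤ 1 / 16 * (1 / 2) ^ j := by gcongr
    refine (ENNReal.tsum_le_tsum h3).trans ?_
    have h7 : ∑' j : ℕ, (2⁻¹ : ℝ≥0∞) ^ j = 2 := ENNReal.tsum_geometric_two
    rw [ENNReal.tsum_mul_left, h7, show (2 : ℝ≥0∞) = ENNReal.ofReal 2 by simp,
      ← ENNReal.ofReal_mul (by norm_num)]
    exact ENNReal.ofReal_le_ofReal (by norm_num)

end RWRE

end

theorem theorem2p12 (d : ℕ) [NeZero d] (hd : 2 ≤ d)
    (P : Measure (RWRE.Env d)) [IsProbabilityMeasure P]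
    (hP : RWRE.TranslationInvariant P)
    (κ : ℝ) (hκ : 0 < κ) (hell : RWRE.UniformlyElliptic P κ)
    (r : ℕ) (hr : 1 ≤ r) (hG : RWRE.ConditionG P r)
    (v : ℝ) (hv : RWRE.IsSpeed P v) (hvpos : 0 < v) :
    (∃ c₅ : ℝ, 0 < c₅ ∧ 0 < RWRE.annealedLaw P {y | RWRE.stopR c₅ y.2 = ⊤}) ∧
    ∀ c₅ : ℝ, 0 < c₅ → 0 < RWRE.annealedLaw P {y | RWRE.stopR c₅ y.2 = ⊤} →
      ∃ L₀ : ℕ, ∀ L : ℕ, L₀ ≤ L →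
        (∀ n : ℕ, ∀ᵐ y ∂(RWRE.hatLaw P κ c₅), RWRE.regTime c₅ L n y < ⊤) ∧
        ∃ C : ℝ, 0 < C ∧ ∀ n : ℕ, 1 ≤ n →
          (∀ x : RWRE.Site d, RWRE.hatLaw P κ c₅ (RWRE.regPosition c₅ L n x) ≤
            ENNReal.ofReal (C * (n : ℝ) ^ (-(d : ℝ) / 2))) ∧
          ∑' x : RWRE.Site d, RWRE.visitProb P κ c₅ L n x ^ 2 ≤
            ENNReal.ofReal (C * (n : ℝ) ^ (-(d : ℝ) / 2)) * RWRE.meanTau P κ c₅ L ^ 2 := by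
  simp_rw [RWRE.annealedLaw_stopR hκ hell]
  refine ⟨?_, fun c hc hgood => ?_⟩
  · obtain ⟨c, hc⟩ := RWRE.exists_goodMass_ne_zero hP hκ hell hv hvpos
    exact ⟨c, by linarith [RWRE.one_le_of_goodMass hc], pos_iff_ne_zero.2 hc⟩
  · obtain ⟨a, ha, D, hD, hdec⟩ := RWRE.exists_decouples hr hG hc.le
    obtain ⟨L₀, hrL, h1L, hL₀⟩ := RWRE.exists_large ha hD r
    refine ⟨L₀, fun L hL => ?_⟩
    obtain ⟨p, q, hpq, hp, hq⟩ := RWRE.exists_weights hD (hL₀ L hL).1 (hL₀ L hL).2 rfl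
    have hθ : ∀ t : ℕ, ENNReal.ofReal (Real.exp (D * Real.exp (-a * t))) ≠ ∞ :=
      fun t => ENNReal.ofReal_ne_top
    have hθ1 : ∀ t : ℕ, 1 ≤ ENNReal.ofReal (Real.exp (D * Real.exp (-a * t))) := fun t => by
      rw [ENNReal.one_le_ofReal, Real.one_le_exp_iff]
      positivity
    have hDL := hdec L (hrL.trans hL)
    exact ⟨fun n => hDL.regTime_lt_top hP hθ hκ hell.two_mul_lt_one hgood.ne' n,
      hDL.estimates hθ hθ1 hP hgood.ne' hκ hell (h1L.trans hL) hpq hp hq⟩
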